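/- Let $K$ be a field and $d\in K$. The Temperley–Lieb category over $K$ with loop parameter $d$ has as objects the non-negative integers; $\mathrm{Hom}(m,n)$ is the $K$-vector space whose basis is the set of $(m,n)$-diagrams, that is, of pairings of $m$ points on the top edge and $n$ points on the bottom edge of a rectangle by pairwise non-crossing strands (diagrams that induce the same pairing are identified). The composition $ba$ of diagrams $a\in\mathrm{Hom}(l,m)$ and $b\in\mathrm{Hom}(m,n)$ is obtained by putting $a$ on top of $b$, removing all closed loops, and multiplying by $d^{r}$, where $r$ is the number of removed loops; the tensor product is horizontal juxtaposition; both are extended bilinearly. The trace $\mathrm{Tr}:\mathrm{End}(n)\to K$ is the linear map that sends a diagram $a$ to $d^{c(a)}$, where $c(a)$ is the number of closed loops obtained by joining the $i$-th top point to the $i$-th bottom point for all $i$. A morphism $a\in \mathrm{Hom}(m,n)$ is negligible if $\mathrm{Tr}(ab)=0$ for all $b\in\mathrm{Hom}(n,m)$. A (tensor) ideal is a family of subspaces $J(m,n)\subseteq\mathrm{Hom}(m,n)$, $m,n\ge 0$, that is closed under composition and under tensor product, on either side, with arbitrary morphisms; it is proper if it does not contain all morphisms. For $d\in\mathbb C$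 let $\mathrm{TL}_d$ be this category over $K=\mathbb C$, and let $\mathrm{TL}$ (the generic category) be this category over $K=\mathbb C(t)$ with loop parameter $t+t^{-1}$. Call $d\in\mathbb C$ special if $d=2\cos(j\pi/n)$ for some integers $n\ge 3$ and $j$ with $j$ coprime to $n$. **Theorem.** 1. If $d\in\mathbb C$ is special, then $\mathrm{TL}_d$ has exactly one non-zero proper tensor ideal, namely the ideal of negligible morphisms. 2. If $d\in\mathbb C$ is non-zero and not special, then $\mathrm{TL}_d$ has no non-zero proper tensor ideal. 3. The generic category $\mathrm{TL}$ has no non-zero proper tensor ideal. 4. For $\tau\in\mathbb C\setminus\{0\}$, the number $d=\tau+\tau^{-1}$ is special if and only if $\tau$ is a proper root of unity, that is, a root of unity with $\tau\notin\{1,-1,i,-i\}$. -/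

import Mathlib

namespace TemperleyLieb

/-! ### Planar diagrams -/

/-- Position of a marked point on the boundary of the rectangle, read clockwise from the top left
corner: first the `m` points of the top edge from left to right, then the `n` points of the bottom
edge from right to left. -/
def pos {m n : ℕ} : Fin m ⊕ Fin n → ℕ
  | Sum.inl i => (i : ℕ)
  | Sum.inr j => m + (n - 1 - (j : ℕ))

/-- An `(m, n)`-diagram (up to equivalence): a pairing of the `m` points of the top edge and the
`n` points of the bottom edge of a rectangle by pairwise non-crossing strands. `pair x` is the other
end point of the strand that starts at `x`. -/
@[ext]
structure Diagram (m n : ℕ) where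
  pair : Fin m ⊕ Fin n → Fin m ⊕ Fin n
  pair_pair : ∀ x, pair (pair x) = x
  pair_ne : ∀ x, pair x ≠ x
  noncrossing : ∀ x y, ¬ (pos x < pos y ∧ pos y < pos (pair x) ∧ pos (pair x) < pos (pair y))

/-! ### Vertical juxtaposition

A diagram `a` from `l` to `m` is put on top of a diagram `b` from `m` to `n`. The marked points of
the resulting picture are `Fin l ⊕ (Fin m ⊕ Fin n)`: top, middle, bottom. -/

/-- The points of the upper rectangle among all points of the juxtaposition. -/
def upper {l m n : ℕ} : Fin l ⊕ Fin m → Fin l ⊕ (Fin m ⊕ Fin n)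
  | Sum.inl i => Sum.inl i
  | Sum.inr k => Sum.inr (Sum.inl k)

/-- The points of the lower rectangle among all points of the juxtaposition. -/
def lower {l m n : ℕ} : Fin m ⊕ Fin n → Fin l ⊕ (Fin m ⊕ Fin n) := Sum.inr

/-- The points on the top and bottom edges of the juxtaposition. -/
def outer {l m n : ℕ} : Fin l ⊕ Fin n → Fin l ⊕ (Fin m ⊕ Fin n)
  | Sum.inl i => Sum.inl i
  | Sum.inr j => Sum.inr (Sum.inr j)

/-- Two points of the juxtaposition of `a` (above) and `b` (below) are linked if a strand of `a` or
of `b` joins them. -/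
inductive Link {l m n : ℕ} (b : Diagram m n) (a : Diagram l m) :
    Fin l ⊕ (Fin m ⊕ Fin n) → Fin l ⊕ (Fin m ⊕ Fin n) → Prop
  | up (x : Fin l ⊕ Fin m) : Link b a (upper x) (upper (a.pair x))
  | low (y : Fin m ⊕ Fin n) : Link b a (lower y) (lower (b.pair y))

/-- The connected components (curves) of the juxtaposition. -/
def Curve {l m n : ℕ} (b : Diagram m n) (a : Diagram l m) : Type := Quot (Link b a)

/-- The curve through a point of the juxtaposition. -/
def curve {l m n : ℕ} (b : Diagram m n) (a : Diagram l m) (v : Fin l ⊕ (Fin m ⊕ Fin n)) :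
    Curve b a := Quot.mk _ v

/-- The number of closed loops of the juxtaposition: the curves without end point on the top or the
bottom edge. -/
noncomputable def loops {l m n : ℕ} (b : Diagram m n) (a : Diagram l m) : ℕ :=
  Nat.card {c : Curve b a // ∀ x, curve b a (outer x) ≠ c}

/-- In a finite orbit of two involutions that contains an end (a fixed point of one of them)
there is exactly one other end. -/
theorem existsUnique_other_end {V : Type*} [Finite V] (A B : Equiv.Perm V)
    (hA : ∀ v, A (A v) = v) (hB : ∀ v, B (B v) = v) (x : V) (hBx : B x = x) (hAx : A x ≠ x) :
    ∃! y, y ≠ x ∧ (A y = y ∨ B y = y) ∧ ∃ k : ℤ, y = ((B * A) ^ k) x := by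
  set σ := B * A with hσ
  have hAA : A * A = 1 := Equiv.ext hA
  have hBB : B * B = 1 := Equiv.ext hB
  have hAi : A⁻¹ = A := inv_eq_of_mul_eq_one_left hAA
  have hBi : B⁻¹ = B := inv_eq_of_mul_eq_one_left hBB
  have hconj : B * σ * B⁻¹ = σ⁻¹ := by
    rw [hσ, mul_inv_rev, hAi, hBi, ← mul_assoc, hBB, one_mul]
  have hBk (k : ℤ) : B ((σ ^ k) x) = (σ ^ (-k)) x := by
    have h1 : B * σ ^ k * B⁻¹ = σ ^ (-k) := by
      rw [← conj_zpow, hconj, inv_zpow, zpow_neg]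
    have h2 : B * σ ^ k = σ ^ (-k) * B := by rw [← h1]; group
    calc B ((σ ^ k) x) = (B * σ ^ k) x := rfl
      _ = (σ ^ (-k)) (B x) := by rw [h2]; rfl
      _ = _ := by rw [hBx]
  have hAk (k : ℤ) : A ((σ ^ k) x) = (σ ^ (-(k + 1))) x := by
    rw [← hBk, add_comm, zpow_add, zpow_one, hσ]
    simp [Equiv.Perm.mul_apply, hB]
  set p : ℕ := Function.minimalPeriod (σ • · : V → V) x with hp
  have hpd (k : ℤ) : (σ ^ k) x = x ↔ (p : ℤ) ∣ k :=
    MulAction.zpow_smul_eq_iff_minimalPeriod_dvd (a := σ) (b := x) (n := k)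
  have heq (i j : ℤ) : (σ ^ i) x = (σ ^ j) x ↔ (p : ℤ) ∣ i - j := by
    rw [← hpd, sub_eq_neg_add, zpow_add, Equiv.Perm.mul_apply, zpow_neg,
      Equiv.Perm.inv_eq_iff_eq]
  have hp0 : 0 < p := by
    have := isOfFinOrder_of_finite σ
    obtain ⟨N, hN, h⟩ := this.exists_pow_eq_one
    have h3 : (σ ^ (N : ℤ)) x = x := by rw [zpow_natCast, h]; rfl
    rw [hpd] at h3
    rcases Nat.eq_zero_or_pos p with h0 | h0
    · rw [h0] at h3; simp at h3; omega
    · exact h0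
  have hp1 : p ≠ 1 := by
    intro h1
    apply hAx
    have := hAk 0
    rw [zpow_zero, Equiv.Perm.one_apply] at this
    rw [this, hpd, h1]
    simp
  have hfA (k : ℤ) : A ((σ ^ k) x) = (σ ^ k) x ↔ (p : ℤ) ∣ 2 * k + 1 := by
    rw [hAk, heq, ← dvd_neg]; ring_nf
  have hfB (k : ℤ) : B ((σ ^ k) x) = (σ ^ k) x ↔ (p : ℤ) ∣ 2 * k := by
    rw [hBk, heq, ← dvd_neg]; ring_nf
  have hne (k : ℤ) : (σ ^ k) x ≠ x ↔ ¬ (p : ℤ) ∣ k := not_congr (hpd k)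
  refine ⟨(σ ^ ((p / 2 : ℕ) : ℤ)) x, ⟨?_, ?_, _, rfl⟩, ?_⟩
  · rw [hne]
    intro h
    have := Nat.le_of_dvd (by omega) (Int.natCast_dvd_natCast.mp h)
    omega
  · rw [hfA, hfB]
    rcases Nat.even_or_odd' p with ⟨c, hc | hc⟩
    · right
      have : (2 * ((p / 2 : ℕ) : ℤ)) = p := by omega
      rw [this]
    · left
      have : (2 * ((p / 2 : ℕ) : ℤ)) + 1 = p := by omega
      rw [this]
  · rintro y ⟨h1, h2, k, rfl⟩
    rw [hne] at h1
    rw [hfA, hfB] at h2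
    rw [heq]
    rcases Nat.even_or_odd' p with ⟨c, hc | hc⟩
    · have hc2 : p / 2 = c := by omega
      rw [hc2]
      rcases h2 with ⟨u, hu⟩ | ⟨u, hu⟩
      · exfalso
        have : 2 * k + 1 = 2 * (c * u) := by rw [hu, hc]; push_cast; ring
        omega
      · have hk : k = c * u := by
          have : 2 * k = 2 * (c * u) := by rw [hu, hc]; push_cast; ring
          omega
        rcases Int.even_or_odd' u with ⟨w, hw | hw⟩
        · exact absurd ⟨w, by rw [hk, hw, hc]; push_cast; ring⟩ h1
        · exact ⟨w, by rw [hk, hw, hc]; push_cast; ring⟩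
    · have hc2 : p / 2 = c := by omega
      rw [hc2]
      have hcop : IsCoprime (p : ℤ) 2 := by
        refine ⟨1, -c, ?_⟩
        rw [hc]; push_cast; ring
      rcases h2 with h | h
      · apply hcop.dvd_of_dvd_mul_left
        have : 2 * (k - c) = (2 * k + 1) - p := by rw [hc]; push_cast; ring
        rw [this]
        exact dvd_sub_self_right.mpr h
      · exact absurd (hcop.dvd_of_dvd_mul_left h) h1

/-- A curve of the juxtaposition that ends on the top or the bottom edge has exactly two ends. -/
theorem existsUnique_partner {l m n : ℕ} (b : Diagram m n) (a : Diagram l m) (x : Fin l ⊕ Fin n) :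
    ∃! y, y ≠ x ∧ curve b a (outer y) = curve b a (outer x) := by
  -- `A` moves along the strands of `a`, and `B` along the strands of `b`
  let fA : Fin l ⊕ (Fin m ⊕ Fin n) → Fin l ⊕ (Fin m ⊕ Fin n) := fun v => match v with
    | Sum.inl i => upper (a.pair (Sum.inl i))
    | Sum.inr (Sum.inl k) => upper (a.pair (Sum.inr k))
    | Sum.inr (Sum.inr j) => Sum.inr (Sum.inr j)
  let fB : Fin l ⊕ (Fin m ⊕ Fin n) → Fin l ⊕ (Fin m ⊕ Fin n) := fun v => match v with
    | Sum.inl i => Sum.inl i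
    | Sum.inr y => Sum.inr (b.pair y)
  have fA_upper : ∀ u, fA (upper u) = upper (a.pair u) := by rintro (i | k) <;> rfl
  have upper_inj : Function.Injective (upper : Fin l ⊕ Fin m → Fin l ⊕ (Fin m ⊕ Fin n)) := by
    rintro (i | k) (i' | k') h <;> simp_all [upper]
  have hfA : ∀ v, fA (fA v) = v := by
    rintro (i | k | j)
    · exact (fA_upper _).trans (by rw [a.pair_pair]; rfl)
    · exact (fA_upper _).trans (by rw [a.pair_pair]; rfl)
    · rfl
  have hfB : ∀ v, fB (fB v) = v := by
    rintro (i | y)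
    · rfl
    · exact congrArg Sum.inr (b.pair_pair y)
  let A : Equiv.Perm (Fin l ⊕ (Fin m ⊕ Fin n)) := ⟨fA, fA, hfA, hfA⟩
  let B : Equiv.Perm (Fin l ⊕ (Fin m ⊕ Fin n)) := ⟨fB, fB, hfB, hfB⟩
  have hA : ∀ v, A (A v) = v := hfA
  have hB : ∀ v, B (B v) = v := hfB
  have cA : ∀ v, curve b a (A v) = curve b a v := by
    rintro (i | k | j)
    · exact (Quot.sound (Link.up (Sum.inl i))).symm
    · exact (Quot.sound (Link.up (Sum.inr k))).symm
    · rfl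
  have cB : ∀ v, curve b a (B v) = curve b a v := by
    rintro (i | y)
    · rfl
    · exact (Quot.sound (Link.low y)).symm
  have fixA : ∀ v, A v = v ↔ ∃ j, v = outer (Sum.inr j) := by
    rintro (i | k | j)
    · constructor
      · intro h
        exact absurd (upper_inj h) (a.pair_ne (Sum.inl i))
      · rintro ⟨j, h⟩; simp [outer] at h
    · constructor
      · intro h
        exact absurd (upper_inj h) (a.pair_ne (Sum.inr k))
      · rintro ⟨j, h⟩; simp [outer] at h
    · exact ⟨fun _ => ⟨j, rfl⟩, fun _ => rfl⟩
  have fixB : ∀ v, B v = v ↔ ∃ i, v = outer (Sum.inl i) := by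
    rintro (i | y)
    · exact ⟨fun _ => ⟨i, rfl⟩, fun _ => rfl⟩
    · constructor
      · intro h
        exact absurd (Sum.inr_injective h) (b.pair_ne y)
      · rintro ⟨j, h⟩; simp [outer] at h
  have outer_inj : Function.Injective (outer : Fin l ⊕ Fin n → Fin l ⊕ (Fin m ⊕ Fin n)) := by
    rintro (i | k) (i' | k') h <;> simp_all [outer]
  have linkAB : ∀ v w, Link b a v w → w = A v ∨ w = B v := by
    rintro _ _ (u | y)
    · left; exact (fA_upper u).symm
    · right; rfl
  -- the argument is the same for top points and, with `A` and `B` exchanged, for bottom points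
  have key : ∀ C D : Equiv.Perm (Fin l ⊕ (Fin m ⊕ Fin n)), (∀ v, C (C v) = v) →
      (∀ v, D (D v) = v) → (∀ v, curve b a (C v) = curve b a v) →
      (∀ v, curve b a (D v) = curve b a v) → (∀ v w, Link b a v w → w = C v ∨ w = D v) →
      (∀ v, (C v = v ∨ D v = v) ↔ ∃ y, v = outer y) → D (outer x) = outer x →
      C (outer x) ≠ outer x → ∃! y, y ≠ x ∧ curve b a (outer y) = curve b a (outer x) := by
    intro C D hC hD cC cD link hfix hDx hCx
    have orb : ∀ v, curve b a v = curve b a (outer x) ↔ ∃ k : ℤ, v = ((D * C) ^ k) (outer x) := by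
      have sD : ∀ v, (∃ k : ℤ, v = ((D * C) ^ k) (outer x)) →
          ∃ k : ℤ, D v = ((D * C) ^ k) (outer x) := by
        rintro v ⟨k, rfl⟩
        refine ⟨-k, ?_⟩
        have hDi : D⁻¹ = D := inv_eq_of_mul_eq_one_left (Equiv.ext hD)
        have hCi : C⁻¹ = C := inv_eq_of_mul_eq_one_left (Equiv.ext hC)
        have h1 : D * (D * C) ^ k * D⁻¹ = (D * C) ^ (-k) := by
          rw [← conj_zpow, zpow_neg, ← inv_zpow, mul_inv_rev, hCi, hDi, ← mul_assoc,
            show D * D = 1 from Equiv.ext hD, one_mul]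
        have h2 : D * (D * C) ^ k = (D * C) ^ (-k) * D := by rw [← h1]; group
        calc D (((D * C) ^ k) (outer x)) = (D * (D * C) ^ k) (outer x) := rfl
          _ = ((D * C) ^ (-k)) (D (outer x)) := by rw [h2]; rfl
          _ = _ := by rw [hDx]
      have sC : ∀ v, (∃ k : ℤ, v = ((D * C) ^ k) (outer x)) →
          ∃ k : ℤ, C v = ((D * C) ^ k) (outer x) := by
        rintro v ⟨k, rfl⟩
        obtain ⟨k', h⟩ := sD (((D * C) ^ (k + 1)) (outer x)) ⟨_, rfl⟩
        refine ⟨k', ?_⟩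
        rw [← h, add_comm, zpow_add, zpow_one]
        simp [Equiv.Perm.mul_apply, hD]
      intro v
      constructor
      · intro h
        let S : Curve b a → Prop := Quot.lift (fun v => ∃ k : ℤ, v = ((D * C) ^ k) (outer x)) (by
          intro v w hvw
          apply propext
          rcases link v w hvw with rfl | rfl
          · exact ⟨sC v, fun h => by simpa [hC] using sC _ h⟩
          · exact ⟨sD v, fun h => by simpa [hD] using sD _ h⟩)
        have hS : S (curve b a (outer x)) := ⟨0, rfl⟩
        rw [← h] at hS
        exact hS
      · rintro ⟨k, rfl⟩
        have step : ∀ v, curve b a ((D * C) v) = curve b a v := fun v => (cD _).trans (cC _)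
        have step' : ∀ v, curve b a ((D * C)⁻¹ v) = curve b a v := fun v => by
          rw [← step ((D * C)⁻¹ v), ← Equiv.Perm.mul_apply, mul_inv_cancel, Equiv.Perm.one_apply]
        induction k using Int.induction_on with
        | zero => rfl
        | succ i ih => rw [add_comm, zpow_add, zpow_one, Equiv.Perm.mul_apply, step, ih]
        | pred i ih =>
          rw [sub_eq_neg_add, zpow_add, zpow_neg_one, Equiv.Perm.mul_apply, step', ih]
    obtain ⟨v, ⟨h1, h2, h3⟩, hu⟩ := existsUnique_other_end C D hC hD (outer x) hDx hCx
    obtain ⟨y, rfl⟩ := (hfix v).mp h2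
    refine ⟨y, ⟨fun h => h1 (by rw [h]), (orb _).mpr h3⟩, ?_⟩
    rintro y' ⟨h4, h5⟩
    exact outer_inj (hu _ ⟨fun h => h4 (outer_inj h), (hfix _).mpr ⟨_, rfl⟩, (orb _).mp h5⟩)
  have hfix : ∀ v, (A v = v ∨ B v = v) ↔ ∃ y, v = outer y := by
    intro v
    rw [fixA, fixB]
    constructor
    · rintro (⟨j, h⟩ | ⟨i, h⟩)
      · exact ⟨_, h⟩
      · exact ⟨_, h⟩
    · rintro ⟨i | j, h⟩
      · exact Or.inr ⟨i, h⟩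
      · exact Or.inl ⟨j, h⟩
  rcases x with i | j
  · refine key A B hA hB cA cB linkAB hfix ((fixB _).mpr ⟨i, rfl⟩) ?_
    rw [Ne, fixA]
    rintro ⟨j, h⟩; simp [outer] at h
  · refine key B A hB hA cB cA (fun v w h => (linkAB v w h).symm)
      (fun v => or_comm.trans (hfix v)) ((fixA _).mpr ⟨j, rfl⟩) ?_
    rw [Ne, fixB]
    rintro ⟨j, h⟩; simp [outer] at h

theorem pos_injective {m n : ℕ} : Function.Injective (pos : Fin m ⊕ Fin n → ℕ) := by
  rintro (i | j) (i' | j') h <;> simp only [pos] at h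
  · exact congrArg _ (Fin.ext h)
  · have := i.2; have := j'.2; omega
  · have := i'.2; have := j.2; omega
  · have := j.2; have := j'.2; exact congrArg _ (Fin.ext (by omega))

/-- The number of points in a union of strands is even. -/
theorem sum_strands {m n : ℕ} (a : Diagram m n) (P : Fin m ⊕ Fin n → ZMod 2)
    (hP : ∀ u, P (a.pair u) = P u) : ∑ u, P u = 0 := by
  refine Finset.sum_involution (fun u _ => a.pair u) (fun u _ => ?_) (fun u _ _ => a.pair_ne u)
    (fun _ _ => Finset.mem_univ _) (fun u _ => a.pair_pair u)
  rw [hP]; exact CharTwo.add_self_eq_zero _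

/-- Two arcs that do not cross interlace an even number of times. -/
theorem interlace_arcs (p p' q q' : ℕ) (e1 : p ≠ q) (e2 : p ≠ q') (e3 : p' ≠ q) (e4 : p' ≠ q')
    (h : ∀ x x' y y', (x = p ∧ x' = p' ∨ x = p' ∧ x' = p) → (y = q ∧ y' = q' ∨ y = q' ∧ y' = q) →
      ¬ (x < y ∧ y < x' ∧ x' < y') ∧ ¬ (y < x ∧ x < y' ∧ y' < x')) :
    ((if p < q then 1 else 0) + (if p < q' then 1 else 0) +
      ((if p' < q then 1 else 0) + (if p' < q' then 1 else 0)) : ZMod 2) = 0 := by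
  have c1 := h p p' q q' (by simp) (by simp)
  have c2 := h p p' q' q (by simp) (by simp)
  have c3 := h p' p q q' (by simp) (by simp)
  have c4 := h p' p q' q (by simp) (by simp)
  clear h
  by_cases h1 : p < q <;> by_cases h2 : p < q' <;> by_cases h3 : p' < q <;>
    by_cases h4 : p' < q' <;> simp only [h1, h2, h3, h4, if_true, if_false] <;>
    first | rfl | (exfalso; omega)

/-- Two disjoint unions of strands of a diagram interlace an even number of times. -/
theorem sum_interlace {m n : ℕ} (a : Diagram m n) (P Q : Fin m ⊕ Fin n → ZMod 2)
    (hP : ∀ u, P (a.pair u) = P u) (hQ : ∀ u, Q (a.pair u) = Q u) (hPQ : ∀ u, P u * Q u = 0) :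
    ∑ u, ∑ v, P u * Q v * (if pos u < pos v then 1 else 0) = 0 := by
  refine Finset.sum_involution (fun u _ => a.pair u) (fun u _ => ?_) (fun u _ _ => a.pair_ne u)
    (fun _ _ => Finset.mem_univ _) (fun u _ => a.pair_pair u)
  rw [← Finset.sum_add_distrib]
  refine Finset.sum_involution (fun u _ => a.pair u) (fun v _ => ?_) (fun u _ _ => a.pair_ne u)
    (fun _ _ => Finset.mem_univ _) (fun u _ => a.pair_pair u)
  rw [hP, hQ]
  by_cases huv : u = v
  · subst huv; simp [hPQ]
  by_cases huv' : u = a.pair v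
  · have : P u * Q v = 0 := by rw [huv', hP, hPQ]
    simp [this]
  have e1 : pos u ≠ pos v := fun h => huv (pos_injective h)
  have e2 : pos u ≠ pos (a.pair v) := fun h => huv' (pos_injective h)
  have e3 : pos (a.pair u) ≠ pos v := fun h => huv' (by
    rw [← pos_injective h, a.pair_pair])
  have e4 : pos (a.pair u) ≠ pos (a.pair v) := fun h => huv (by
    rw [← a.pair_pair u, pos_injective h, a.pair_pair])
  have c1 := a.noncrossing u v
  have c2 := a.noncrossing v u
  have c3 := a.noncrossing u (a.pair v)
  have c4 := a.noncrossing (a.pair v) u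
  have c5 := a.noncrossing (a.pair u) v
  have c6 := a.noncrossing v (a.pair u)
  have c7 := a.noncrossing (a.pair u) (a.pair v)
  have c8 := a.noncrossing (a.pair v) (a.pair u)
  simp only [a.pair_pair] at c1 c2 c3 c4 c5 c6 c7 c8
  have key := interlace_arcs _ _ _ _ e1 e2 e3 e4 (by
    rintro x x' y y' (⟨rfl, rfl⟩ | ⟨rfl, rfl⟩) (⟨rfl, rfl⟩ | ⟨rfl, rfl⟩)
    · exact ⟨c1, c2⟩
    · exact ⟨c3, c4⟩
    · exact ⟨c5, c6⟩
    · exact ⟨c7, c8⟩)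
  rw [← mul_add, ← mul_add, ← mul_add, add_add_add_comm, key, mul_zero]

/-- The other end point of the curve of the juxtaposition that ends at `x`. -/
noncomputable def partner {l m n : ℕ} (b : Diagram m n) (a : Diagram l m) (x : Fin l ⊕ Fin n) :
    Fin l ⊕ Fin n := (existsUnique_partner b a x).choose

theorem partner_ne {l m n : ℕ} (b : Diagram m n) (a : Diagram l m) (x : Fin l ⊕ Fin n) :
    partner b a x ≠ x := (existsUnique_partner b a x).choose_spec.1.1

theorem curve_partner {l m n : ℕ} (b : Diagram m n) (a : Diagram l m) (x : Fin l ⊕ Fin n) :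
    curve b a (outer (partner b a x)) = curve b a (outer x) :=
  (existsUnique_partner b a x).choose_spec.1.2

theorem eq_partner {l m n : ℕ} (b : Diagram m n) (a : Diagram l m) (x y : Fin l ⊕ Fin n)
    (h1 : y ≠ x) (h2 : curve b a (outer y) = curve b a (outer x)) : y = partner b a x :=
  (existsUnique_partner b a x).choose_spec.2 y ⟨h1, h2⟩

theorem partner_partner {l m n : ℕ} (b : Diagram m n) (a : Diagram l m) (x : Fin l ⊕ Fin n) :
    partner b a (partner b a x) = x :=
  (eq_partner b a _ x (partner_ne b a x).symm (curve_partner b a x).symm).symm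

open Classical in
theorem partner_noncrossing {l m n : ℕ} (b : Diagram m n) (a : Diagram l m)
    (x y : Fin l ⊕ Fin n) : ¬ (pos x < pos y ∧ pos y < pos (partner b a x) ∧
      pos (partner b a x) < pos (partner b a y)) := by
  rintro ⟨h1, h2, h3⟩
  have hne : curve b a (outer y) ≠ curve b a (outer x) := by
    intro h
    have := eq_partner b a x y (by rintro rfl; omega) h
    rw [← this] at h2
    omega
  set P : Fin l ⊕ (Fin m ⊕ Fin n) → ZMod 2 :=
    fun v => if curve b a v = curve b a (outer x) then 1 else 0 with hP
  set Q : Fin l ⊕ (Fin m ⊕ Fin n) → ZMod 2 :=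
    fun v => if curve b a v = curve b a (outer y) then 1 else 0 with hQ
  have PQ : ∀ v, P v * Q v = 0 := by
    intro v
    simp only [hP, hQ]
    split_ifs with h h'
    · exact absurd (h'.symm.trans h) hne
    all_goals simp
  have cu : ∀ u, curve b a (upper (a.pair u)) = curve b a (upper u) :=
    fun u => (Quot.sound (Link.up u)).symm
  have cl : ∀ u, curve b a (lower (b.pair u)) = curve b a (lower u) :=
    fun u => (Quot.sound (Link.low u)).symm
  have Pu : ∀ u, P (upper (a.pair u)) = P (upper u) := fun u => by simp only [hP, cu]
  have Qu : ∀ u, Q (upper (a.pair u)) = Q (upper u) := fun u => by simp only [hQ, cu]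
  have Pl : ∀ u, P (lower (b.pair u)) = P (lower u) := fun u => by simp only [hP, cl]
  have Ql : ∀ u, Q (lower (b.pair u)) = Q (lower u) := fun u => by simp only [hQ, cl]
  have ia := sum_interlace a (fun u => P (upper u)) (fun u => Q (upper u)) Pu Qu (fun _ => PQ _)
  have ib := sum_interlace b (fun u => P (lower u)) (fun u => Q (lower u)) Pl Ql (fun _ => PQ _)
  have sPa := sum_strands a (fun u => P (upper u)) Pu
  have sQa := sum_strands a (fun u => Q (upper u)) Qu
  have sPb := sum_strands b (fun u => P (lower u)) Pl
  have sQb := sum_strands b (fun u => Q (lower u)) Ql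
  have ic : ∑ u : Fin l ⊕ Fin n, ∑ v : Fin l ⊕ Fin n,
      P (outer u) * Q (outer v) * (if pos u < pos v then 1 else 0) = 1 := by
    have Po : ∀ u : Fin l ⊕ Fin n, P (outer u) =
        (if u = x then 1 else 0) + (if u = partner b a x then 1 else 0) := by
      intro u
      by_cases hu : u = x
      · subst hu; simp [hP, (partner_ne b a u).symm]
      · by_cases hu' : u = partner b a x
        · rw [hu']; simp [hP, partner_ne, curve_partner]
        · have : curve b a (outer u) ≠ curve b a (outer x) := fun h => hu' (eq_partner b a x u hu h)
          simp [hP, hu, hu', this]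
    have Qo : ∀ u : Fin l ⊕ Fin n, Q (outer u) =
        (if u = y then 1 else 0) + (if u = partner b a y then 1 else 0) := by
      intro u
      by_cases hu : u = y
      · subst hu; simp [hQ, (partner_ne b a u).symm]
      · by_cases hu' : u = partner b a y
        · rw [hu']; simp [hQ, partner_ne, curve_partner]
        · have : curve b a (outer u) ≠ curve b a (outer y) := fun h => hu' (eq_partner b a y u hu h)
          simp [hQ, hu, hu', this]
    have two : ∀ (z z' : Fin l ⊕ Fin n) (f : Fin l ⊕ Fin n → ZMod 2),
        ∑ u, ((if u = z then 1 else 0) + (if u = z' then 1 else 0)) * f u = f z + f z' := by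
      intro z z' f
      simp only [add_mul, Finset.sum_add_distrib, ite_mul, one_mul, zero_mul, Finset.sum_ite_eq',
        Finset.mem_univ, if_true]
    simp only [mul_assoc, ← Finset.mul_sum]
    simp only [Po, Qo, two]
    rw [if_pos h1, if_pos (by omega : pos x < pos (partner b a y)),
      if_neg (by omega : ¬ pos (partner b a x) < pos y), if_pos h3]
    rfl
  clear_value P Q
  simp only [Fintype.sum_sum_type, upper, lower, outer, Finset.sum_add_distrib] at *
  have lt1 : ∀ {p q : ℕ} (i : Fin p) (k : Fin q),
      pos (Sum.inl i : Fin p ⊕ Fin q) < pos (Sum.inr k : Fin p ⊕ Fin q) := by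
    intro p q i k; have := i.2; simp only [pos]; omega
  have lt2 : ∀ {p q : ℕ} (i : Fin p) (k : Fin q),
      ¬ pos (Sum.inr k : Fin p ⊕ Fin q) < pos (Sum.inl i : Fin p ⊕ Fin q) :=
    fun i k => (lt1 i k).le.not_gt
  have lt3 : ∀ {p q : ℕ} (i j : Fin p),
      pos (Sum.inl i : Fin p ⊕ Fin q) < pos (Sum.inl j : Fin p ⊕ Fin q) ↔ i < j :=
    fun i j => Iff.rfl
  have lt4 : ∀ {p q : ℕ} (i j : Fin q),
      pos (Sum.inr i : Fin p ⊕ Fin q) < pos (Sum.inr j : Fin p ⊕ Fin q) ↔ j < i := by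
    intro p q i j; have := i.2; have := j.2; simp only [pos, Fin.lt_def]; omega
  simp only [lt1, lt2, lt3, lt4, if_true, if_false, mul_one, mul_zero, Finset.sum_const_zero,
    add_zero, ← Finset.mul_sum, ← Finset.sum_mul] at ia ib ic
  have mid : (∑ k : Fin m, ∑ k' : Fin m, P (Sum.inr (Sum.inl k)) * Q (Sum.inr (Sum.inl k')) *
        (if k' < k then 1 else 0)) +
      (∑ k : Fin m, ∑ k' : Fin m, P (Sum.inr (Sum.inl k)) * Q (Sum.inr (Sum.inl k')) *
        (if k < k' then 1 else 0)) =
      (∑ k : Fin m, P (Sum.inr (Sum.inl k))) * (∑ k : Fin m, Q (Sum.inr (Sum.inl k))) := by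
    rw [Finset.sum_mul_sum, ← Finset.sum_add_distrib]
    refine Finset.sum_congr rfl fun k _ => ?_
    rw [← Finset.sum_add_distrib]
    refine Finset.sum_congr rfl fun k' _ => ?_
    rcases lt_trichotomy k k' with h | h | h
    · simp [h, h.not_gt]
    · subst h; simp [PQ]
    · simp [h, h.not_gt]
  generalize (∑ k : Fin m, ∑ k' : Fin m, P (Sum.inr (Sum.inl k)) * Q (Sum.inr (Sum.inl k')) *
        (if k' < k then 1 else 0)) = M1 at *
  generalize (∑ k : Fin m, ∑ k' : Fin m, P (Sum.inr (Sum.inl k)) * Q (Sum.inr (Sum.inl k')) *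
        (if k < k' then 1 else 0)) = M2 at *
  generalize (∑ i : Fin l, ∑ i' : Fin l, P (Sum.inl i) * Q (Sum.inl i') *
        (if i < i' then 1 else 0)) = T at *
  generalize (∑ k : Fin n, ∑ k' : Fin n, P (Sum.inr (Sum.inr k)) * Q (Sum.inr (Sum.inr k')) *
        (if k' < k then 1 else 0)) = R at *
  generalize (∑ k : Fin m, P (Sum.inr (Sum.inl k))) = pm at *
  generalize (∑ k : Fin m, Q (Sum.inr (Sum.inl k))) = qm at *
  generalize (∑ k : Fin l, P (Sum.inl k)) = pt at *
  generalize (∑ k : Fin l, Q (Sum.inl k)) = qt at *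
  generalize (∑ k : Fin n, P (Sum.inr (Sum.inr k))) = pb at *
  generalize (∑ k : Fin n, Q (Sum.inr (Sum.inr k))) = qb at *
  clear * - ia ib ic sPa sPb sQa sQb mid
  obtain rfl := CharTwo.add_eq_zero.mp sPa
  obtain rfl := CharTwo.add_eq_zero.mp sPb
  obtain rfl := CharTwo.add_eq_zero.mp sQa
  obtain rfl := CharTwo.add_eq_zero.mp sQb
  have h2 : (2 : ZMod 2) = 0 := rfl
  refine one_ne_zero (α := ZMod 2) ?_
  linear_combination -ic + ia + ib - mid - pt * qt * h2

/-- The diagram of the juxtaposition of `a` (above) and `b` (below), closed loops removed. -/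
noncomputable def Diagram.comp {l m n : ℕ} (b : Diagram m n) (a : Diagram l m) : Diagram l n where
  pair := partner b a
  pair_pair := partner_partner b a
  pair_ne := partner_ne b a
  noncrossing := partner_noncrossing b a

/-! ### Horizontal juxtaposition -/

/-- The marked points of the horizontal juxtaposition of an `(m, n)`-diagram (left) and an
`(m', n')`-diagram (right). -/
def sideBySide (m n m' n' : ℕ) :
    (Fin m ⊕ Fin n) ⊕ (Fin m' ⊕ Fin n') ≃ Fin (m + m') ⊕ Fin (n + n') :=
  (Equiv.sumSumSumComm (Fin m) (Fin n) (Fin m') (Fin n')).trans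
    (Equiv.sumCongr finSumFinEquiv finSumFinEquiv)

theorem pos_left {m n m' n' : ℕ} (u : Fin m ⊕ Fin n) :
    (pos u < m ∧ pos (sideBySide m n m' n' (Sum.inl u)) = pos u) ∨
    (m ≤ pos u ∧ pos (sideBySide m n m' n' (Sum.inl u)) = pos u + (m' + n')) := by
  rcases u with i | j
  · left; exact ⟨i.2, rfl⟩
  · right
    have := j.2
    constructor
    · simp only [pos]; omega
    · simp [pos, sideBySide]
      omega

theorem pos_right {m n m' n' : ℕ} (v : Fin m' ⊕ Fin n') :
    pos v < m' + n' ∧ pos (sideBySide m n m' n' (Sum.inr v)) = m + pos v := by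
  rcases v with i | j
  · have := i.2
    exact ⟨by simp only [pos]; omega, rfl⟩
  · have := j.2
    constructor
    · simp only [pos]; omega
    · simp [pos, sideBySide]
      omega

/-- Horizontal juxtaposition of diagrams, `a` on the left of `b`. -/
def Diagram.tensor {m n m' n' : ℕ} (a : Diagram m n) (b : Diagram m' n') :
    Diagram (m + m') (n + n') where
  pair x := sideBySide m n m' n' (Sum.map a.pair b.pair ((sideBySide m n m' n').symm x))
  pair_pair x := by
    rw [Equiv.symm_apply_apply, ← Equiv.eq_symm_apply]
    rcases (sideBySide m n m' n').symm x with u | v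
    · simp [a.pair_pair]
    · simp [b.pair_pair]
  pair_ne x := by
    rw [Ne, ← Equiv.eq_symm_apply]
    rcases (sideBySide m n m' n').symm x with u | v
    · simpa using a.pair_ne u
    · simpa using b.pair_ne v
  noncrossing x y := by
    obtain ⟨x, rfl⟩ := (sideBySide m n m' n').surjective x
    obtain ⟨y, rfl⟩ := (sideBySide m n m' n').surjective y
    simp only [Equiv.symm_apply_apply]
    rcases x with u | u <;> rcases y with v | v <;> simp only [Sum.map_inl, Sum.map_inr]
    · have h1 := pos_left (m' := m') (n' := n') u
      have h2 := pos_left (m' := m') (n' := n') v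
      have h3 := pos_left (m' := m') (n' := n') (a.pair u)
      have h4 := pos_left (m' := m') (n' := n') (a.pair v)
      have h5 := a.noncrossing u v
      omega
    · have h1 := pos_left (m' := m') (n' := n') u
      have h2 := pos_right (m := m) (n := n) v
      have h3 := pos_left (m' := m') (n' := n') (a.pair u)
      have h4 := pos_right (m := m) (n := n) (b.pair v)
      omega
    · have h1 := pos_right (m := m) (n := n) u
      have h2 := pos_left (m' := m') (n' := n') v
      have h3 := pos_right (m := m) (n := n) (b.pair u)
      have h4 := pos_left (m' := m') (n' := n') (a.pair v)
      omega
    · have h1 := pos_right (m := m) (n := n) u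
      have h2 := pos_right (m := m) (n := n) v
      have h3 := pos_right (m := m) (n := n) (b.pair u)
      have h4 := pos_right (m := m) (n := n) (b.pair v)
      have h5 := b.noncrossing u v
      omega

/-! ### Closing up a diagram -/

/-- Two points of an `(n, n)`-diagram `a` are linked in its closure if a strand of `a` joins them,
or if they are the `i`-th top point and the `i`-th bottom point. -/
inductive ClosureLink {n : ℕ} (a : Diagram n n) : Fin n ⊕ Fin n → Fin n ⊕ Fin n → Prop
  | strand (x : Fin n ⊕ Fin n) : ClosureLink a x (a.pair x)
  | close (i : Fin n) : ClosureLink a (Sum.inl i) (Sum.inr i)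

/-- The number of closed loops of the closure of `a`. -/
noncomputable def closureLoops {n : ℕ} (a : Diagram n n) : ℕ := Nat.card (Quot (ClosureLink a))

/-! ### The Temperley-Lieb category over a field `K` with loop parameter `d` -/

/-- The morphisms from `m` to `n`: the vector space with basis the `(m, n)`-diagrams. -/
abbrev Hom (K : Type*) [Field K] (m n : ℕ) : Type _ := Diagram m n →₀ K

section

variable {K : Type*} [Field K]

/-- Composition `b ∘ a`: the bilinear extension of vertical juxtaposition (`a` above `b`), where
each closed loop is replaced by the factor `d`. -/
noncomputable def comp (d : K) {l m n : ℕ} : Hom K m n →ₗ[K] Hom K l m →ₗ[K] Hom K l n :=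
  Finsupp.linearCombination K fun b : Diagram m n =>
    Finsupp.linearCombination K fun a : Diagram l m =>
      Finsupp.single (b.comp a) (d ^ loops b a)

/-- Tensor product `a ⊗ b`: the bilinear extension of horizontal juxtaposition. -/
noncomputable def tensor {m n m' n' : ℕ} :
    Hom K m n →ₗ[K] Hom K m' n' →ₗ[K] Hom K (m + m') (n + n') :=
  Finsupp.linearCombination K fun a : Diagram m n =>
    Finsupp.linearCombination K fun b : Diagram m' n' =>
      Finsupp.single (a.tensor b) (1 : K)

/-- The Markov (categorical) trace. -/
noncomputable def trace (d : K) {n : ℕ} : Hom K n n →ₗ[K] K :=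
  Finsupp.linearCombination K fun a : Diagram n n => d ^ closureLoops a

/-- A (tensor) ideal of the Temperley-Lieb category with loop parameter `d`: a family of subspaces
of the morphism spaces that is closed under composition and tensor product with arbitrary
morphisms. The zero ideal is `⊥`, and the ideal of all morphisms is `⊤`. -/
structure IsTensorIdeal (d : K) (J : ∀ m n : ℕ, Submodule K (Hom K m n)) : Prop where
  comp_left : ∀ {l m n : ℕ} (b : Hom K m n) (a : Hom K l m), a ∈ J l m → comp d b a ∈ J l n
  comp_right : ∀ {l m n : ℕ} (b : Hom K m n) (a : Hom K l m), b ∈ J m n → comp d b a ∈ J l n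
  tensor_left : ∀ {m n m' n' : ℕ} (a : Hom K m n) (b : Hom K m' n'),
    b ∈ J m' n' → tensor a b ∈ J (m + m') (n + n')
  tensor_right : ∀ {m n m' n' : ℕ} (a : Hom K m n) (b : Hom K m' n'),
    a ∈ J m n → tensor a b ∈ J (m + m') (n + n')

/-- The negligible morphisms: all `a : m → n` such that `Tr (a ∘ b) = 0` for all `b : n → m`. -/
noncomputable def negligible (d : K) (m n : ℕ) : Submodule K (Hom K m n) where
  carrier := {a | ∀ b : Hom K n m, trace d (comp d a b) = 0}
  add_mem' := fun ha hb c => by simp [ha c, hb c]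
  zero_mem' := fun c => by simp
  smul_mem' := fun r a ha c => by simp [ha c]

end

/-! ### The parameters -/

/-- `d` is `2 cos (j π / n)` with `n ≥ 3` and `j` coprime to `n`. -/
def IsSpecialValue (d : ℂ) : Prop :=
  ∃ (n : ℕ) (j : ℤ), 3 ≤ n ∧ IsCoprime j (n : ℤ) ∧ d = ((2 * Real.cos (j * Real.pi / n) : ℝ) : ℂ)

/-- `τ` is a root of unity different from `1`, `-1`, `i` and `-i`. -/
def IsProperRootOfUnity (τ : ℂ) : Prop :=
  (∃ k : ℕ, 0 < k ∧ τ ^ k = 1) ∧ τ ≠ 1 ∧ τ ≠ -1 ∧ τ ≠ Complex.I ∧ τ ≠ -Complex.I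

end TemperleyLieb

/-!
Morphisms are studied through their bent forms: bending the top points down identifies `Hom m n`
with `Hom 0 (m + n)` inside of every tensor ideal, so an ideal is determined by its morphisms
without top points. If `x : 0 → N` is a non-zero morphism in an ideal with the least possible `N`,
all caps at neighbouring points send `x` to zero; such morphisms are called singular. If `N = 0`,
the ideal contains a non-zero scalar and hence everything. The theorem is thus a question about
singular morphisms, for `d = τ + τ⁻¹`.

*Singular morphisms.* In the spin model a cup is the tensor `e₀ ⊗ e₁ + τ e₁ ⊗ e₀`, and a morphism
`0 → N` becomes a function `spin τ x` on the subsets of `{0, …, N - 1}`; this is faithful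
(`exists_spin_ne_zero`). A singular `x` on `N = 2 k` points has coefficients proportional to
`(-τ) ^ ∑ S` (`Singular.spin_eq`). On the other hand every diagram has a strand between neighbours
in any window of more than half of the points, so the `q`-symmetriser on such a window kills every
morphism (`sum_spin_window`). Comparing both, a non-zero singular `x` with `k > 0` forces
`∑_{A ⊆ {0, …, k + r - 1}, |A| = r} Q ^ ∑ A = 0` for `Q = τ ^ 2` and `1 ≤ r ≤ k`
(`Singular.gaussSum_eq_zero`). For `r = 1` this reads `1 + Q + ⋯ + Q ^ k = 0`. It is impossible in
the generic case and for `d ≠ 0` not special (`IsTensorIdeal.eq_bot_or_eq_top`). If `Q` is a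
primitive `l`-th root of unity, `r = 1` and `r = l` leave only `k = l - 1`
(`Singular.add_one_eq`).

*Existence in the special case.* Let `k = l - 1`. By a dimension count some `y ≠ 0` on `2 k`
points is orthogonal to all diagrams but the nested caps. All caps but the middle one send `y` to
negligible morphisms on fewer points, which vanish. The window relations and
`1 + Q + ⋯ + Q ^ k = 0` then show that `y` is killed by the middle cap as well
(`singular_of_halves`). As every diagram `2 k → 0` factors through a cap, up to the factor
`d ≠ 0`, `y` is negligible (`negligible_ne_bot`).

*Uniqueness in the special case.* A proper ideal is contained in the negligible ideal, since
closing up an endomorphism turns its trace into a scalar. Conversely, a non-zero proper ideal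
contains a non-zero singular `z` on `2 k` points, and its coefficient at the nested cups is
non-zero. Bending `z` to an endomorphism of `k`, one gets a non-zero multiple of the identity
modulo diagrams that factor through caps. Composition with it shows, by induction on the number of
points, that every negligible morphism lies in the ideal (`IsTensorIdeal.negligible_le`).

Identities between pictures, with their numbers of closed loops, are checked in the two-colour
model with `d = 2`: a picture is determined by the matrix that counts its compatible colourings
(`LoopDiagram.mat_injective`), and this matrix turns juxtaposition into matrix products.

Finally `τ + τ⁻¹` is special if and only if `τ ^ 2` is a root of unity of order at least three
(`isSpecialValue_iff`), which means that `τ` is a proper root of unity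
(`isProperRootOfUnity_iff`).
-/

namespace TemperleyLieb

/-! ### Two-colourings of diagrams -/

/-- A two-colouring of the marked points of a diagram (`s` on top, `t` on the bottom) is compatible
with the diagram if it is constant along strands. -/
def Compat {m n : ℕ} (D : Diagram m n) (s : Fin m → Bool) (t : Fin n → Bool) : Prop :=
  ∀ x, Sum.elim s t (D.pair x) = Sum.elim s t x

open Classical in
/-- The matrix of a diagram in the two-colour model: the indicator of the compatible colourings. It
realises the diagrams with loop parameter `2`. -/
noncomputable def colMat {m n : ℕ} (D : Diagram m n) :
    Matrix (Fin m → Bool) (Fin n → Bool) ℕ :=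
  fun s t => if Compat D s t then 1 else 0

theorem colMat_eq_one {m n : ℕ} {D : Diagram m n} {s : Fin m → Bool} {t : Fin n → Bool}
    (h : Compat D s t) : colMat D s t = 1 := if_pos h

theorem colMat_eq_zero {m n : ℕ} {D : Diagram m n} {s : Fin m → Bool} {t : Fin n → Bool}
    (h : ¬ Compat D s t) : colMat D s t = 0 := if_neg h

theorem compat_of_colMat_ne_zero {m n : ℕ} {D : Diagram m n} {s : Fin m → Bool}
    {t : Fin n → Bool} (h : colMat D s t ≠ 0) : Compat D s t := by
  by_contra h'
  exact h (colMat_eq_zero h')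

theorem colMat_const {m n : ℕ} (D : Diagram m n) :
    colMat D (fun _ => true) (fun _ => true) = 1 := by
  refine colMat_eq_one fun x => ?_
  rcases D.pair x with i | i <;> rcases x with j | j <;> rfl

/-- The colouring that singles out one strand is compatible with the diagram. -/
theorem compat_strand {m n : ℕ} (D : Diagram m n) (x : Fin m ⊕ Fin n) :
    Compat D (fun i => decide (Sum.inl i = x ∨ Sum.inl i = D.pair x))
      (fun j => decide (Sum.inr j = x ∨ Sum.inr j = D.pair x)) := by
  have key : ∀ y : Fin m ⊕ Fin n,
      Sum.elim (fun i => decide (Sum.inl i = x ∨ Sum.inl i = D.pair x))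
        (fun j => decide (Sum.inr j = x ∨ Sum.inr j = D.pair x)) y =
      decide (y = x ∨ y = D.pair x) := by
    rintro (i | j) <;> rfl
  intro y
  rw [key, key, decide_eq_decide]
  constructor
  · rintro (h | h)
    · right; rw [← h, D.pair_pair]
    · left; rw [← D.pair_pair y, h, D.pair_pair]
  · rintro (h | h)
    · right; rw [h]
    · left; rw [h, D.pair_pair]

/-- Strands can be read off from the compatible colourings. -/
theorem pair_eq_of_forall_compat {m n : ℕ} (D : Diagram m n) (x y : Fin m ⊕ Fin n) (hxy : x ≠ y)
    (h : ∀ s t, Compat D s t → Sum.elim s t x = Sum.elim s t y) : D.pair x = y := by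
  have h1 := h _ _ (compat_strand D x)
  have key : ∀ y : Fin m ⊕ Fin n,
      Sum.elim (fun i => decide (Sum.inl i = x ∨ Sum.inl i = D.pair x))
        (fun j => decide (Sum.inr j = x ∨ Sum.inr j = D.pair x)) y =
      decide (y = x ∨ y = D.pair x) := by
    rintro (i | j) <;> rfl
  rw [key, key, decide_eq_decide] at h1
  rcases h1.mp (Or.inl rfl) with h2 | h2
  · exact absurd h2.symm hxy
  · exact h2.symm

theorem colMat_injective {m n : ℕ} :
    Function.Injective (colMat : Diagram m n → Matrix (Fin m → Bool) (Fin n → Bool) ℕ) := by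
  intro D D' h
  ext1
  funext x
  refine (pair_eq_of_forall_compat D' x (D.pair x) (D.pair_ne x).symm ?_).symm
  intro s t hst
  have h1 : Compat D s t := by
    apply compat_of_colMat_ne_zero
    rw [h, colMat_eq_one hst]
    exact one_ne_zero
  exact (h1 x).symm

theorem compat_comp_iff {l m n : ℕ} (b : Diagram m n) (a : Diagram l m) (s : Fin l → Bool)
    (t : Fin n → Bool) :
    Compat (b.comp a) s t ↔ ∀ x y, curve b a (outer x) = curve b a (outer y) →
      Sum.elim s t x = Sum.elim s t y := by
  constructor
  · intro h x y hxy
    by_cases hne : x = y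
    · rw [hne]
    · rw [eq_partner b a y x hne hxy]
      exact h y
  · intro h x
    exact h _ _ (curve_partner b a x)

/-- Vertical juxtaposition in the two-colour model: the colours of the outer points determine those
of the curves that reach the boundary, and each closed loop can be coloured in two ways. -/
theorem colMat_mul {l m n : ℕ} (b : Diagram m n) (a : Diagram l m) :
    colMat a * colMat b = 2 ^ loops b a • colMat (b.comp a) := by
  classical
  ext s t
  rw [Matrix.mul_apply, Matrix.smul_apply, smul_eq_mul]
  have hfin : Finite (Curve b a) := Quot.finite _
  have hsum : ∑ u, colMat a s u * colMat b u t =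
      Nat.card {u : Fin m → Bool // Compat a s u ∧ Compat b u t} := by
    rw [Nat.card_eq_fintype_card, Fintype.card_subtype, Finset.card_filter]
    refine Finset.sum_congr rfl fun u _ => ?_
    unfold colMat
    by_cases h1 : Compat a s u <;> by_cases h2 : Compat b u t <;> simp [h1, h2]
  rw [hsum]
  -- a compatible colouring of the whole picture is constant along curves
  have lift : ∀ u : Fin m → Bool, Compat a s u → Compat b u t →
      ∀ v w, Link b a v w → (Sum.elim s (Sum.elim u t) v : Bool) = Sum.elim s (Sum.elim u t) w := by
    intro u h1 h2 v w h
    rcases h with x | y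
    · have := h1 x
      have e : ∀ z : Fin l ⊕ Fin m,
          Sum.elim s (Sum.elim u t) (upper (n := n) z) = Sum.elim s u z := by
        rintro (i | k) <;> rfl
      rw [e, e, this]
    · exact (h2 y).symm
  have elim_outer : ∀ (u : Fin m → Bool) (x : Fin l ⊕ Fin n),
      Sum.elim s (Sum.elim u t) (outer x) = Sum.elim s t x := by
    rintro u (i | j) <;> rfl
  by_cases hst : Compat (b.comp a) s t
  · rw [colMat_eq_one hst, mul_one]
    rw [compat_comp_iff] at hst
    let F : {u : Fin m → Bool // Compat a s u ∧ Compat b u t} →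
        ({c : Curve b a // ∀ x, curve b a (outer x) ≠ c} → Bool) :=
      fun u c => Quot.lift _ (lift u.1 u.2.1 u.2.2) c.1
    have hF : Function.Bijective F := by
      constructor
      · rintro ⟨u, hu⟩ ⟨u', hu'⟩ h
        have h1 : ∀ c : Curve b a, Quot.lift _ (lift u hu.1 hu.2) c =
            Quot.lift _ (lift u' hu'.1 hu'.2) c := by
          intro c
          by_cases hc : ∀ x, curve b a (outer x) ≠ c
          · exact congrFun h ⟨c, hc⟩
          · push Not at hc
            obtain ⟨x, rfl⟩ := hc
            exact (elim_outer u x).trans (elim_outer u' x).symm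
        exact Subtype.ext (funext fun k => h1 (curve b a (Sum.inr (Sum.inl k))))
      · intro g
        let G : Curve b a → Bool := fun c =>
          if h : ∃ x, curve b a (outer x) = c then Sum.elim s t h.choose
          else g ⟨c, fun x hx => h ⟨x, hx⟩⟩
        have hG : ∀ x, G (curve b a (outer x)) = Sum.elim s t x := by
          intro x
          have h : ∃ y, curve b a (outer y) = curve b a (outer x) := ⟨x, rfl⟩
          have : G (curve b a (outer x)) = Sum.elim s t h.choose := dif_pos h
          rw [this]
          exact hst _ _ h.choose_spec
        have hup : ∀ z : Fin l ⊕ Fin m,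
            Sum.elim s (fun k => G (curve b a (Sum.inr (Sum.inl k)))) z =
              G (curve b a (upper z)) := by
          rintro (i | k)
          · exact (hG (Sum.inl i)).symm
          · rfl
        have hlow : ∀ z : Fin m ⊕ Fin n,
            Sum.elim (fun k => G (curve b a (Sum.inr (Sum.inl k)))) t z =
              G (curve b a (lower z)) := by
          rintro (k | j)
          · rfl
          · exact (hG (Sum.inr j)).symm
        refine ⟨⟨fun k => G (curve b a (Sum.inr (Sum.inl k))), ?_, ?_⟩, ?_⟩
        · intro z
          rw [hup, hup]
          exact congrArg G (Quot.sound (Link.up z)).symm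
        · intro z
          rw [hlow, hlow]
          exact congrArg G (Quot.sound (Link.low z)).symm
        · funext ⟨c, hc⟩
          induction c using Quot.ind with
          | mk v =>
            have hv : G (Quot.mk _ v) = g ⟨Quot.mk _ v, hc⟩ :=
              dif_neg (fun ⟨x, hx⟩ => hc x hx)
            rw [← hv]
            rcases v with i | k | j
            · exact absurd rfl (hc (Sum.inl i))
            · rfl
            · exact absurd rfl (hc (Sum.inr j))
    rw [Nat.card_eq_of_bijective F hF, Nat.card_fun]
    simp [loops]
  · rw [colMat_eq_zero hst, mul_zero]
    rw [Nat.card_eq_zero]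
    left
    refine ⟨fun ⟨u, h1, h2⟩ => hst ?_⟩
    rw [compat_comp_iff]
    intro x y hxy
    rw [← elim_outer u, ← elim_outer u]
    exact congrArg (Quot.lift _ (lift u h1 h2)) hxy

/-- The closed loops of the closure are coloured independently. -/
theorem trace_colMat {n : ℕ} (a : Diagram n n) : (colMat a).trace = 2 ^ closureLoops a := by
  classical
  have hfin : Finite (Quot (ClosureLink a)) := Quot.finite _
  have hsum : (colMat a).trace = Nat.card {s : Fin n → Bool // Compat a s s} := by
    rw [Nat.card_eq_fintype_card, Fintype.card_subtype, Finset.card_filter]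
    rfl
  have lift : ∀ s : Fin n → Bool, Compat a s s → ∀ v w, ClosureLink a v w →
      (Sum.elim s s v : Bool) = Sum.elim s s w := by
    intro s hs v w h
    rcases h with x | i
    · exact (hs v).symm
    · rfl
  let F : {s : Fin n → Bool // Compat a s s} → (Quot (ClosureLink a) → Bool) :=
    fun s => Quot.lift _ (lift s.1 s.2)
  have hF : Function.Bijective F := by
    constructor
    · intro s s' h
      exact Subtype.ext (funext fun i => congrFun h (Quot.mk _ (Sum.inl i)))
    · intro g
      have e : ∀ z, Sum.elim (fun i => g (Quot.mk _ (Sum.inl i)))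
          (fun i => g (Quot.mk _ (Sum.inl i))) z = g (Quot.mk _ z) := by
        rintro (i | i)
        · rfl
        · exact congrArg g (Quot.sound (ClosureLink.close i))
      refine ⟨⟨fun i => g (Quot.mk _ (Sum.inl i)), fun z => ?_⟩, ?_⟩
      · rw [e, e]
        exact congrArg g (Quot.sound (ClosureLink.strand z)).symm
      · funext c
        induction c using Quot.ind with
        | mk v => exact e v
  rw [hsum, Nat.card_eq_of_bijective F hF, Nat.card_fun]
  simp [closureLoops]

theorem colMat_tensor {m n m' n' : ℕ} (a : Diagram m n) (b : Diagram m' n')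
    (s : Fin m → Bool) (s' : Fin m' → Bool) (t : Fin n → Bool) (t' : Fin n' → Bool) :
    colMat (a.tensor b) (Fin.append s s') (Fin.append t t') = colMat a s t * colMat b s' t' := by
  have e : ∀ z, Sum.elim (Fin.append s s') (Fin.append t t') (sideBySide m n m' n' z) =
      Sum.elim (Sum.elim s t) (Sum.elim s' t') z := by
    rintro ((i | i) | (i | i)) <;> simp [sideBySide]
  have h : Compat (a.tensor b) (Fin.append s s') (Fin.append t t') ↔
      Compat a s t ∧ Compat b s' t' := by
    have e2 : ∀ z, (a.tensor b).pair (sideBySide m n m' n' z) =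
        sideBySide m n m' n' (Sum.map a.pair b.pair z) := fun z => by simp [Diagram.tensor]
    unfold Compat
    rw [← (sideBySide m n m' n').forall_congr_right]
    simp only [e2, e, Sum.forall, Sum.map_inl, Sum.map_inr, Sum.elim_inl, Sum.elim_inr]
  unfold colMat
  by_cases h1 : Compat a s t <;> by_cases h2 : Compat b s' t' <;> simp [h, h1, h2]

/-- The identity diagram, up to a change of the number of points along an equality. -/
def idDiagram {m n : ℕ} (h : m = n) : Diagram m n where
  pair := Sum.elim (fun i => Sum.inr (Fin.cast h i)) (fun j => Sum.inl (Fin.cast h.symm j))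
  pair_pair := by rintro (i | j) <;> rfl
  pair_ne := by rintro (i | j) <;> simp
  noncrossing := by
    rintro (i | i) (j | j) <;> simp [pos] <;> omega

theorem colMat_idDiagram {m n : ℕ} (h : m = n) (s : Fin m → Bool) (t : Fin n → Bool) :
    colMat (idDiagram h) s t = if s = t ∘ Fin.cast h then 1 else 0 := by
  unfold colMat
  congr 1
  subst h
  rw [eq_iff_iff]
  constructor
  · intro H
    exact funext fun i => (H (Sum.inl i)).symm
  · rintro rfl (i | i) <;> rfl

theorem colMat_id {m : ℕ} : colMat (idDiagram (rfl : m = m)) = 1 := by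
  ext s t
  rw [colMat_idDiagram, Matrix.one_apply]
  rfl

/-! ### Scaled diagrams -/

/-- A diagram together with a number of closed loops next to it. -/
structure LoopDiagram (m n : ℕ) where
  /-- the number of closed loops -/
  num : ℕ
  /-- the underlying diagram -/
  diag : Diagram m n

namespace LoopDiagram

/-- A diagram without additional loops. -/
def of {m n : ℕ} (D : Diagram m n) : LoopDiagram m n := ⟨0, D⟩

/-- Vertical juxtaposition, `a` above `b`. -/
noncomputable def comp {l m n : ℕ} (b : LoopDiagram m n) (a : LoopDiagram l m) :
    LoopDiagram l n := ⟨b.num + a.num + loops b.diag a.diag, b.diag.comp a.diag⟩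

/-- Horizontal juxtaposition. -/
def tensor {m n m' n' : ℕ} (a : LoopDiagram m n) (b : LoopDiagram m' n') :
    LoopDiagram (m + m') (n + n') := ⟨a.num + b.num, a.diag.tensor b.diag⟩

/-- The matrix in the two-colour model, where each loop counts `2`. -/
noncomputable def mat {m n : ℕ} (a : LoopDiagram m n) :
    Matrix (Fin m → Bool) (Fin n → Bool) ℕ := 2 ^ a.num • colMat a.diag

@[simp] theorem mat_of {m n : ℕ} (D : Diagram m n) : (of D).mat = colMat D := by
  simp [mat, of]

@[simp] theorem mat_comp {l m n : ℕ} (b : LoopDiagram m n) (a : LoopDiagram l m) :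
    (b.comp a).mat = a.mat * b.mat := by
  simp only [mat, comp, Matrix.smul_mul, Matrix.mul_smul, colMat_mul, smul_smul]
  congr 1
  ring

theorem mat_tensor {m n m' n' : ℕ} (a : LoopDiagram m n) (b : LoopDiagram m' n')
    (s : Fin m → Bool) (s' : Fin m' → Bool) (t : Fin n → Bool) (t' : Fin n' → Bool) :
    (a.tensor b).mat (Fin.append s s') (Fin.append t t') = a.mat s t * b.mat s' t' := by
  simp only [mat, tensor, Matrix.smul_apply, colMat_tensor, smul_eq_mul]
  ring

theorem trace_mat {n : ℕ} (a : LoopDiagram n n) :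
    a.mat.trace = 2 ^ (a.num + closureLoops a.diag) := by
  rw [mat, Matrix.trace_smul, trace_colMat, smul_eq_mul, pow_add]

/-- A diagram with loops is determined by its matrix in the two-colour model: identities between
pictures, with their numbers of loops, can be checked on matrices. -/
theorem mat_injective {m n : ℕ} : Function.Injective
    (mat : LoopDiagram m n → Matrix (Fin m → Bool) (Fin n → Bool) ℕ) := by
  rintro ⟨r, D⟩ ⟨r', D'⟩ h
  have h1 := congrFun (congrFun h (fun _ => true)) (fun _ => true)
  simp only [mat, Matrix.smul_apply, colMat_const, smul_eq_mul, mul_one] at h1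
  obtain rfl := Nat.pow_right_injective le_rfl h1
  congr 1
  apply colMat_injective
  ext s t
  have h2 := congrFun (congrFun h s) t
  simp only [mat, Matrix.smul_apply, smul_eq_mul] at h2
  exact Nat.eq_of_mul_eq_mul_left (by positivity) h2

theorem comp_assoc {k l m n : ℕ} (c : LoopDiagram m n) (b : LoopDiagram l m)
    (a : LoopDiagram k l) : c.comp (b.comp a) = (c.comp b).comp a :=
  mat_injective (by simp only [mat_comp, Matrix.mul_assoc])

variable {K : Type*} [Field K]

/-- The morphism represented by a diagram with loops, each loop being replaced by `d`. -/
noncomputable def toHom (d : K) {m n : ℕ} (a : LoopDiagram m n) : Hom K m n :=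
  Finsupp.single a.diag (d ^ a.num)

theorem toHom_of (d : K) {m n : ℕ} (D : Diagram m n) :
    toHom d (of D) = Finsupp.single D 1 := by simp [toHom, of]

theorem toHom_comp (d : K) {l m n : ℕ} (b : LoopDiagram m n) (a : LoopDiagram l m) :
    toHom d (b.comp a) = TemperleyLieb.comp d (toHom d b) (toHom d a) := by
  simp only [toHom, comp, TemperleyLieb.comp, Finsupp.linearCombination_single,
    LinearMap.smul_apply, Finsupp.smul_single, smul_eq_mul, pow_add]
  congr 1
  ring

theorem toHom_tensor (d : K) {m n m' n' : ℕ} (a : LoopDiagram m n) (b : LoopDiagram m' n') :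
    toHom d (a.tensor b) = TemperleyLieb.tensor (toHom d a) (toHom d b) := by
  simp [toHom, tensor, TemperleyLieb.tensor, pow_add]

theorem trace_toHom (d : K) {n : ℕ} (a : LoopDiagram n n) :
    trace d (toHom d a) = d ^ (a.num + closureLoops a.diag) := by
  simp [toHom, trace, pow_add]

/-- Two pictures with the same trace in the two-colour model have the same trace for every loop
parameter. -/
theorem trace_toHom_congr (d : K) {m n : ℕ} (a : LoopDiagram m m) (b : LoopDiagram n n)
    (h : a.mat.trace = b.mat.trace) : trace d (toHom d a) = trace d (toHom d b) := by
  rw [trace_mat, trace_mat] at h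
  rw [trace_toHom, trace_toHom, Nat.pow_right_injective le_rfl h]

end LoopDiagram

section

variable {K : Type*} [Field K]

/-- A property of morphisms holds if it holds for diagrams and is preserved by linear
combinations. -/
theorem hom_induction (d : K) {m n : ℕ} {P : Hom K m n → Prop}
    (h : ∀ D : Diagram m n, P ((LoopDiagram.of D).toHom d)) (h0 : P 0)
    (hadd : ∀ x y, P x → P y → P (x + y)) (hsmul : ∀ (r : K) x, P x → P (r • x)) (x : Hom K m n) :
    P x := by
  induction x using Finsupp.induction_linear with
  | zero => exact h0
  | add x y hx hy => exact hadd x y hx hy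
  | single D r =>
    have := hsmul r _ (h D)
    rwa [LoopDiagram.toHom_of, Finsupp.smul_single, smul_eq_mul, mul_one] at this

theorem comp_assoc (d : K) {k l m n : ℕ} (c : Hom K m n) (b : Hom K l m) (a : Hom K k l) :
    comp d c (comp d b a) = comp d (comp d c b) a := by
  induction c using hom_induction d with
  | h0 => simp
  | hadd x y hx hy => simp [hx, hy]
  | hsmul r x hx => simp [hx]
  | h C =>
  induction b using hom_induction d with
  | h0 => simp
  | hadd x y hx hy => simp [hx, hy]
  | hsmul r x hx => simp [hx]
  | h B =>
  induction a using hom_induction d with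
  | h0 => simp
  | hadd x y hx hy => simp [hx, hy]
  | hsmul r x hx => simp [hx]
  | h A => simp only [← LoopDiagram.toHom_comp, LoopDiagram.comp_assoc]

theorem trace_comp_comm (d : K) {m n : ℕ} (b : Hom K m n) (a : Hom K n m) :
    trace d (comp d b a) = trace d (comp d a b) := by
  induction b using hom_induction d with
  | h0 => simp
  | hadd x y hx hy => simp [hx, hy]
  | hsmul r x hx => simp [hx]
  | h B =>
  induction a using hom_induction d with
  | h0 => simp
  | hadd x y hx hy => simp [hx, hy]
  | hsmul r x hx => simp [hx]
  | h A =>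
  rw [← LoopDiagram.toHom_comp, ← LoopDiagram.toHom_comp]
  apply LoopDiagram.trace_toHom_congr
  rw [LoopDiagram.mat_comp, LoopDiagram.mat_comp, Matrix.trace_mul_comm]

/-- The identity morphism. -/
noncomputable def idHom (K : Type*) [Field K] (n : ℕ) : Hom K n n :=
  Finsupp.single (idDiagram rfl) 1

theorem idHom_eq (d : K) (n : ℕ) : idHom K n = (LoopDiagram.of (idDiagram rfl)).toHom d :=
  (LoopDiagram.toHom_of d _).symm

theorem comp_idHom (d : K) {m n : ℕ} (a : Hom K m n) : comp d a (idHom K m) = a := by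
  induction a using hom_induction d with
  | h0 => simp
  | hadd x y hx hy => simp [hx, hy]
  | hsmul r x hx => simp [hx]
  | h A =>
  rw [idHom_eq d, ← LoopDiagram.toHom_comp]
  congr 1
  apply LoopDiagram.mat_injective
  simp [colMat_id]

theorem idHom_comp (d : K) {m n : ℕ} (a : Hom K m n) : comp d (idHom K n) a = a := by
  induction a using hom_induction d with
  | h0 => simp
  | hadd x y hx hy => simp [hx, hy]
  | hsmul r x hx => simp [hx]
  | h A =>
  rw [idHom_eq d, ← LoopDiagram.toHom_comp]
  congr 1
  apply LoopDiagram.mat_injective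
  simp [colMat_id]

end

/-! ### Cups, caps and bending -/

namespace Diagram

/-- The upside-down mirror image of a diagram. -/
def flip {m n : ℕ} (D : Diagram m n) : Diagram n m where
  pair x := (D.pair x.swap).swap
  pair_pair x := by simp [D.pair_pair]
  pair_ne x h := D.pair_ne x.swap (by rw [← Sum.swap_swap (D.pair x.swap), h])
  noncrossing x y := by
    have key : ∀ z : Fin m ⊕ Fin n, pos z.swap + pos z + 1 = m + n := by
      rintro (i | j)
      · have := i.2
        simp only [Sum.swap_inl, pos]; omega
      · have := j.2
        simp only [Sum.swap_inr, pos]; omega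
    have h := D.noncrossing (D.pair y.swap) (D.pair x.swap)
    have h' := D.noncrossing (D.pair x.swap) (D.pair y.swap)
    have h2 := D.noncrossing y.swap x.swap
    have h3 := D.noncrossing x.swap y.swap
    simp only [D.pair_pair] at h h'
    have k1 := key x.swap
    have k2 := key y.swap
    have k3 := key (D.pair x.swap)
    have k4 := key (D.pair y.swap)
    rw [Sum.swap_swap] at k1 k2
    omega

theorem flip_flip {m n : ℕ} (D : Diagram m n) : D.flip.flip = D := by
  refine Diagram.ext (funext fun x => ?_)
  change (D.pair x.swap.swap).swap.swap = D.pair x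
  rw [Sum.swap_swap, Sum.swap_swap]

end Diagram

theorem colMat_flip {m n : ℕ} (D : Diagram m n) (s : Fin n → Bool) (t : Fin m → Bool) :
    colMat D.flip s t = colMat D t s := by
  have e : ∀ x, Sum.elim s t (Sum.swap x) = Sum.elim t s x := by rintro (i | j) <;> rfl
  have h : Compat D.flip s t ↔ Compat D t s := by
    constructor
    · intro h x
      have := h x.swap
      rw [e] at this
      rw [← this]
      simp only [Diagram.flip, Sum.swap_swap, e]
    · intro h x
      have := h x.swap
      rw [← e x.swap, Sum.swap_swap] at this
      rw [← this]
      simp only [Diagram.flip, e]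
  by_cases h' : Compat D t s
  · rw [colMat_eq_one h', colMat_eq_one (h.mpr h')]
  · rw [colMat_eq_zero h', colMat_eq_zero (mt h.mp h')]

/-- The diagram of `m` nested cups. -/
def nestCup (m : ℕ) : Diagram 0 (m + m) where
  pair := Sum.elim (fun i => i.elim0) (fun j => Sum.inr j.rev)
  pair_pair := by
    rintro (i | j)
    · exact i.elim0
    · simp
  pair_ne := by
    rintro (i | j)
    · exact i.elim0
    · have := j.2
      simp only [Sum.elim_inr, ne_eq, Sum.inr.injEq, Fin.ext_iff, Fin.val_rev]
      omega
  noncrossing := by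
    rintro (i | i) (j | j)
    · exact i.elim0
    · exact i.elim0
    · exact j.elim0
    · have := j.2
      have := i.2
      simp only [Sum.elim_inr, pos, Fin.val_rev]
      omega

/-- The diagram of `m` nested caps. -/
def nestCap (m : ℕ) : Diagram (m + m) 0 := (nestCup m).flip

theorem colMat_nestCup {m : ℕ} (e : Fin 0 → Bool) (s t : Fin m → Bool) :
    colMat (nestCup m) e (Fin.append s t) = if t = s ∘ Fin.rev then 1 else 0 := by
  unfold colMat
  congr 1
  rw [eq_iff_iff]
  have e1 : ∀ i : Fin m, (Fin.castAdd m i).rev = Fin.natAdd m i.rev := by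
    intro i; ext; have := i.2; simp; omega
  have e2 : ∀ i : Fin m, (Fin.natAdd m i).rev = Fin.castAdd m i.rev := by
    intro i; ext; have := i.2; simp; omega
  constructor
  · intro H
    funext i
    have := H (Sum.inr (Fin.natAdd m i))
    simp only [nestCup, Sum.elim_inr, e2, Fin.append_left, Fin.append_right] at this
    exact this.symm
  · rintro rfl (i | j)
    · exact i.elim0
    · induction j using Fin.addCases with
      | left i => simp only [nestCup, Sum.elim_inr, e1, Fin.append_left, Fin.append_right,
          Function.comp_apply, Fin.rev_rev]
      | right i => simp only [nestCup, Sum.elim_inr, e2, Fin.append_left, Fin.append_right,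
          Function.comp_apply]

theorem colMat_nestCap {m : ℕ} (e : Fin 0 → Bool) (s t : Fin m → Bool) :
    colMat (nestCap m) (Fin.append s t) e = if t = s ∘ Fin.rev then 1 else 0 := by
  rw [nestCap, colMat_flip, colMat_nestCup]

theorem sum_append {m n : ℕ} (f : (Fin (m + n) → Bool) → ℕ) :
    ∑ w, f w = ∑ s : Fin m → Bool, ∑ t : Fin n → Bool, f (Fin.append s t) := by
  rw [← (Fin.appendEquiv m n).sum_comp, Fintype.sum_prod_type]
  rfl

theorem exists_append {m n : ℕ} (w : Fin (m + n) → Bool) :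
    ∃ (s : Fin m → Bool) (t : Fin n → Bool), w = Fin.append s t := by
  obtain ⟨⟨s, t⟩, h⟩ := (Fin.appendEquiv m n).surjective w
  exact ⟨s, t, h.symm⟩

theorem idDiagram_mul {l m n : ℕ} (h : l = m) (X : Matrix (Fin m → Bool) (Fin n → Bool) ℕ)
    (s : Fin l → Bool) (t : Fin n → Bool) :
    (colMat (idDiagram h) * X) s t = X (s ∘ Fin.cast h.symm) t := by
  subst h
  rw [colMat_id, Matrix.one_mul]
  rfl

namespace LoopDiagram

/-- The identity picture. -/
def one (n : ℕ) : LoopDiagram n n := of (idDiagram rfl)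

@[simp] theorem mat_one (n : ℕ) : (one n).mat = 1 := by rw [one, mat_of, colMat_id]

theorem tensor_mul {m n m' n' k : ℕ} (a : LoopDiagram m n) (b : LoopDiagram m' n')
    (X : Matrix (Fin (n + n') → Bool) (Fin k → Bool) ℕ) (s : Fin m → Bool) (s' : Fin m' → Bool)
    (w : Fin k → Bool) : ((a.tensor b).mat * X) (Fin.append s s') w =
      ∑ u, ∑ u', a.mat s u * b.mat s' u' * X (Fin.append u u') w := by
  rw [Matrix.mul_apply, sum_append]
  simp only [mat_tensor]

theorem one_tensor_mul {m m' n' k : ℕ} (b : LoopDiagram m' n')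
    (X : Matrix (Fin (m + n') → Bool) (Fin k → Bool) ℕ) (s : Fin m → Bool) (s' : Fin m' → Bool)
    (w : Fin k → Bool) : (((one m).tensor b).mat * X) (Fin.append s s') w =
      ∑ u', b.mat s' u' * X (Fin.append s u') w := by
  rw [tensor_mul]
  simp [Matrix.one_apply]

theorem tensor_one_mul {m n m' k : ℕ} (a : LoopDiagram m n)
    (X : Matrix (Fin (n + m') → Bool) (Fin k → Bool) ℕ) (s : Fin m → Bool) (s' : Fin m' → Bool)
    (w : Fin k → Bool) : ((a.tensor (one m')).mat * X) (Fin.append s s') w =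
      ∑ u, a.mat s u * X (Fin.append u s') w := by
  rw [tensor_mul]
  simp [Matrix.one_apply]

theorem mat_ext_append {m n k : ℕ} {a b : LoopDiagram k (m + n)}
    (h : ∀ e s t, a.mat e (Fin.append s t) = b.mat e (Fin.append s t)) : a = b := by
  apply mat_injective
  ext e w
  obtain ⟨s, t, rfl⟩ := exists_append w
  exact h e s t

/-- Bending the top points of a picture down to the left. -/
noncomputable def bend {m n : ℕ} (a : LoopDiagram m n) : LoopDiagram 0 (m + n) :=
  ((one m).tensor a).comp (of (nestCup m))

theorem mat_bend {m n : ℕ} (a : LoopDiagram m n) (e : Fin 0 → Bool) (s : Fin m → Bool)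
    (t : Fin n → Bool) : a.bend.mat e (Fin.append s t) = a.mat (s ∘ Fin.rev) t := by
  rw [bend, mat_comp, Matrix.mul_apply, sum_append]
  simp [mat_tensor, colMat_nestCup, Matrix.one_apply]

theorem append_assoc_cast {m n p : ℕ} (a : Fin m → Bool) (b : Fin n → Bool) (c : Fin p → Bool) :
    Fin.append a (Fin.append b c) ∘ Fin.cast (Nat.add_assoc m n p) =
      Fin.append (Fin.append a b) c := by
  rw [Fin.append_assoc]

theorem append_assoc_cast_symm {m n p : ℕ} (a : Fin m → Bool) (b : Fin n → Bool)
    (c : Fin p → Bool) : Fin.append (Fin.append a b) c ∘ Fin.cast (Nat.add_assoc m n p).symm =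
      Fin.append a (Fin.append b c) := by
  rw [Fin.append_assoc]
  rfl

theorem comp_cast_add_zero {m : ℕ} (s : Fin m → Bool) (e : Fin 0 → Bool) :
    s ∘ Fin.cast (Nat.add_zero m) = Fin.append s e := by
  rw [Fin.append_right_nil s e rfl]

theorem comp_cast_zero_add {m : ℕ} (s : Fin m → Bool) (e : Fin 0 → Bool) :
    s ∘ Fin.cast (Nat.zero_add m) = Fin.append e s := by
  rw [Fin.append_left_nil e s rfl]

/-- A change of the number of points along an equality. -/
def cast {m n : ℕ} (h : m = n) : LoopDiagram m n := of (idDiagram h)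

theorem cast_mul {l m n : ℕ} (h : l = m) (X : Matrix (Fin m → Bool) (Fin n → Bool) ℕ)
    (s : Fin l → Bool) (t : Fin n → Bool) :
    ((cast h).mat * X) s t = X (s ∘ Fin.cast h.symm) t := by
  rw [cast, mat_of, idDiagram_mul]

theorem mat_cast {m n : ℕ} (h : m = n) (s : Fin m → Bool) (t : Fin n → Bool) :
    (cast h).mat s t = if s = t ∘ Fin.cast h then 1 else 0 := by
  rw [cast, mat_of, colMat_idDiagram]

theorem append_inj_iff {m n : ℕ} (s s' : Fin m → Bool) (t t' : Fin n → Bool) :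
    Fin.append s t = Fin.append s' t' ↔ s = s' ∧ t = t' := by
  rw [← Prod.mk.injEq]
  exact (Fin.appendEquiv m n).injective.eq_iff (a := (s, t)) (b := (s', t'))

/-- The inverse of `bend`. -/
noncomputable def unbend {m n : ℕ} (a : LoopDiagram 0 (m + n)) : LoopDiagram m n :=
  (cast (Nat.zero_add n)).comp (((of (nestCap m)).tensor (one n)).comp
    ((cast (Nat.add_assoc m m n).symm).comp (((one m).tensor a).comp (cast (Nat.add_zero m).symm))))

theorem mat_unbend {m n : ℕ} (a : LoopDiagram 0 (m + n)) (e : Fin 0 → Bool) (s : Fin m → Bool)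
    (t : Fin n → Bool) : a.unbend.mat s t = a.mat e (Fin.append (s ∘ Fin.rev) t) := by
  simp only [unbend, mat_comp, Matrix.mul_assoc]
  rw [cast_mul, comp_cast_add_zero s e, one_tensor_mul, sum_append]
  simp only [cast_mul, append_assoc_cast, tensor_one_mul, mat_of, colMat_nestCap, mat_cast,
    comp_cast_zero_add t e, append_inj_iff]
  simp [Subsingleton.elim _ e]

theorem unbend_bend {m n : ℕ} (a : LoopDiagram m n) : a.bend.unbend = a := by
  apply mat_injective
  ext s t
  rw [mat_unbend _ Fin.elim0, mat_bend]
  congr 1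
  funext i
  simp

theorem bend_one (m : ℕ) : (one m).bend = of (nestCup m) := by
  apply mat_ext_append
  intro e s t
  rw [mat_bend, mat_one, mat_of, colMat_nestCup, Matrix.one_apply]
  simp only [eq_comm]

theorem trace_mat_nestCap_comp_bend {n : ℕ} (a : LoopDiagram n n) :
    ((of (nestCap n)).comp a.bend).mat.trace = a.mat.trace := by
  rw [mat_comp, Matrix.trace, Fintype.sum_unique, Matrix.diag_apply, Matrix.mul_apply, sum_append,
    Matrix.trace]
  simp only [mat_bend, mat_of, colMat_nestCap]
  simp only [mul_ite, mul_one, mul_zero, Finset.sum_ite_eq', Finset.mem_univ, if_true,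
    Matrix.diag_apply]
  exact Fintype.sum_equiv (Fin.revPerm.arrowCongr (Equiv.refl Bool)) _ _ fun s => rfl

theorem comp_rev_inj {m : ℕ} (s t : Fin m → Bool) : s ∘ Fin.rev = t ∘ Fin.rev ↔ s = t :=
  Fin.rev_surjective.injective_comp_right.eq_iff

/-- Partial closure: the right part of the picture `c` is closed up through `b`. -/
noncomputable def closeRight {m n m' n' : ℕ} (b : LoopDiagram m' n')
    (c : LoopDiagram (n + n') (m + m')) : LoopDiagram n m :=
  (cast (Nat.add_zero m)).comp (((one m).tensor (of (nestCap m'))).comp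
    ((cast (Nat.add_assoc m m' m')).comp ((c.tensor (one m')).comp
      ((((one n).tensor b).tensor (one m')).comp ((cast (Nat.add_assoc n m' m').symm).comp
        (((one n).tensor (of (nestCup m'))).comp (cast (Nat.add_zero n).symm)))))))

/-- Partial closure: the left part of the picture `c` is closed up through `b`. -/
noncomputable def closeLeft {m n m' n' : ℕ} (b : LoopDiagram m' n')
    (c : LoopDiagram (n' + n) (m' + m)) : LoopDiagram n m :=
  (cast (Nat.zero_add m)).comp (((of (nestCap m')).tensor (one m)).comp
    ((cast (Nat.add_assoc m' m' m).symm).comp (((one m').tensor c).comp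
      (((one m').tensor (b.tensor (one n))).comp ((cast (Nat.add_assoc m' m' n)).comp
        (((of (nestCup m')).tensor (one n)).comp (cast (Nat.zero_add n).symm)))))))

theorem mat_closeRight {m n m' n' : ℕ} (b : LoopDiagram m' n')
    (c : LoopDiagram (n + n') (m + m')) (t : Fin n → Bool) (s : Fin m → Bool) :
    (closeRight b c).mat t s =
      ∑ s', ∑ t', b.mat s' t' * c.mat (Fin.append t t') (Fin.append s s') := by
  simp only [closeRight, mat_comp, Matrix.mul_assoc]
  have e : Fin 0 → Bool := Fin.elim0
  rw [cast_mul, comp_cast_add_zero t e, one_tensor_mul, sum_append]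
  simp only [cast_mul, append_assoc_cast, tensor_one_mul, sum_append, one_tensor_mul, mat_of,
    colMat_nestCap, colMat_nestCup, mat_cast, mat_tensor, mat_one, Matrix.one_apply,
    append_assoc_cast_symm, comp_cast_add_zero s e, append_inj_iff]
  simp [Subsingleton.elim _ e, comp_rev_inj]

theorem mat_closeLeft {m n m' n' : ℕ} (b : LoopDiagram m' n')
    (c : LoopDiagram (n' + n) (m' + m)) (t : Fin n → Bool) (s : Fin m → Bool) :
    (closeLeft b c).mat t s =
      ∑ s', ∑ t', b.mat s' t' * c.mat (Fin.append t' t) (Fin.append s' s) := by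
  simp only [closeLeft, mat_comp, Matrix.mul_assoc]
  have e : Fin 0 → Bool := Fin.elim0
  rw [cast_mul, comp_cast_zero_add t e, tensor_one_mul, sum_append]
  simp only [cast_mul, append_assoc_cast, tensor_one_mul, sum_append, one_tensor_mul, mat_of,
    colMat_nestCap, colMat_nestCup, mat_cast, mat_tensor, mat_one, Matrix.one_apply,
    append_assoc_cast_symm, comp_cast_zero_add s e, append_inj_iff]
  simp [Subsingleton.elim _ e]
  exact Fintype.sum_equiv (Fin.revPerm.arrowCongr (Equiv.refl Bool)) _ _ fun s => rfl

theorem trace_mat_comp_tensor_right {m n m' n' : ℕ} (a : LoopDiagram m n) (b : LoopDiagram m' n')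
    (c : LoopDiagram (n + n') (m + m')) :
    ((a.tensor b).comp c).mat.trace = (a.comp (closeRight b c)).mat.trace := by
  simp only [mat_comp, Matrix.trace, Matrix.diag_apply, Matrix.mul_apply, sum_append, mat_tensor,
    mat_closeRight, Finset.sum_mul]
  refine Finset.sum_congr rfl fun t _ => ?_
  rw [Finset.sum_comm]
  refine Finset.sum_congr rfl fun s _ => ?_
  rw [Finset.sum_comm]
  refine Finset.sum_congr rfl fun s' _ => ?_
  refine Finset.sum_congr rfl fun t' _ => ?_
  ring

theorem trace_mat_comp_tensor_left {m n m' n' : ℕ} (a : LoopDiagram m n) (b : LoopDiagram m' n')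
    (c : LoopDiagram (n' + n) (m' + m)) :
    ((b.tensor a).comp c).mat.trace = (a.comp (closeLeft b c)).mat.trace := by
  simp only [mat_comp, Matrix.trace, Matrix.diag_apply, Matrix.mul_apply, sum_append, mat_tensor,
    mat_closeLeft, Finset.sum_mul]
  rw [Finset.sum_comm]
  refine Finset.sum_congr rfl fun t _ => ?_
  rw [Finset.sum_comm]
  conv_rhs => rw [Finset.sum_comm]
  refine Finset.sum_congr rfl fun s' _ => ?_
  rw [Finset.sum_comm]
  refine Finset.sum_congr rfl fun s _ => ?_
  refine Finset.sum_congr rfl fun t' _ => ?_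
  ring

end LoopDiagram

/-! ### Ideals -/

section

variable {K : Type*} [Field K]

/-- In a trace, a tensor factor on the right can be absorbed into the other morphism. -/
theorem exists_trace_comp_tensor_right (d : K) {m n m' n' : ℕ} (b : Hom K m' n')
    (c : Hom K (n + n') (m + m')) : ∃ c' : Hom K n m, ∀ a : Hom K m n,
      trace d (comp d (tensor a b) c) = trace d (comp d a c') := by
  induction b using hom_induction d with
  | h0 => exact ⟨0, by simp⟩
  | hadd x y hx hy =>
    obtain ⟨x', hx⟩ := hx
    obtain ⟨y', hy⟩ := hy
    exact ⟨x' + y', fun a => by simp [hx, hy]⟩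
  | hsmul r x hx =>
    obtain ⟨x', hx⟩ := hx
    exact ⟨r • x', fun a => by simp [hx]⟩
  | h B =>
  induction c using hom_induction d with
  | h0 => exact ⟨0, by simp⟩
  | hadd x y hx hy =>
    obtain ⟨x', hx⟩ := hx
    obtain ⟨y', hy⟩ := hy
    exact ⟨x' + y', fun a => by simp [hx, hy]⟩
  | hsmul r x hx =>
    obtain ⟨x', hx⟩ := hx
    exact ⟨r • x', fun a => by simp [hx]⟩
  | h C =>
  refine ⟨(LoopDiagram.closeRight (.of B) (.of C)).toHom d, fun a => ?_⟩
  induction a using hom_induction d with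
  | h0 => simp
  | hadd x y hx hy => simp [hx, hy]
  | hsmul r x hx => simp [hx]
  | h A =>
  rw [← LoopDiagram.toHom_tensor, ← LoopDiagram.toHom_comp, ← LoopDiagram.toHom_comp]
  exact LoopDiagram.trace_toHom_congr _ _ _ (LoopDiagram.trace_mat_comp_tensor_right _ _ _)

/-- In a trace, a tensor factor on the left can be absorbed into the other morphism. -/
theorem exists_trace_comp_tensor_left (d : K) {m n m' n' : ℕ} (b : Hom K m' n')
    (c : Hom K (n' + n) (m' + m)) : ∃ c' : Hom K n m, ∀ a : Hom K m n,
      trace d (comp d (tensor b a) c) = trace d (comp d a c') := by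
  induction b using hom_induction d with
  | h0 => exact ⟨0, by simp⟩
  | hadd x y hx hy =>
    obtain ⟨x', hx⟩ := hx
    obtain ⟨y', hy⟩ := hy
    exact ⟨x' + y', fun a => by simp [hx, hy]⟩
  | hsmul r x hx =>
    obtain ⟨x', hx⟩ := hx
    exact ⟨r • x', fun a => by simp [hx]⟩
  | h B =>
  induction c using hom_induction d with
  | h0 => exact ⟨0, by simp⟩
  | hadd x y hx hy =>
    obtain ⟨x', hx⟩ := hx
    obtain ⟨y', hy⟩ := hy
    exact ⟨x' + y', fun a => by simp [hx, hy]⟩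
  | hsmul r x hx =>
    obtain ⟨x', hx⟩ := hx
    exact ⟨r • x', fun a => by simp [hx]⟩
  | h C =>
  refine ⟨(LoopDiagram.closeLeft (.of B) (.of C)).toHom d, fun a => ?_⟩
  induction a using hom_induction d with
  | h0 => simp
  | hadd x y hx hy => simp [hx, hy]
  | hsmul r x hx => simp [hx]
  | h A =>
  rw [← LoopDiagram.toHom_tensor, ← LoopDiagram.toHom_comp, ← LoopDiagram.toHom_comp]
  exact LoopDiagram.trace_toHom_congr _ _ _ (LoopDiagram.trace_mat_comp_tensor_left _ _ _)

/-- Closure under tensor products holds as the trace of `(a ⊗ b) c` is the trace of the composite of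
`a` with a partial closure of `c` through `b`. -/
theorem isTensorIdeal_negligible (d : K) : IsTensorIdeal d (negligible d) where
  comp_left b a ha := by
    intro c
    rw [← comp_assoc, trace_comp_comm, ← comp_assoc]
    exact ha _
  comp_right b a hb := by
    intro c
    rw [← comp_assoc]
    exact hb _
  tensor_left a b hb := by
    intro c
    obtain ⟨c', h⟩ := exists_trace_comp_tensor_left d a c
    rw [h]
    exact hb _
  tensor_right a b ha := by
    intro c
    obtain ⟨c', h⟩ := exists_trace_comp_tensor_right d b c
    rw [h]
    exact ha _

/-- Bending the top points of a morphism down to the left. -/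
noncomputable def bendHom (d : K) {m n : ℕ} (a : Hom K m n) : Hom K 0 (m + n) :=
  comp d (tensor (idHom K m) a) ((LoopDiagram.of (nestCup m)).toHom d)

/-- The inverse of `bendHom`. -/
noncomputable def unbendHom (d : K) {m n : ℕ} (a : Hom K 0 (m + n)) : Hom K m n :=
  comp d ((LoopDiagram.cast (Nat.zero_add n)).toHom d)
    (comp d (tensor ((LoopDiagram.of (nestCap m)).toHom d) (idHom K n))
      (comp d ((LoopDiagram.cast (Nat.add_assoc m m n).symm).toHom d)
        (comp d (tensor (idHom K m) a) ((LoopDiagram.cast (Nat.add_zero m).symm).toHom d))))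

theorem bendHom_toHom (d : K) {m n : ℕ} (a : LoopDiagram m n) :
    bendHom d (a.toHom d) = a.bend.toHom d := by
  simp only [bendHom, LoopDiagram.bend, LoopDiagram.toHom_comp, LoopDiagram.toHom_tensor,
    LoopDiagram.one, idHom_eq d]

theorem unbendHom_toHom (d : K) {m n : ℕ} (a : LoopDiagram 0 (m + n)) :
    unbendHom d (a.toHom d) = a.unbend.toHom d := by
  simp only [unbendHom, LoopDiagram.unbend, LoopDiagram.toHom_comp, LoopDiagram.toHom_tensor,
    LoopDiagram.one, idHom_eq d]

theorem unbendHom_bendHom (d : K) {m n : ℕ} (a : Hom K m n) : unbendHom d (bendHom d a) = a := by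
  induction a using hom_induction d with
  | h0 => simp [unbendHom, bendHom]
  | hadd x y hx hy =>
    simp only [unbendHom, bendHom, map_add, LinearMap.add_apply] at *
    rw [hx, hy]
  | hsmul r x hx =>
    simp only [unbendHom, bendHom, map_smul, LinearMap.smul_apply] at *
    rw [hx]
  | h A => rw [bendHom_toHom, unbendHom_toHom, LoopDiagram.unbend_bend]

instance : Subsingleton (Diagram 0 0) :=
  ⟨fun D D' => Diagram.ext (funext fun x => by rcases x with i | i <;> exact i.elim0)⟩

theorem toHom_zero_zero (d : K) (a : LoopDiagram 0 0) :
    a.toHom d = trace d (a.toHom d) • idHom K 0 := by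
  have h : closureLoops a.diag = 0 := by
    rw [closureLoops, Nat.card_eq_zero]
    left
    refine ⟨fun c => ?_⟩
    induction c using Quot.ind with
    | mk v => rcases v with i | i <;> exact i.elim0
  rw [LoopDiagram.trace_toHom, h, idHom, LoopDiagram.toHom, Finsupp.smul_single]
  simp [Subsingleton.elim a.diag (idDiagram rfl)]

/-- Closing up an endomorphism, as a composite of its bent form with nested caps. -/
theorem trace_smul_idHom (d : K) {n : ℕ} (a : Hom K n n) :
    comp d ((LoopDiagram.of (nestCap n)).toHom d) (bendHom d a) = trace d a • idHom K 0 := by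
  induction a using hom_induction d with
  | h0 => simp [bendHom]
  | hadd x y hx hy =>
    simp only [bendHom, map_add, LinearMap.add_apply, add_smul] at *
    rw [hx, hy]
  | hsmul r x hx =>
    simp only [bendHom, map_smul, LinearMap.smul_apply, smul_assoc] at *
    rw [hx]
  | h A =>
    rw [bendHom_toHom, ← LoopDiagram.toHom_comp, toHom_zero_zero]
    congr 1
    exact LoopDiagram.trace_toHom_congr _ _ _ (LoopDiagram.trace_mat_nestCap_comp_bend _)

variable {d : K} {J : ∀ m n : ℕ, Submodule K (Hom K m n)}

theorem IsTensorIdeal.bendHom_mem (hJ : IsTensorIdeal d J) {m n : ℕ} {a : Hom K m n}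
    (ha : a ∈ J m n) : bendHom d a ∈ J 0 (m + n) :=
  hJ.comp_right _ _ (hJ.tensor_left _ _ ha)

theorem IsTensorIdeal.unbendHom_mem (hJ : IsTensorIdeal d J) {m n : ℕ} {a : Hom K 0 (m + n)}
    (ha : a ∈ J 0 (m + n)) : unbendHom d a ∈ J m n :=
  hJ.comp_left _ _ (hJ.comp_left _ _ (hJ.comp_left _ _ (hJ.comp_right _ _
    (hJ.tensor_left _ _ ha))))

theorem IsTensorIdeal.mem_of_bendHom_mem (hJ : IsTensorIdeal d J) {m n : ℕ} {a : Hom K m n}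
    (ha : bendHom d a ∈ J 0 (m + n)) : a ∈ J m n := by
  rw [← unbendHom_bendHom d a]
  exact hJ.unbendHom_mem ha

end

/-! ### Elementary caps -/

/-- The order embedding of `ℕ` into `ℕ` whose image omits `i` and `i + 1`. -/
def skip (i q : ℕ) : ℕ := if q < i then q else q + 2

theorem skip_lt {i q M N : ℕ} (h : N = M + 2) (hq : q < M) : skip i q < N := by
  unfold skip; split_ifs <;> omega

/-- The diagram that caps off the points `i` and `i + 1` of the top edge. -/
def capAt {N M : ℕ} (h : N = M + 2) (i : ℕ) (hi : i ≤ M) : Diagram N M where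
  pair := Sum.elim
    (fun p => if h1 : (p : ℕ) < i then Sum.inr ⟨p, by omega⟩ else
      if h2 : (p : ℕ) = i then Sum.inl ⟨i + 1, by omega⟩ else
      if h3 : (p : ℕ) = i + 1 then Sum.inl ⟨i, by omega⟩ else
      Sum.inr ⟨p - 2, by have := p.2; omega⟩)
    (fun q => Sum.inl ⟨skip i q, skip_lt h q.2⟩)
  pair_pair := by
    rintro (p | q)
    · have := p.2
      simp only [Sum.elim_inl]
      split_ifs with h1 h2 h3
      · simp only [Sum.elim_inr, skip, h1, if_true]
      · have e1 : ¬ i + 1 < i := by omega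
        simp [h2.symm]
        rw [Fin.le_def]
        simp
      · simp [h3.symm]
      · have e1 : ¬ (p : ℕ) - 2 < i := by omega
        simp only [Sum.elim_inr, skip, e1, if_false, Sum.inl.injEq, Fin.ext_iff]
        omega
    · by_cases h1 : (q : ℕ) < i
      · simp [skip, h1]
      · have e1 : ¬ (q : ℕ) + 2 < i := by omega
        have e2 : ¬ (q : ℕ) + 2 = i := by omega
        have e3 : ¬ (q : ℕ) + 1 = i := by omega
        simp [skip, h1, e1, e2, e3]
  pair_ne := by
    rintro (p | q)
    · have := p.2
      simp only [Sum.elim_inl]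
      split_ifs with h1 h2 h3
      · simp
      · simp [Fin.ext_iff]; omega
      · simp [Fin.ext_iff]; omega
      · simp
    · simp
  noncrossing := by
    subst h
    rintro (p | p) (q | q) <;> have := p.2 <;> have := q.2 <;>
      simp only [Sum.elim_inl, Sum.elim_inr, skip] <;> split_ifs <;> simp only [pos] <;>
      (try split_ifs) <;> omega

/-- The colouring of `N = M + 2` points that is constant on the points `i` and `i + 1`, and given on
the other points. -/
def insertPair {N M : ℕ} (h : N = M + 2) (i : ℕ) (hi : i ≤ M) (u : Fin M → Bool) (c : Bool) :
    Fin N → Bool := fun p => if h1 : (p : ℕ) < i then u ⟨p, by omega⟩ else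
      if h2 : (p : ℕ) ≤ i + 1 then c else u ⟨p - 2, by have := p.2; omega⟩

theorem eq_or_skip {N M : ℕ} (h : N = M + 2) (i : ℕ) (hi : i ≤ M) (p : Fin N) :
    p = ⟨i, by omega⟩ ∨ p = ⟨i + 1, by omega⟩ ∨
    ∃ q : Fin M, p = ⟨skip i q, skip_lt h q.2⟩ := by
  have := p.2
  by_cases h1 : (p : ℕ) < i
  · exact Or.inr (Or.inr ⟨⟨p, by omega⟩, by simp [skip, h1]⟩)
  by_cases h2 : (p : ℕ) = i
  · exact Or.inl (Fin.ext h2)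
  by_cases h3 : (p : ℕ) = i + 1
  · exact Or.inr (Or.inl (Fin.ext h3))
  · refine Or.inr (Or.inr ⟨⟨p - 2, by omega⟩, Fin.ext ?_⟩)
    have : ¬ (p : ℕ) - 2 < i := by omega
    simp only [skip, this, if_false]
    omega

section

variable {N M : ℕ} (h : N = M + 2) (i : ℕ) (hi : i ≤ M)

theorem insertPair_skip (u : Fin M → Bool) (c : Bool) (q : Fin M) :
    insertPair h i hi u c ⟨skip i q, skip_lt h q.2⟩ = u q := by
  unfold insertPair skip
  by_cases h1 : (q : ℕ) < i
  · simp [h1]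
  · have e1 : ¬ (q : ℕ) + 2 < i := by omega
    have e2 : ¬ (q : ℕ) + 1 ≤ i := by omega
    simp [h1, e1, e2]

theorem insertPair_left (u : Fin M → Bool) (c : Bool) :
    insertPair h i hi u c ⟨i, by omega⟩ = c := by simp [insertPair]

theorem insertPair_right (u : Fin M → Bool) (c : Bool) :
    insertPair h i hi u c ⟨i + 1, by omega⟩ = c := by simp [insertPair]

theorem compat_capAt_iff (s : Fin N → Bool) (u : Fin M → Bool) :
    Compat (capAt h i hi) s u ↔
      s ⟨i, by omega⟩ = s ⟨i + 1, by omega⟩ ∧ ∀ q : Fin M, s ⟨skip i q, skip_lt h q.2⟩ = u q := by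
  constructor
  · intro H
    refine ⟨?_, fun q => H (Sum.inr q)⟩
    have := H (Sum.inl ⟨i, by omega⟩)
    simpa [capAt] using this.symm
  · rintro ⟨h1, h2⟩ (p | q)
    · rcases eq_or_skip h i hi p with rfl | rfl | ⟨q, rfl⟩
      · simp [capAt, h1]
      · simp [capAt, h1]
      · have e : (capAt h i hi).pair (Sum.inl ⟨skip i q, skip_lt h q.2⟩) = Sum.inr q :=
          (capAt h i hi).pair_pair (Sum.inr q)
        rw [e]
        exact (h2 q).symm
    · exact h2 q

theorem compat_capAt_insertPair (u : Fin M → Bool) (c : Bool) :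
    Compat (capAt h i hi) (insertPair h i hi u c) u := by
  rw [compat_capAt_iff, insertPair_left, insertPair_right]
  exact ⟨rfl, insertPair_skip h i hi u c⟩

theorem eq_insertPair_of_compat {s : Fin N → Bool} {u : Fin M → Bool}
    (H : Compat (capAt h i hi) s u) : s = insertPair h i hi u (s ⟨i, by omega⟩) := by
  rw [compat_capAt_iff] at H
  funext p
  rcases eq_or_skip h i hi p with rfl | rfl | ⟨q, rfl⟩
  · rw [insertPair_left]
  · rw [insertPair_right, H.1]
  · rw [insertPair_skip, H.2]

theorem sum_colMat_capAt (u : Fin M → Bool) (f : (Fin N → Bool) → ℕ) :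
    ∑ s, colMat (capAt h i hi) s u * f s = ∑ c, f (insertPair h i hi u c) := by
  symm
  refine Fintype.sum_of_injective (insertPair h i hi u) ?_ _ _ ?_ ?_
  · intro c c' hc
    rw [← insertPair_left h i hi u c, hc, insertPair_left]
  · intro s hs
    rw [colMat_eq_zero, zero_mul]
    exact fun H => hs ⟨_, (eq_insertPair_of_compat h i hi H).symm⟩
  · intro c
    rw [colMat_eq_one (compat_capAt_insertPair h i hi u c), one_mul]

/-- The diagram with a cup between the points `i` and `i + 1` of the bottom edge. -/
def cupAt : Diagram M N := (capAt h i hi).flip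

theorem compat_insertPair_of_compat {n : ℕ} (P : Diagram N n)
    (hP : P.pair (Sum.inl ⟨i, by omega⟩) = Sum.inl ⟨i + 1, by omega⟩) (u : Fin M → Bool)
    (c c' : Bool) (t : Fin n → Bool) (H : Compat P (insertPair h i hi u c) t) :
    Compat P (insertPair h i hi u c') t := by
  have hP' : P.pair (Sum.inl ⟨i + 1, by omega⟩) = Sum.inl ⟨i, by omega⟩ := by
    rw [← hP, P.pair_pair]
  have key : ∀ x : Fin N ⊕ Fin n, x ≠ Sum.inl ⟨i, by omega⟩ → x ≠ Sum.inl ⟨i + 1, by omega⟩ →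
      Sum.elim (insertPair h i hi u c') t x = Sum.elim (insertPair h i hi u c) t x := by
    rintro (p | q) h1 h2
    · rcases eq_or_skip h i hi p with rfl | rfl | ⟨q, rfl⟩
      · exact absurd rfl h1
      · exact absurd rfl h2
      · simp only [Sum.elim_inl, insertPair_skip]
    · rfl
  intro x
  by_cases h1 : x = Sum.inl ⟨i, by omega⟩
  · rw [h1, hP, Sum.elim_inl, Sum.elim_inl, insertPair_left, insertPair_right]
  by_cases h2 : x = Sum.inl ⟨i + 1, by omega⟩
  · rw [h2, hP', Sum.elim_inl, Sum.elim_inl, insertPair_left, insertPair_right]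
  rw [key x h1 h2, key, H x]
  · intro h3
    rw [← P.pair_pair x, h3, hP] at h2
    exact h2 rfl
  · intro h3
    rw [← P.pair_pair x, h3, hP'] at h1
    exact h1 rfl

/-- A picture that joins the top points `i` and `i + 1` factors, up to a loop, through the cap at
these points. -/
theorem comp_cupAt_comp_capAt {n : ℕ} (P : LoopDiagram N n)
    (hP : P.diag.pair (Sum.inl ⟨i, by omega⟩) = Sum.inl ⟨i + 1, by omega⟩) :
    (P.comp (.of (cupAt h i hi))).comp (.of (capAt h i hi)) = ⟨P.num + 1, P.diag⟩ := by
  apply LoopDiagram.mat_injective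
  ext s t
  have e : ∀ u, ((LoopDiagram.of (cupAt h i hi)).mat * P.mat) u t =
      ∑ c, P.mat (insertPair h i hi u c) t := by
    intro u
    rw [Matrix.mul_apply, ← sum_colMat_capAt h i hi u fun s => P.mat s t]
    refine Finset.sum_congr rfl fun s _ => ?_
    rw [LoopDiagram.mat_of, cupAt, colMat_flip]
  rw [LoopDiagram.mat_comp, LoopDiagram.mat_comp, Matrix.mul_apply]
  simp only [e]
  simp only [LoopDiagram.mat_of]
  by_cases hs : s ⟨i, by omega⟩ = s ⟨i + 1, by omega⟩
  · set u : Fin M → Bool := fun q => s ⟨skip i q, skip_lt h q.2⟩ with hu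
    have hc : Compat (capAt h i hi) s u := by
      rw [compat_capAt_iff]; exact ⟨hs, fun q => rfl⟩
    rw [Finset.sum_eq_single u, colMat_eq_one hc, one_mul]
    · have e2 : ∀ c, P.mat (insertPair h i hi u c) t = P.mat s t := by
        intro c
        conv_rhs => rw [eq_insertPair_of_compat h i hi hc]
        simp only [LoopDiagram.mat, Matrix.smul_apply]
        congr 1
        by_cases h1 : Compat P.diag (insertPair h i hi u c) t
        · rw [colMat_eq_one h1, colMat_eq_one (compat_insertPair_of_compat h i hi _ hP _ _ _ _ h1)]
        · rw [colMat_eq_zero h1, colMat_eq_zero fun h2 =>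
            h1 (compat_insertPair_of_compat h i hi _ hP _ _ _ _ h2)]
      simp only [e2, Fintype.sum_bool]
      simp only [LoopDiagram.mat, Matrix.smul_apply, smul_eq_mul, pow_succ]
      ring
    · intro u' _ hu'
      rw [colMat_eq_zero, zero_mul]
      rw [compat_capAt_iff]
      exact fun H => hu' (funext fun q => (H.2 q).symm)
    · simp
  · rw [Finset.sum_eq_zero]
    · rw [LoopDiagram.mat, Matrix.smul_apply, colMat_eq_zero, smul_zero]
      intro H
      have := H (Sum.inl ⟨i, by omega⟩)
      rw [hP] at this
      exact hs this.symm
    · intro u _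
      rw [colMat_eq_zero, zero_mul]
      rw [compat_capAt_iff]
      exact fun H => hs H.1

/-- If `P` joins the top points `i` and `i + 1`, then `d • (P ∘ a)` factors through the cap of `a`
at these points. -/
theorem smul_comp_eq {K : Type*} [Field K] (d : K) {n l : ℕ} (P : LoopDiagram N n)
    (hP : P.diag.pair (Sum.inl ⟨i, by omega⟩) = Sum.inl ⟨i + 1, by omega⟩) (a : Hom K l N) :
    d • comp d (P.toHom d) a = comp d (comp d (P.toHom d) ((LoopDiagram.of (cupAt h i hi)).toHom d))
      (comp d ((LoopDiagram.of (capAt h i hi)).toHom d) a) := by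
  rw [comp_assoc, ← LoopDiagram.toHom_comp, ← LoopDiagram.toHom_comp,
    comp_cupAt_comp_capAt h i hi P hP]
  rw [← LinearMap.smul_apply, ← map_smul]
  congr 2
  rw [LoopDiagram.toHom, LoopDiagram.toHom, Finsupp.smul_single, smul_eq_mul, pow_succ']

end

/-! ### Diagrams without top points -/

namespace Diagram

variable {N : ℕ}

/-- The other end of the strand at the bottom point `p` of a diagram without top points. -/
def mate (D : Diagram 0 N) (p : Fin N) : Fin N := Sum.elim Fin.elim0 id (D.pair (Sum.inr p))

theorem pair_inr (D : Diagram 0 N) (p : Fin N) : D.pair (Sum.inr p) = Sum.inr (D.mate p) := by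
  unfold mate
  rcases D.pair (Sum.inr p) with i | q
  · exact i.elim0
  · rfl

theorem mate_mate (D : Diagram 0 N) (p : Fin N) : D.mate (D.mate p) = p := by
  have := D.pair_pair (Sum.inr p)
  rw [pair_inr, pair_inr] at this
  exact Sum.inr_injective this

theorem mate_ne (D : Diagram 0 N) (p : Fin N) : D.mate p ≠ p := by
  have := D.pair_ne (Sum.inr p)
  rw [pair_inr] at this
  exact fun h => this (congrArg _ h)

theorem mate_injective (D : Diagram 0 N) : Function.Injective D.mate :=
  Function.LeftInverse.injective D.mate_mate

theorem mate_noncrossing (D : Diagram 0 N) {p q : Fin N} (h1 : p < q) (h2 : q < D.mate p)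
    (h3 : D.mate p < D.mate q) : False := by
  have := D.noncrossing (Sum.inr (D.mate q)) (Sum.inr (D.mate p))
  rw [pair_inr, pair_inr, mate_mate, mate_mate] at this
  simp only [pos, Fin.lt_def] at *
  have := (D.mate q).2
  omega

theorem ext_mate {D D' : Diagram 0 N} (h : ∀ p, D.mate p = D'.mate p) : D = D' := by
  ext1
  funext x
  rcases x with i | p
  · exact i.elim0
  · rw [pair_inr, pair_inr, h]

theorem mate_eq_of_forall_compat (D : Diagram 0 N) (p q : Fin N) (hpq : p ≠ q)
    (h : ∀ e s, Compat D e s → s p = s q) : D.mate p = q := by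
  have := pair_eq_of_forall_compat D (Sum.inr p) (Sum.inr q) (by simpa using hpq)
    (fun e s H => h e s H)
  rw [pair_inr] at this
  exact Sum.inr_injective this

theorem compat_mate {D : Diagram 0 N} {e : Fin 0 → Bool} {s : Fin N → Bool} (h : Compat D e s)
    (p : Fin N) : s (D.mate p) = s p := by
  have := h (Sum.inr p)
  rwa [pair_inr] at this

theorem compat_of_mate {D : Diagram 0 N} {e : Fin 0 → Bool} {s : Fin N → Bool}
    (h : ∀ p, s (D.mate p) = s p) : Compat D e s := by
  rintro (i | p)
  · exact i.elim0
  · rw [pair_inr]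
    exact h p

/-- Inside every strand there is a strand that joins neighbours. -/
theorem exists_adjacent (D : Diagram 0 N) (p q : Fin N) (hpq : p < q) (h : D.mate p = q) :
    ∃ (i : ℕ) (hi : i + 1 < N), p.1 ≤ i ∧ i + 1 ≤ q.1 ∧ D.mate ⟨i, by omega⟩ = ⟨i + 1, hi⟩ := by
  induction hn : q.1 - p.1 using Nat.strong_induction_on generalizing p q with
  | _ n ih =>
  rw [Fin.lt_def] at hpq
  have hq := q.2
  by_cases h1 : q.1 = p.1 + 1
  · exact ⟨p, by omega, le_rfl, by omega, by rw [Fin.eta, h]; exact Fin.ext h1⟩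
  have hr : p.1 + 1 < N := by omega
  set r : Fin N := ⟨p.1 + 1, hr⟩ with hrd
  have hr1 : r.1 = p.1 + 1 := rfl
  have c1 : D.mate r ≠ p := fun h2 => by
    rw [← D.mate_mate r, h2, h] at hr1; omega
  have c2 : D.mate r ≠ q := fun h2 => by
    rw [← D.mate_mate r, h2, ← h, D.mate_mate] at hr1; omega
  have c3 := D.mate_ne r
  have c4 : ¬ q < D.mate r := fun h2 => D.mate_noncrossing (p := p) (q := r)
    (by rw [Fin.lt_def]; omega) (by rw [h, Fin.lt_def]; omega) (by rwa [h])
  have c5 : ¬ D.mate r < p := fun h2 => D.mate_noncrossing (p := D.mate r) (q := p)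
    h2 (by rw [D.mate_mate, Fin.lt_def]; omega) (by rw [D.mate_mate, h, Fin.lt_def]; omega)
  rw [Ne, Fin.ext_iff] at c1 c2 c3
  rw [Fin.lt_def] at c4 c5
  obtain ⟨i, hi, h2, h3, h4⟩ := ih ((D.mate r).1 - r.1) (by omega) r (D.mate r)
    (by rw [Fin.lt_def]; omega) rfl rfl
  exact ⟨i, hi, by omega, by omega, h4⟩

/-- A window that covers more than half of the points contains both ends of some strand, hence a
strand that joins neighbours. -/
theorem exists_adjacent_window (D : Diagram 0 N) (a b : ℕ) (hb : b ≤ N)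
    (h : N < 2 * (b - a)) :
    ∃ (i : ℕ) (hi : i + 1 < N), a ≤ i ∧ i + 1 < b ∧ D.mate ⟨i, by omega⟩ = ⟨i + 1, hi⟩ := by
  have key : ∃ p : Fin N, (a ≤ p.1 ∧ p.1 < b) ∧ (a ≤ (D.mate p).1 ∧ (D.mate p).1 < b) := by
    by_contra hcon
    push Not at hcon
    -- otherwise the strands inject the window into its complement
    let f : ℕ → ℕ := fun p => if hp : p < N then (D.mate ⟨p, hp⟩).1 else 0
    have hf : ∀ p (hp : p < N), f p = (D.mate ⟨p, hp⟩).1 := fun p hp => dif_pos hp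
    have hle : (Finset.Ico a b).card ≤ (Finset.range N \ Finset.Ico a b).card := by
      apply Finset.card_le_card_of_injOn f
      · intro p hp
        rw [Finset.mem_coe, Finset.mem_Ico] at hp
        have hpN : p < N := by omega
        rw [Finset.mem_coe, hf p hpN, Finset.mem_sdiff, Finset.mem_range, Finset.mem_Ico]
        refine ⟨Fin.is_lt _, fun hc => ?_⟩
        have := hcon ⟨p, hpN⟩ hp hc.1
        omega
      · intro p hp q hq hpq
        rw [Finset.mem_coe, Finset.mem_Ico] at hp hq
        rw [hf p (by omega), hf q (by omega)] at hpq
        exact congrArg Fin.val (D.mate_injective (Fin.ext hpq))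
    rw [Finset.card_sdiff_of_subset, Finset.card_range, Nat.card_Ico] at hle
    · omega
    · intro p hp
      rw [Finset.mem_Ico] at hp
      rw [Finset.mem_range]; omega
  obtain ⟨p, hp, hp'⟩ := key
  rcases lt_or_gt_of_ne (D.mate_ne p) with h1 | h1
  · obtain ⟨i, hi, h2, h3, h4⟩ := D.exists_adjacent _ p h1 (D.mate_mate p)
    exact ⟨i, hi, by omega, by omega, h4⟩
  · obtain ⟨i, hi, h2, h3, h4⟩ := D.exists_adjacent p _ h1 rfl
    exact ⟨i, hi, by omega, by omega, h4⟩

theorem even_of_diagram (D : Diagram 0 N) : Even N := by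
  have := sum_strands D (fun _ => 1) (fun _ => rfl)
  rw [Finset.sum_const, Finset.card_univ, Fintype.card_sum, Fintype.card_fin, Fintype.card_fin,
    zero_add, nsmul_eq_mul, mul_one] at this
  exact (ZMod.natCast_eq_zero_iff_even).mp this

/-- The nested cups form the only diagram without a strand between the first `k` points. -/
theorem eq_nestCup {k : ℕ} (D : Diagram 0 (k + k)) (h : ∀ p : Fin (k + k), p.1 < k →
    k ≤ (D.mate p).1) : D = nestCup k := by
  -- the strands that start in the left half end in the right half, in reverse order
  have anti : ∀ p q : Fin (k + k), p < q → q.1 < k → D.mate q < D.mate p := by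
    intro p q hpq hq
    have h1 := h p (by rw [Fin.lt_def] at hpq; omega)
    rcases lt_trichotomy (D.mate q) (D.mate p) with h2 | h2 | h2
    · exact h2
    · exact absurd (D.mate_injective h2) hpq.ne'
    · exact (D.mate_noncrossing hpq (by rw [Fin.lt_def]; omega) h2).elim
  have upper : ∀ (p : ℕ) (hp : p < k), (D.mate ⟨p, by omega⟩).1 + p + 1 ≤ k + k := by
    intro p
    induction p with
    | zero => intro hp; have := (D.mate ⟨0, by omega⟩).2; omega
    | succ p ih =>
      intro hp
      have h1 := ih (by omega)
      have h2 := anti ⟨p, by omega⟩ ⟨p + 1, by omega⟩ (by rw [Fin.lt_def]; simp) hp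
      rw [Fin.lt_def] at h2
      omega
  have lower : ∀ (r : ℕ) (hr : r < k), k + r ≤ (D.mate ⟨k - 1 - r, by omega⟩).1 := by
    intro r
    induction r with
    | zero => intro hr; exact h _ (by simp only; omega)
    | succ r ih =>
      intro hr
      have h1 := ih (by omega)
      have h2 := anti ⟨k - 1 - (r + 1), by omega⟩ ⟨k - 1 - r, by omega⟩
        (by rw [Fin.lt_def]; simp only; omega) (by simp only; omega)
      rw [Fin.lt_def] at h2
      omega
  have first : ∀ p : Fin (k + k), p.1 < k → D.mate p = p.rev := by
    intro p hp
    have h1 := upper p hp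
    have h2 := lower (k - 1 - p) (by omega)
    have e : (⟨k - 1 - (k - 1 - p.1), by omega⟩ : Fin (k + k)) = p := Fin.ext (by simp only; omega)
    rw [e] at h2
    rw [Fin.eta] at h1
    apply Fin.ext
    rw [Fin.val_rev]
    omega
  apply ext_mate
  intro p
  have hn : (nestCup k).mate p = p.rev := rfl
  rw [hn]
  by_cases hp : p.1 < k
  · exact first p hp
  · have h1 := first p.rev (by rw [Fin.val_rev]; omega)
    rw [Fin.rev_rev] at h1
    rw [← h1, D.mate_mate, h1]

end Diagram

/-! ### Capping off a diagram without top points -/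

section

variable {N M : ℕ} (h : N = M + 2) (i : ℕ) (hi : i ≤ M) (D : Diagram 0 N)

/-- The compatible colourings after capping off: a closed loop arises if both colours of the cap are
possible. -/
theorem pow_loops_mul_colMat (e : Fin 0 → Bool) (u : Fin M → Bool) :
    2 ^ loops (capAt h i hi) D * colMat ((capAt h i hi).comp D) e u =
      colMat D e (insertPair h i hi u true) + colMat D e (insertPair h i hi u false) := by
  have h1 := congrFun (congrFun (colMat_mul (capAt h i hi) D) e) u
  rw [Matrix.mul_apply, Matrix.smul_apply, smul_eq_mul] at h1
  rw [← h1, ← Fintype.sum_bool fun c => colMat D e (insertPair h i hi u c), ← sum_colMat_capAt]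
  exact Finset.sum_congr rfl fun s _ => mul_comm _ _

theorem exists_compat_of_compat_comp {e : Fin 0 → Bool} {u : Fin M → Bool}
    (H : Compat ((capAt h i hi).comp D) e u) : ∃ c, Compat D e (insertPair h i hi u c) := by
  by_contra hc
  push Not at hc
  have h1 := pow_loops_mul_colMat h i hi D e u
  rw [colMat_eq_one H, colMat_eq_zero (hc _), colMat_eq_zero (hc _)] at h1
  simp at h1

/-- The embedding of the bottom points after capping off at `i` into those before. -/
def skipFin (q : Fin M) : Fin N := ⟨skip i q, skip_lt h q.2⟩

theorem skipFin_lt_iff (p q : Fin M) : skipFin h i p < skipFin h i q ↔ p < q := by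
  simp only [skipFin, Fin.lt_def, skip]
  split_ifs <;> omega

theorem skipFin_injective : Function.Injective (skipFin h i) := by
  intro p q hpq
  simp only [skipFin, Fin.ext_iff, skip] at hpq
  ext
  split_ifs at hpq <;> omega

theorem skipFin_ne_left (q : Fin M) : skipFin h i q ≠ ⟨i, by omega⟩ := by
  have := hi
  simp only [skipFin, ne_eq, Fin.ext_iff, skip]
  split_ifs <;> omega

theorem skipFin_ne_right (q : Fin M) : skipFin h i q ≠ ⟨i + 1, by omega⟩ := by
  have := hi
  simp only [skipFin, ne_eq, Fin.ext_iff, skip]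
  split_ifs <;> omega

theorem insertPair_skipFin (u : Fin M → Bool) (c : Bool) (q : Fin M) :
    insertPair h i hi u c (skipFin h i q) = u q := insertPair_skip h i hi u c q

theorem mate_capAt_comp_of_eq {p q : Fin M} (hpq : D.mate (skipFin h i p) = skipFin h i q) :
    ((capAt h i hi).comp D).mate p = q := by
  apply Diagram.mate_eq_of_forall_compat
  · rintro rfl
    exact D.mate_ne _ hpq
  · intro e u H
    obtain ⟨c, hc⟩ := exists_compat_of_compat_comp h i hi D H
    have h1 := Diagram.compat_mate hc (skipFin h i p)
    rw [hpq, insertPair_skipFin, insertPair_skipFin] at h1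
    exact h1.symm

theorem mate_capAt_comp_of_left {p q : Fin M} (hp : D.mate ⟨i, by omega⟩ = skipFin h i p)
    (hq : D.mate ⟨i + 1, by omega⟩ = skipFin h i q) : ((capAt h i hi).comp D).mate p = q := by
  apply Diagram.mate_eq_of_forall_compat
  · rintro rfl
    have := D.mate_injective (hp.trans hq.symm)
    simp at this
  · intro e u H
    obtain ⟨c, hc⟩ := exists_compat_of_compat_comp h i hi D H
    have h1 := Diagram.compat_mate hc ⟨i, by omega⟩
    have h2 := Diagram.compat_mate hc ⟨i + 1, by omega⟩
    rw [hp, insertPair_skipFin, insertPair_left] at h1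
    rw [hq, insertPair_skipFin, insertPair_right] at h2
    rw [h1, h2]

theorem insertPair_true :
    insertPair h i hi (fun _ => true) true = fun _ => true := by
  funext p
  simp [insertPair]

theorem mate_skipFin_of_adjacent (had : D.mate ⟨i, by omega⟩ = ⟨i + 1, by omega⟩) (q : Fin M) :
    ∃ q', D.mate (skipFin h i q) = skipFin h i q' := by
  have had' : D.mate ⟨i + 1, by omega⟩ = ⟨i, by omega⟩ := by rw [← had, D.mate_mate]
  rcases eq_or_skip h i hi (D.mate (skipFin h i q)) with h3 | h3 | ⟨q', h3⟩
  · have := D.mate_mate (skipFin h i q)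
    rw [h3, had] at this
    exact absurd this.symm (skipFin_ne_right h i hi q)
  · have := D.mate_mate (skipFin h i q)
    rw [h3, had'] at this
    exact absurd this.symm (skipFin_ne_left h i hi q)
  · exact ⟨q', h3⟩

theorem loops_capAt_of_adjacent (had : D.mate ⟨i, by omega⟩ = ⟨i + 1, by omega⟩) :
    loops (capAt h i hi) D = 1 := by
  have had' : D.mate ⟨i + 1, by omega⟩ = ⟨i, by omega⟩ := by rw [← had, D.mate_mate]
  have h1 := pow_loops_mul_colMat h i hi D (fun _ => true) (fun _ => true)
  have h2 : Compat D (fun _ => true) (insertPair h i hi (fun _ => true) false) := by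
    apply Diagram.compat_of_mate
    intro p
    rcases eq_or_skip h i hi p with rfl | rfl | ⟨q, rfl⟩
    · rw [had, insertPair_left, insertPair_right]
    · rw [had', insertPair_left, insertPair_right]
    · obtain ⟨q', h3⟩ := mate_skipFin_of_adjacent h i hi D had q
      change insertPair h i hi _ false (D.mate (skipFin h i q)) =
        insertPair h i hi _ false (skipFin h i q)
      rw [h3, insertPair_skipFin, insertPair_skipFin]
  rw [insertPair_true, colMat_const, colMat_const, mul_one, colMat_eq_one h2] at h1
  exact Nat.pow_right_injective le_rfl (h1.trans (pow_one 2).symm)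

theorem exists_skipFin_of_not_adjacent (had : D.mate ⟨i, by omega⟩ ≠ ⟨i + 1, by omega⟩) :
    ∃ u v, D.mate ⟨i, by omega⟩ = skipFin h i u ∧ D.mate ⟨i + 1, by omega⟩ = skipFin h i v := by
  rcases eq_or_skip h i hi (D.mate ⟨i, by omega⟩) with h3 | h3 | ⟨u, hu⟩
  · exact absurd h3 (D.mate_ne _)
  · exact absurd h3 had
  rcases eq_or_skip h i hi (D.mate ⟨i + 1, by omega⟩) with h3 | h3 | ⟨v, hv⟩
  · rw [← h3, D.mate_mate] at had
    exact absurd rfl had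
  · exact absurd h3 (D.mate_ne _)
  exact ⟨u, v, hu, hv⟩

theorem loops_capAt_of_not_adjacent (had : D.mate ⟨i, by omega⟩ ≠ ⟨i + 1, by omega⟩) :
    loops (capAt h i hi) D = 0 := by
  obtain ⟨u, v, hu, hv⟩ := exists_skipFin_of_not_adjacent h i hi D had
  have h1 := pow_loops_mul_colMat h i hi D (fun _ => true) (fun _ => true)
  have h2 : ¬ Compat D (fun _ => true) (insertPair h i hi (fun _ => true) false) := by
    intro hc
    have := Diagram.compat_mate hc ⟨i, by omega⟩
    rw [hu, insertPair_skipFin, insertPair_left] at this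
    simp at this
  rw [insertPair_true, colMat_const, colMat_const, mul_one, colMat_eq_zero h2] at h1
  exact Nat.pow_right_injective le_rfl (h1.trans (pow_zero 2).symm)

end

/-! ### The spin model -/

section

variable {K : Type*} [Field K] (τ : K)

/-- The weight of a cup whose left and right ends carry the spins `x` and `y`. -/
def cupWeight (x y : Bool) : K := if x = y then 0 else if x then τ else 1

/-- The coefficient at the word `w` of the tensor that a diagram without top points represents in
the spin representation of the category with loop parameter `τ + τ⁻¹`. -/
noncomputable def spinWeight {N : ℕ} (D : Diagram 0 N) (w : ℕ → Bool) : K :=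
  ∏ p : Fin N, if p < D.mate p then cupWeight τ (w p) (w (D.mate p)) else 1

/-- The word `w` with the letters at `i` and `i + 1` replaced by `x` and `y`. -/
def setPair (w : ℕ → Bool) (i : ℕ) (x y : Bool) : ℕ → Bool :=
  fun p => if p = i then x else if p = i + 1 then y else w p

variable {N M : ℕ} (h : N = M + 2) (i : ℕ) (hi : i ≤ M)

theorem prod_skipFin (f : Fin N → K) :
    ∏ p, f p = f ⟨i, by omega⟩ * f ⟨i + 1, by omega⟩ * ∏ q, f (skipFin h i q) := by
  classical
  have h1 : (Finset.univ : Finset (Fin N)) = insert ⟨i, by omega⟩ (insert ⟨i + 1, by omega⟩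
      (Finset.univ.map ⟨skipFin h i, skipFin_injective h i⟩)) := by
    ext p
    simp only [Finset.mem_univ, Finset.mem_insert, Finset.mem_map, Function.Embedding.coeFn_mk,
      true_and, true_iff]
    rcases eq_or_skip h i hi p with h1 | h1 | ⟨q, h1⟩
    · exact Or.inl h1
    · exact Or.inr (Or.inl h1)
    · exact Or.inr (Or.inr ⟨q, h1.symm⟩)
  rw [h1, Finset.prod_insert, Finset.prod_insert, Finset.prod_map, mul_assoc]
  · rfl
  · simp [skipFin_ne_right h i hi]
  · simp [skipFin_ne_left h i hi]

theorem setPair_skipFin (w : ℕ → Bool) (x y : Bool) (q : Fin M) :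
    setPair w i x y (skipFin h i q) = (w ∘ skip i) q := by
  have h1 : skip i q ≠ i := by unfold skip; split_ifs <;> omega
  have h2 : skip i q ≠ i + 1 := by unfold skip; split_ifs <;> omega
  simp only [setPair, skipFin, h1, h2, if_false]
  rfl

/-- Exactly one of the two ends of a strand contributes the weight of the strand. -/
theorem factor_mul_factor_mate (D : Diagram 0 N) (w : ℕ → Bool) (p : Fin N) :
    (if p < D.mate p then cupWeight τ (w p) (w (D.mate p)) else 1) *
      (if D.mate p < D.mate (D.mate p) then
        cupWeight τ (w (D.mate p)) (w (D.mate (D.mate p))) else 1) =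
      if p < D.mate p then cupWeight τ (w p) (w (D.mate p))
        else cupWeight τ (w (D.mate p)) (w p) := by
  rw [D.mate_mate]
  rcases lt_or_gt_of_ne (D.mate_ne p) with h1 | h1
  · rw [if_neg h1.not_gt, if_pos h1, if_neg h1.not_gt, one_mul]
  · rw [if_neg h1.not_gt, if_pos h1, if_pos h1, mul_one]

/-- The local computation for the contraction of two strands with a cap, in the three possible
relative positions of the strands. -/
theorem cupWeight_contract (hτ : τ ≠ 0) (a b : Bool) (c1 c2 c3 : Prop) [Decidable c1] [Decidable c2]
    [Decidable c3] (h : (¬ c1 ∧ ¬ c2 ∧ ¬ c3) ∨ (¬ c1 ∧ c2 ∧ c3) ∨ (c1 ∧ c2 ∧ ¬ c3)) :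
    (if c3 then cupWeight τ a b else cupWeight τ b a) =
      τ⁻¹ * ((if c1 then cupWeight τ false a else cupWeight τ a false) *
        (if c2 then cupWeight τ true b else cupWeight τ b true)) +
      (if c1 then cupWeight τ true a else cupWeight τ a true) *
        (if c2 then cupWeight τ false b else cupWeight τ b false) := by
  rcases h with ⟨h1, h2, h3⟩ | ⟨h1, h2, h3⟩ | ⟨h1, h2, h3⟩ <;>
    simp only [h1, h2, h3, if_true, if_false] <;> cases a <;> cases b <;> simp [cupWeight, hτ]

theorem setPair_left (w : ℕ → Bool) (i : ℕ) (x y : Bool) : setPair w i x y i = x := if_pos rfl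

theorem setPair_right (w : ℕ → Bool) (i : ℕ) (x y : Bool) : setPair w i x y (i + 1) = y := by
  simp [setPair]

/-- Strands away from a cap contribute the same factor before and after capping off. -/
theorem factor_skipFin (D : Diagram 0 N) (w : ℕ → Bool) (x y : Bool) (q q' : Fin M)
    (hq : D.mate (skipFin h i q) = skipFin h i q') :
    (if skipFin h i q < D.mate (skipFin h i q) then cupWeight τ
      (setPair w i x y (skipFin h i q)) (setPair w i x y (D.mate (skipFin h i q))) else 1) =
    if q < ((capAt h i hi).comp D).mate q then cupWeight τ ((w ∘ skip i) q)
      ((w ∘ skip i) (((capAt h i hi).comp D).mate q)) else 1 := by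
  simp only [mate_capAt_comp_of_eq h i hi D hq, hq, skipFin_lt_iff, setPair_skipFin h i]

/-- A strand between neighbours contributes a factor and can be removed. -/
theorem spinWeight_setPair_of_adjacent (D : Diagram 0 N)
    (had : D.mate ⟨i, by omega⟩ = ⟨i + 1, by omega⟩) (w : ℕ → Bool) (x y : Bool) :
    spinWeight τ D (setPair w i x y) =
      cupWeight τ x y * spinWeight τ ((capAt h i hi).comp D) (w ∘ skip i) := by
  have had' : D.mate ⟨i + 1, by omega⟩ = ⟨i, by omega⟩ := by rw [← had, D.mate_mate]
  rw [spinWeight, prod_skipFin h i hi, had, had']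
  rw [if_pos (by rw [Fin.lt_def]; simp), if_neg (by rw [Fin.lt_def]; simp), mul_one]
  simp only [setPair_left, setPair_right]
  congr 1
  refine Finset.prod_congr rfl fun q _ => ?_
  obtain ⟨q', hq⟩ := mate_skipFin_of_adjacent h i hi D had q
  exact factor_skipFin τ h i hi D w x y q q' hq

/-- Capping off two neighbouring points corresponds to contracting the tensor with the cap whose
weights are `1` and `τ⁻¹`. -/
theorem spinWeight_capAt_comp (hτ : τ ≠ 0) (D : Diagram 0 N) (w : ℕ → Bool) :
    (τ + τ⁻¹) ^ loops (capAt h i hi) D * spinWeight τ ((capAt h i hi).comp D) (w ∘ skip i) =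
      τ⁻¹ * spinWeight τ D (setPair w i false true) +
        spinWeight τ D (setPair w i true false) := by
  by_cases had : D.mate ⟨i, by omega⟩ = ⟨i + 1, by omega⟩
  · rw [loops_capAt_of_adjacent h i hi D had, pow_one,
      spinWeight_setPair_of_adjacent τ h i hi D had, spinWeight_setPair_of_adjacent τ h i hi D had]
    simp [cupWeight]
    ring
  · obtain ⟨u, v, hu, hv⟩ := exists_skipFin_of_not_adjacent h i hi D had
    rw [loops_capAt_of_not_adjacent h i hi D had, pow_zero, one_mul]
    have huv : v ≠ u := by
      rintro rfl
      have := D.mate_injective (hu.trans hv.symm)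
      simp at this
    have hEu := mate_capAt_comp_of_left h i hi D hu hv
    have split : ∀ f : Fin M → K,
        ∏ q, f q = f u * f v * ∏ q ∈ (Finset.univ.erase u).erase v, f q := by
      intro f
      rw [mul_assoc, Finset.mul_prod_erase _ _ (by simp [huv]), Finset.mul_prod_erase _ _ (by simp)]
    set R := ∏ q ∈ (Finset.univ.erase u).erase v, if q < ((capAt h i hi).comp D).mate q then
      cupWeight τ ((w ∘ skip i) q) ((w ∘ skip i) (((capAt h i hi).comp D).mate q)) else 1 with hR
    have hE : spinWeight τ ((capAt h i hi).comp D) (w ∘ skip i) =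
        (if u < v then cupWeight τ ((w ∘ skip i) u) ((w ∘ skip i) v) else
          cupWeight τ ((w ∘ skip i) v) ((w ∘ skip i) u)) * R := by
      have h1 := factor_mul_factor_mate τ ((capAt h i hi).comp D) (w ∘ skip i) u
      rw [hEu] at h1
      rw [spinWeight, split, hEu, h1]
    have hD : ∀ x y, spinWeight τ D (setPair w i x y) =
        ((if (⟨i, by omega⟩ : Fin N) < skipFin h i u then cupWeight τ x ((w ∘ skip i) u) else
          cupWeight τ ((w ∘ skip i) u) x) *
        (if (⟨i + 1, by omega⟩ : Fin N) < skipFin h i v then cupWeight τ y ((w ∘ skip i) v) else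
          cupWeight τ ((w ∘ skip i) v) y)) * R := by
      intro x y
      have h1 := factor_mul_factor_mate τ D (setPair w i x y) ⟨i, by omega⟩
      have h2 := factor_mul_factor_mate τ D (setPair w i x y) ⟨i + 1, by omega⟩
      simp only [hu, setPair_left, setPair_skipFin h i] at h1
      simp only [hv, setPair_right, setPair_skipFin h i] at h2
      rw [spinWeight, prod_skipFin h i hi, split]
      simp only [hu, hv, setPair_left, setPair_right, setPair_skipFin h i]
      rw [← h1, ← h2, hR]
      rw [Finset.prod_congr rfl (g := fun q => if q < ((capAt h i hi).comp D).mate q then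
        cupWeight τ ((w ∘ skip i) q) ((w ∘ skip i) (((capAt h i hi).comp D).mate q)) else 1)]
      · ring
      · intro q hq
        rw [Finset.mem_erase, Finset.mem_erase] at hq
        rcases eq_or_skip h i hi (D.mate (skipFin h i q)) with h3 | h3 | ⟨q', h3⟩
        · rw [← h3, D.mate_mate] at hu
          exact absurd (skipFin_injective h i hu) hq.2.1
        · rw [← h3, D.mate_mate] at hv
          exact absurd (skipFin_injective h i hv) hq.1
        · have h4 := factor_skipFin τ h i hi D w x y q q' h3
          rwa [setPair_skipFin h i] at h4
    rw [hE, hD, hD]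
    have hu' : D.mate (skipFin h i u) = ⟨i, by omega⟩ := by rw [← hu, D.mate_mate]
    have hv' : D.mate (skipFin h i v) = ⟨i + 1, by omega⟩ := by rw [← hv, D.mate_mate]
    have nu := skipFin_ne_left h i hi u
    have nu' := skipFin_ne_right h i hi u
    have nv := skipFin_ne_left h i hi v
    have nv' := skipFin_ne_right h i hi v
    have cross : ∀ p q : Fin N, p < q → q < D.mate p → ¬ D.mate p < D.mate q :=
      fun p q h1 h2 h3 => D.mate_noncrossing h1 h2 h3
    have x1 := cross (skipFin h i v) ⟨i, by omega⟩
    have x2 := cross (skipFin h i u) (skipFin h i v)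
    have x3 := cross ⟨i, by omega⟩ ⟨i + 1, by omega⟩
    have x4 := cross ⟨i, by omega⟩ (skipFin h i v)
    rw [cupWeight_contract τ hτ ((w ∘ skip i) u) ((w ∘ skip i) v)
      ((⟨i, by omega⟩ : Fin N) < skipFin h i u) ((⟨i + 1, by omega⟩ : Fin N) < skipFin h i v)
      (u < v)]
    · ring
    · rw [← skipFin_lt_iff h i u v]
      have nuv : skipFin h i v ≠ skipFin h i u := fun h5 => huv (skipFin_injective h i h5)
      rw [hu', hv', hu, hv] at *
      simp only [Fin.lt_def, ne_eq, Fin.ext_iff] at *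
      omega

end

/-! ### Spin coefficients of linear combinations -/

/-- The word with letter `true` exactly at the positions in `S`. -/
def letters (S : Finset ℕ) : ℕ → Bool := fun p => decide (p ∈ S)

section

variable {K : Type*} [Field K] (τ : K)

/-- The tensor that a morphism without top points represents in the spin representation. -/
noncomputable def spin {N : ℕ} : Hom K 0 N →ₗ[K] ((ℕ → Bool) → K) :=
  Finsupp.linearCombination K fun D => spinWeight τ D

theorem spin_apply {N : ℕ} (x : Hom K 0 N) (w : ℕ → Bool) :
    spin τ x w = x.sum fun D r => r * spinWeight τ D w := by
  simp [spin, Finsupp.linearCombination_apply, Finsupp.sum, Finset.sum_apply]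

/-- The morphism given by a cap at the points `i` and `i + 1`. -/
noncomputable def capHom (d : K) {N M : ℕ} (h : N = M + 2) (i : ℕ) (hi : i ≤ M) : Hom K N M :=
  (LoopDiagram.of (capAt h i hi)).toHom d

/-- The contraction formula for caps, extended to linear combinations. -/
theorem spin_capHom_comp (hτ : τ ≠ 0) {N M : ℕ} (h : N = M + 2) (i : ℕ) (hi : i ≤ M)
    (x : Hom K 0 N) (w : ℕ → Bool) :
    spin τ (comp (τ + τ⁻¹) (capHom (τ + τ⁻¹) h i hi) x) (w ∘ skip i) =
      τ⁻¹ * spin τ x (setPair w i false true) + spin τ x (setPair w i true false) := by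
  induction x using hom_induction (τ + τ⁻¹) with
  | h0 => simp
  | hadd x y hx hy =>
    simp only [map_add, Pi.add_apply, hx, hy]
    ring
  | hsmul r x hx =>
    simp only [map_smul, Pi.smul_apply, smul_eq_mul, hx]
    ring
  | h D =>
    rw [capHom, ← LoopDiagram.toHom_comp]
    have h1 := spinWeight_capAt_comp τ h i hi hτ D w
    simp only [LoopDiagram.toHom, LoopDiagram.comp, LoopDiagram.of, spin,
      Finsupp.linearCombination_single, Pi.smul_apply, smul_eq_mul, zero_add, pow_zero, one_mul]
    exact h1

theorem letters_eq_setPair (S : Finset ℕ) (i : ℕ) (h1 : i ∈ S) (h2 : i + 1 ∉ S) :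
    letters S = setPair (letters S) i true false := by
  funext p
  simp only [letters, setPair]
  split_ifs with h3 h4
  · simp [h3, h1]
  · simp [h4, h2]
  · rfl

theorem letters_move_eq_setPair (S : Finset ℕ) (i : ℕ) :
    letters (insert (i + 1) (S.erase i)) = setPair (letters S) i false true := by
  funext p
  simp only [letters, setPair]
  split_ifs with h3 h4
  · simp [h3]
  · simp [h4]
  · simp [h3, h4]

theorem sum_move {S : Finset ℕ} {i : ℕ} (h1 : i ∈ S) (h2 : i + 1 ∉ S) :
    ∑ p ∈ insert (i + 1) (S.erase i), p = ∑ p ∈ S, p + 1 := by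
  rw [Finset.sum_insert (fun h => h2 (Finset.mem_of_mem_erase h)),
    ← Finset.add_sum_erase S (fun p => p) h1]
  ring

theorem card_move {S : Finset ℕ} {i : ℕ} (h1 : i ∈ S) (h2 : i + 1 ∉ S) :
    (insert (i + 1) (S.erase i)).card = S.card := by
  rw [Finset.card_insert_of_notMem (fun h => h2 (Finset.mem_of_mem_erase h)),
    Finset.card_erase_add_one h1]

/-- A morphism killed by the cap at `i`, `i + 1` is `q`-symmetric at these positions: its
coefficient at `S`, divided by `(-τ) ^ ∑ S`, does not change when an element of `S` moves from `i`
to `i + 1`. -/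
theorem spin_move (hτ : τ ≠ 0) {N M : ℕ} (h : N = M + 2) (i : ℕ) (hi : i ≤ M) (x : Hom K 0 N)
    (hx : comp (τ + τ⁻¹) (capHom (τ + τ⁻¹) h i hi) x = 0) {S : Finset ℕ} (h1 : i ∈ S)
    (h2 : i + 1 ∉ S) :
    spin τ x (letters S) / (-τ) ^ (∑ p ∈ S, p) =
      spin τ x (letters (insert (i + 1) (S.erase i))) /
        (-τ) ^ (∑ p ∈ insert (i + 1) (S.erase i), p) := by
  have h3 := spin_capHom_comp τ hτ h i hi x (letters S)
  rw [hx, ← letters_eq_setPair S i h1 h2, ← letters_move_eq_setPair S i, map_zero,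
    Pi.zero_apply] at h3
  have h4 : spin τ x (letters S) = -(τ⁻¹ * spin τ x (letters (insert (i + 1) (S.erase i)))) := by
    linear_combination -h3
  rw [sum_move h1 h2, h4, pow_succ]
  have : (-τ) ^ (∑ p ∈ S, p) ≠ 0 := pow_ne_zero _ (neg_ne_zero.mpr hτ)
  field_simp

/-- A function of finite sets that is invariant under moving an element by one step inside of an
interval only depends on the number of elements in the interval. -/
theorem eq_of_move_invariant {α : Type*} (G : Finset ℕ → α) (a b : ℕ)
    (hG : ∀ S i, a ≤ i → i + 1 < b → i ∈ S → i + 1 ∉ S → G S = G (insert (i + 1) (S.erase i)))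
    (R : Finset ℕ) (hR : Disjoint R (Finset.Ico a b)) (A : Finset ℕ) (hA : A ⊆ Finset.Ico a b) :
    G (A ∪ R) = G (Finset.Ico a (a + A.card) ∪ R) := by
  induction hn : ∑ p ∈ A, p using Nat.strong_induction_on generalizing A with
  | _ n ih =>
  by_cases hdown : ∀ i, a ≤ i → i + 1 ∈ A → i ∈ A
  · -- an initial segment of the interval
    have hdown' : ∀ j r, a ≤ j → j + r ∈ A → j ∈ A := by
      intro j r
      induction r with
      | zero => exact fun _ h => h
      | succ r ihr => exact fun h1 h2 => ihr h1 (hdown _ (by omega) h2)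
    have hsub : A ⊆ Finset.Ico a (a + A.card) := by
      intro j hj
      have hja := (Finset.mem_Ico.mp (hA hj)).1
      have h1 : Finset.Ico a (j + 1) ⊆ A := by
        intro p hp
        rw [Finset.mem_Ico] at hp
        exact hdown' p (j - p) hp.1 (by rwa [Nat.add_sub_cancel' (by omega)])
      have h2 := Finset.card_le_card h1
      rw [Nat.card_Ico] at h2
      rw [Finset.mem_Ico]
      omega
    have h3 := Finset.eq_of_subset_of_card_le hsub (by rw [Nat.card_Ico]; omega)
    rw [← h3]
  · push Not at hdown
    obtain ⟨i, hai, hi1, hi⟩ := hdown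
    have hib := (Finset.mem_Ico.mp (hA hi1)).2
    set B := insert i (A.erase (i + 1)) with hB
    have hB1 : i ∈ B := Finset.mem_insert_self _ _
    have hB2 : i + 1 ∉ B := by simp [hB]
    have hBA : insert (i + 1) (B.erase i) = A := by
      rw [hB, Finset.erase_insert (fun h => hi (Finset.mem_of_mem_erase h)),
        Finset.insert_erase hi1]
    have hiR : i ∉ R := fun h => Finset.disjoint_left.mp hR h (Finset.mem_Ico.mpr ⟨hai, by omega⟩)
    have hiR' : i + 1 ∉ R :=
      fun h => Finset.disjoint_left.mp hR h (Finset.mem_Ico.mpr ⟨by omega, by omega⟩)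
    have h1 := hG (B ∪ R) i hai hib (Finset.mem_union_left _ hB1) (by simp [hB2, hiR'])
    have h2 : insert (i + 1) ((B ∪ R).erase i) = A ∪ R := by
      rw [Finset.erase_union_distrib, Finset.erase_eq_of_notMem hiR, ← Finset.insert_union, hBA]
    have hsum := sum_move hB1 hB2
    have hcard := card_move hB1 hB2
    rw [hBA] at hsum hcard
    have hBsub : B ⊆ Finset.Ico a b := by
      rw [hB]
      refine Finset.insert_subset (Finset.mem_Ico.mpr ⟨hai, by omega⟩) ?_
      exact (Finset.erase_subset _ _).trans hA
    rw [h2] at h1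
    rw [← h1, ih _ (by omega) B hBsub rfl, hcard]

/-- A diagram with a strand between neighbours in a window is killed by the symmetriser on the
window. -/
theorem sum_spinWeight_window {N : ℕ} (D : Diagram 0 N) (a b i : ℕ) (hi : i + 1 < N) (hai : a ≤ i)
    (hib : i + 1 < b) (had : D.mate ⟨i, by omega⟩ = ⟨i + 1, hi⟩) (r : ℕ) (R : Finset ℕ)
    (hR : Disjoint R (Finset.Ico a b)) :
    ∑ A ∈ (Finset.Ico a b).powersetCard r, (-τ) ^ (∑ p ∈ A, p) * spinWeight τ D (letters (A ∪ R)) =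
      0 := by
  obtain ⟨M, rfl⟩ : ∃ M, N = M + 2 := ⟨N - 2, by omega⟩
  have key := spinWeight_setPair_of_adjacent τ rfl i (by omega) D had
  have hiR : i ∉ R := fun h => Finset.disjoint_left.mp hR h (Finset.mem_Ico.mpr ⟨hai, by omega⟩)
  have hiR' : i + 1 ∉ R :=
    fun h => Finset.disjoint_left.mp hR h (Finset.mem_Ico.mpr ⟨by omega, by omega⟩)
  -- moving an element from `i` to `i + 1` changes the sign
  have move : ∀ A : Finset ℕ, i ∈ A → i + 1 ∉ A →
      (-τ) ^ (∑ p ∈ A, p) * spinWeight τ D (letters (A ∪ R)) +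
      (-τ) ^ (∑ p ∈ insert (i + 1) (A.erase i), p) *
        spinWeight τ D (letters (insert (i + 1) (A.erase i) ∪ R)) = 0 := by
    intro A h1 h2
    have e : insert (i + 1) (A.erase i) ∪ R = insert (i + 1) ((A ∪ R).erase i) := by
      rw [Finset.erase_union_distrib, Finset.erase_eq_of_notMem hiR, ← Finset.insert_union]
    rw [e, letters_move_eq_setPair, letters_eq_setPair (A ∪ R) i (Finset.mem_union_left _ h1)
      (by simp [h2, hiR']), key, sum_move h1 h2]
    have e2 : setPair (setPair (letters (A ∪ R)) i true false) i false true =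
        setPair (letters (A ∪ R)) i false true := by
      funext p
      simp only [setPair]
      split_ifs <;> rfl
    rw [e2, key, pow_succ]
    simp only [cupWeight]
    simp
    ring
  have same : ∀ A : Finset ℕ, (i ∈ A ↔ i + 1 ∈ A) → spinWeight τ D (letters (A ∪ R)) = 0 := by
    intro A hA
    have e : letters (A ∪ R) =
        setPair (letters (A ∪ R)) i (letters (A ∪ R) i) (letters (A ∪ R) (i + 1)) := by
      funext p
      simp only [setPair]
      split_ifs with h3 h4
      · rw [h3]
      · rw [h4]
      · rfl
    rw [e, key]
    have : letters (A ∪ R) i = letters (A ∪ R) (i + 1) := by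
      simp [letters, hiR, hiR', hA]
    simp [cupWeight, this]
  have back : ∀ A : Finset ℕ, i ∉ A → i + 1 ∈ A →
      insert (i + 1) ((insert i (A.erase (i + 1))).erase i) = A := by
    intro A h1 h2
    rw [Finset.erase_insert (fun h => h1 (Finset.mem_of_mem_erase h)), Finset.insert_erase h2]
  have forth : ∀ A : Finset ℕ, i ∈ A → i + 1 ∉ A →
      insert i ((insert (i + 1) (A.erase i)).erase (i + 1)) = A := by
    intro A h1 h2
    rw [Finset.erase_insert (fun h => h2 (Finset.mem_of_mem_erase h)), Finset.insert_erase h1]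
  -- the sets with one of `i`, `i + 1` cancel in pairs, the other ones contribute zero
  let g : Finset ℕ → Finset ℕ := fun A =>
    if i ∈ A then (if i + 1 ∈ A then A else insert (i + 1) (A.erase i))
    else (if i + 1 ∈ A then insert i (A.erase (i + 1)) else A)
  have gpp : ∀ A, i ∈ A → i + 1 ∈ A → g A = A := fun A h1 h2 => by simp [g, h1, h2]
  have gpn : ∀ A, i ∈ A → i + 1 ∉ A → g A = insert (i + 1) (A.erase i) :=
    fun A h1 h2 => by simp [g, h1, h2]
  have gnp : ∀ A, i ∉ A → i + 1 ∈ A → g A = insert i (A.erase (i + 1)) :=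
    fun A h1 h2 => by simp [g, h1, h2]
  have gnn : ∀ A, i ∉ A → i + 1 ∉ A → g A = A := fun A h1 h2 => by simp [g, h1, h2]
  refine Finset.sum_involution (fun A _ => g A) ?_ ?_ ?_ ?_
  · intro A _
    by_cases h1 : i ∈ A <;> by_cases h2 : i + 1 ∈ A
    · rw [gpp A h1 h2, same A (iff_of_true h1 h2)]; simp
    · rw [gpn A h1 h2]; exact move A h1 h2
    · have h3 := move (insert i (A.erase (i + 1))) (Finset.mem_insert_self _ _) (by simp)
      rw [back A h1 h2] at h3
      rw [gnp A h1 h2, add_comm]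
      exact h3
    · rw [gnn A h1 h2, same A (iff_of_false h1 h2)]; simp
  · intro A _ hne
    by_cases h1 : i ∈ A <;> by_cases h2 : i + 1 ∈ A
    · rw [same A (iff_of_true h1 h2), mul_zero] at hne; exact absurd rfl hne
    · rw [gpn A h1 h2]; exact fun h => h2 (h ▸ Finset.mem_insert_self _ _)
    · rw [gnp A h1 h2]; exact fun h => h1 (h ▸ Finset.mem_insert_self _ _)
    · rw [same A (iff_of_false h1 h2), mul_zero] at hne; exact absurd rfl hne
  · intro A hA
    rw [Finset.mem_powersetCard] at hA ⊢
    have m1 : i ∈ Finset.Ico a b := Finset.mem_Ico.mpr ⟨hai, by omega⟩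
    have m2 : i + 1 ∈ Finset.Ico a b := Finset.mem_Ico.mpr ⟨by omega, by omega⟩
    by_cases h1 : i ∈ A <;> by_cases h2 : i + 1 ∈ A
    · rwa [gpp A h1 h2]
    · rw [gpn A h1 h2, card_move h1 h2]
      exact ⟨Finset.insert_subset m2 ((Finset.erase_subset _ _).trans hA.1), hA.2⟩
    · have h3 := card_move (S := insert i (A.erase (i + 1))) (Finset.mem_insert_self _ _) (by simp)
      rw [back A h1 h2] at h3
      rw [gnp A h1 h2, ← h3]
      exact ⟨Finset.insert_subset m1 ((Finset.erase_subset _ _).trans hA.1), hA.2⟩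
    · rwa [gnn A h1 h2]
  · intro A _
    by_cases h1 : i ∈ A <;> by_cases h2 : i + 1 ∈ A
    · rw [gpp A h1 h2, gpp A h1 h2]
    · rw [gpn A h1 h2, gnp _ (by simp) (Finset.mem_insert_self _ _), forth A h1 h2]
    · rw [gnp A h1 h2, gpn _ (Finset.mem_insert_self _ _) (by simp), back A h1 h2]
    · rw [gnn A h1 h2, gnn A h1 h2]

/-- Every morphism without top points is killed by the symmetriser on a window that covers more than
half of the points. -/
theorem sum_spin_window {N : ℕ} (x : Hom K 0 N) (a b : ℕ) (hb : b ≤ N) (hab : N < 2 * (b - a))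
    (r : ℕ) (R : Finset ℕ) (hR : Disjoint R (Finset.Ico a b)) :
    ∑ A ∈ (Finset.Ico a b).powersetCard r,
      (-τ) ^ (∑ p ∈ A, p) * spin τ x (letters (A ∪ R)) = 0 := by
  simp only [spin_apply, Finsupp.sum, Finset.mul_sum]
  rw [Finset.sum_comm]
  refine Finset.sum_eq_zero fun D _ => ?_
  obtain ⟨i, hi, h1, h2, h3⟩ := D.exists_adjacent_window a b hb hab
  have := sum_spinWeight_window τ D a b i hi h1 h2 h3 r R hR
  rw [← mul_zero (x D), ← this, Finset.mul_sum]
  refine Finset.sum_congr rfl fun A _ => ?_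
  ring

end

/-! ### Faithfulness of the spin model -/

section

variable {K : Type*} [Field K] (τ : K)

/-- The weight of a diagram is non-zero at the words in which the two ends of each strand differ. -/
theorem spinWeight_ne_zero_iff (hτ : τ ≠ 0) {N : ℕ} (D : Diagram 0 N) (w : ℕ → Bool) :
    spinWeight τ D w ≠ 0 ↔ ∀ p : Fin N, w (D.mate p) ≠ w p := by
  unfold spinWeight
  rw [Finset.prod_ne_zero_iff]
  constructor
  · intro h p
    rcases lt_or_gt_of_ne (D.mate_ne p) with h1 | h1
    · have := h (D.mate p) (Finset.mem_univ _)
      rw [D.mate_mate, if_pos h1] at this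
      intro h2
      simp [cupWeight, h2] at this
    · have := h p (Finset.mem_univ _)
      rw [if_pos h1] at this
      intro h2
      simp [cupWeight, h2] at this
  · intro h p _
    have := h p
    split_ifs
    · cases h1 : w p <;> cases h2 : w (D.mate p) <;> simp_all [cupWeight]
    · exact one_ne_zero

/-- The left end points of the strands of a diagram without top points. -/
def openers {N : ℕ} (D : Diagram 0 N) : Finset ℕ :=
  (Finset.univ.filter fun p => p < D.mate p).map Fin.valEmbedding

theorem mem_openers {N : ℕ} (D : Diagram 0 N) (p : Fin N) : (p : ℕ) ∈ openers D ↔ p < D.mate p := by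
  simp only [openers, Finset.mem_map, Finset.mem_filter, Finset.mem_univ, true_and,
    Fin.valEmbedding_apply]
  constructor
  · rintro ⟨q, h1, h2⟩
    rwa [← Fin.ext h2]
  · exact fun h => ⟨p, h, rfl⟩

theorem openers_subset {N : ℕ} (D : Diagram 0 N) : openers D ⊆ Finset.range N := by
  intro p hp
  simp only [openers, Finset.mem_map] at hp
  obtain ⟨q, _, rfl⟩ := hp
  exact Finset.mem_range.mpr q.2

theorem alternates_openers {N : ℕ} (D : Diagram 0 N) (p : Fin N) :
    letters (openers D) (D.mate p) ≠ letters (openers D) p := by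
  simp only [letters, ne_eq, decide_eq_decide, mem_openers, D.mate_mate]
  have := D.mate_ne p
  rw [ne_eq, Fin.ext_iff] at this
  rw [Fin.lt_def, Fin.lt_def]
  omega

/-- A sum over `S`, taken twice, as a sum of contributions of both ends of the strand at each
point. -/
theorem two_mul_sum_eq {N : ℕ} (D : Diagram 0 N) (S : Finset ℕ) (hS : S ⊆ Finset.range N)
    (f : ℕ → ℕ) : 2 * ∑ p ∈ S, f p =
      ∑ p : Fin N, ((if (p : ℕ) ∈ S then f p else 0) +
        if (D.mate p : ℕ) ∈ S then f (D.mate p) else 0) := by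
  have h1 : ∑ p ∈ S, f p = ∑ p : Fin N, if (p : ℕ) ∈ S then f p else 0 := by
    rw [Fin.sum_univ_eq_sum_range fun p => if p ∈ S then f p else 0, ← Finset.sum_filter,
      Finset.filter_mem_eq_inter, Finset.inter_eq_right.mpr hS]
  have h2 : ∑ p : Fin N, (if (D.mate p : ℕ) ∈ S then f (D.mate p) else 0) =
      ∑ p : Fin N, if (p : ℕ) ∈ S then f p else 0 :=
    (Equiv.sum_comp ⟨D.mate, D.mate, D.mate_mate, D.mate_mate⟩
      fun p : Fin N => if (p : ℕ) ∈ S then f p else 0)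
  rw [Finset.sum_add_distrib, h2, ← h1, two_mul]

theorem alternates_iff {N : ℕ} (D : Diagram 0 N) (S : Finset ℕ) (p : Fin N) :
    letters S (D.mate p) ≠ letters S p ↔ ((D.mate p : ℕ) ∈ S ↔ (p : ℕ) ∉ S) := by
  simp only [letters, ne_eq, decide_eq_decide]
  tauto

theorem two_mul_card_of_alternates {N : ℕ} (D : Diagram 0 N) (S : Finset ℕ)
    (hS : S ⊆ Finset.range N) (h : ∀ p : Fin N, letters S (D.mate p) ≠ letters S p) :
    2 * S.card = N := by
  have h1 := two_mul_sum_eq D S hS fun _ => 1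
  rw [← Finset.card_eq_sum_ones] at h1
  rw [h1, Finset.sum_congr rfl (g := fun _ => 1)]
  · simp
  · intro p _
    have := (alternates_iff D S p).mp (h p)
    by_cases h2 : (p : ℕ) ∈ S
    · have h3 : (D.mate p : ℕ) ∉ S := fun h4 => this.mp h4 h2
      simp [h2, h3]
    · have h3 : (D.mate p : ℕ) ∈ S := this.mpr h2
      simp [h2, h3]

/-- Among the sets that contain exactly one end of each strand, the set of left ends is the only one
with the least sum. -/
theorem sum_openers_le {N : ℕ} (D : Diagram 0 N) (S : Finset ℕ)
    (hS : S ⊆ Finset.range N) (h : ∀ p : Fin N, letters S (D.mate p) ≠ letters S p) :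
    ∑ p ∈ openers D, p ≤ ∑ p ∈ S, p ∧ (∑ p ∈ openers D, p = ∑ p ∈ S, p → openers D = S) := by
  have h1 := two_mul_sum_eq D S hS fun p => p
  have h2 := two_mul_sum_eq D (openers D) (openers_subset D) fun p => p
  have hle : ∀ p ∈ (Finset.univ : Finset (Fin N)),
      ((if (p : ℕ) ∈ openers D then (p : ℕ) else 0) +
        if (D.mate p : ℕ) ∈ openers D then (D.mate p : ℕ) else 0) ≤
      ((if (p : ℕ) ∈ S then (p : ℕ) else 0) +
        if (D.mate p : ℕ) ∈ S then (D.mate p : ℕ) else 0) := by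
    intro p _
    have h3 := (alternates_iff D S p).mp (h p)
    have h4 := D.mate_ne p
    rw [ne_eq, Fin.ext_iff] at h4
    simp only [mem_openers, D.mate_mate, Fin.lt_def]
    split_ifs <;> first | omega | tauto
  constructor
  · have := Finset.sum_le_sum hle
    omega
  · intro heq
    have h5 := (Finset.sum_eq_sum_iff_of_le hle).mp (by omega)
    have key : ∀ p : Fin N, (p : ℕ) ∈ openers D ↔ (p : ℕ) ∈ S := by
      intro p
      have h6 := h5 p (Finset.mem_univ _)
      have h3 := (alternates_iff D S p).mp (h p)
      have h4 := D.mate_ne p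
      rw [ne_eq, Fin.ext_iff] at h4
      simp only [mem_openers, D.mate_mate, Fin.lt_def] at h6 ⊢
      split_ifs at h6 <;> first | omega | tauto
    ext p
    constructor
    · intro hp
      exact (key ⟨p, Finset.mem_range.mp (openers_subset D hp)⟩).mp hp
    · intro hp
      exact (key ⟨p, Finset.mem_range.mp (hS hp)⟩).mpr hp

/-- A diagram is determined by the left ends of its strands: a shortest strand that belongs to only
one of two diagrams with the same left ends leads to a crossing. -/
theorem openers_injective {N : ℕ} : Function.Injective (openers : Diagram 0 N → Finset ℕ) := by
  have key : ∀ (n : ℕ) (D D' : Diagram 0 N), openers D = openers D' → ∀ p : Fin N, p < D.mate p →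
      (D.mate p).1 - p.1 = n → D'.mate p = D.mate p := by
    intro n
    induction n using Nat.strong_induction_on with
    | _ n ih =>
    intro D D' h p hp hn
    have hop : ∀ q : Fin N, q < D.mate q ↔ q < D'.mate q := fun q => by
      rw [← mem_openers, ← mem_openers, h]
    have hcl : ∀ q : Fin N, D.mate q < q ↔ D'.mate q < q := fun q => by
      have h1 := hop q
      have h2 := D.mate_ne q
      have h3 := D'.mate_ne q
      rw [ne_eq, Fin.ext_iff] at h2 h3
      simp only [Fin.lt_def] at *
      omega
    -- the strands inside of the strand at `p` belong to both diagrams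
    have inside : ∀ q, p < q → q < D.mate p → D'.mate q = D.mate q := by
      intro q h1 h2
      have c1 : D.mate q ≠ p := fun h3 => by rw [← h3, D.mate_mate] at h2; exact lt_irrefl _ h2
      have c2 : D.mate q ≠ D.mate p := fun h3 => h1.ne (D.mate_injective h3).symm
      have c3 : ¬ D.mate p < D.mate q := fun h3 => D.mate_noncrossing h1 h2 h3
      have c4 : ¬ D.mate q < p := fun h3 =>
        D.mate_noncrossing h3 (by rwa [D.mate_mate]) (by rwa [D.mate_mate])
      have c5 := D.mate_ne q
      rw [ne_eq, Fin.ext_iff] at c1 c2 c5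
      rw [Fin.lt_def] at *
      rcases lt_or_ge q.1 (D.mate q).1 with h3 | h3
      · exact ih ((D.mate q).1 - q.1) (by omega) D D' h q h3 rfl
      · have h4 := ih (q.1 - (D.mate q).1) (by omega) D D' h (D.mate q)
          (by rw [D.mate_mate, Fin.lt_def]; omega) (by rw [D.mate_mate])
        rw [D.mate_mate] at h4
        rw [← h4, D'.mate_mate]
        rw [h4]
    set q := D.mate p with hq
    have hqp : D.mate q = p := by rw [hq, D.mate_mate]
    by_contra hne
    -- otherwise the strand of `D'` at `p` ends to the right of `q`, and the one at `q` to the left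
    -- of `p`, so that they cross
    have h1 : p < D'.mate p := (hop p).mp hp
    have h2 : D'.mate q < q := (hcl q).mp (by rwa [hqp])
    have h3 : q < D'.mate p := by
      by_contra h4
      have h5 : D'.mate p < q := lt_of_le_of_ne (not_lt.mp h4) hne
      have h6 := inside _ h1 h5
      rw [D'.mate_mate] at h6
      have h7 := D.mate_mate (D'.mate p)
      rw [← h6, ← hq] at h7
      exact h5.ne h7.symm
    have h4 : D'.mate q < p := by
      by_contra h5
      have h6 : D'.mate q ≠ p := fun h7 => hne (by rw [← h7, D'.mate_mate])
      have h8 := inside _ (lt_of_le_of_ne (not_lt.mp h5) h6.symm) h2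
      rw [D'.mate_mate] at h8
      have h9 := D.mate_mate (D'.mate q)
      rw [← h8, hqp] at h9
      exact h6 h9.symm
    exact D'.mate_noncrossing h4 (by rw [D'.mate_mate]; exact hp) (by rwa [D'.mate_mate])
  intro D D' h
  apply Diagram.ext_mate
  intro p
  rcases lt_or_gt_of_ne (D.mate_ne p) with h1 | h1
  · have h2 := key _ D D' h (D.mate p) (by rwa [D.mate_mate]) rfl
    rw [D.mate_mate] at h2
    rw [← h2, D'.mate_mate]
    rw [h2]
  · exact (key _ D D' h p h1 rfl).symm

/-- The spin model is faithful: among the diagrams that occur in `x`, the one whose left ends have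
the least sum is the only one with a non-zero coefficient at the set of its left ends. -/
theorem exists_spin_ne_zero (hτ : τ ≠ 0) {N : ℕ} (x : Hom K 0 N) (hx : x ≠ 0) :
    ∃ S ⊆ Finset.range N, 2 * S.card = N ∧ spin τ x (letters S) ≠ 0 := by
  obtain ⟨D, hD, hmin⟩ := Finset.exists_min_image x.support (fun D => ∑ p ∈ openers D, p)
    (Finsupp.support_nonempty_iff.mpr hx)
  refine ⟨openers D, openers_subset D, two_mul_card_of_alternates D _ (openers_subset D)
    (alternates_openers D), ?_⟩
  rw [spin_apply, Finsupp.sum, Finset.sum_eq_single D]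
  · refine mul_ne_zero (Finsupp.mem_support_iff.mp hD) ?_
    rw [spinWeight_ne_zero_iff τ hτ]
    exact alternates_openers D
  · intro D' hD' hne
    by_contra h
    have h1 := (spinWeight_ne_zero_iff τ hτ D' _).mp (right_ne_zero_of_mul h)
    have h2 := sum_openers_le D' (openers D) (openers_subset D) h1
    exact hne (openers_injective (h2.2 (le_antisymm h2.1 (hmin D' hD'))))
  · exact fun h => absurd hD h

/-! ### Gaussian sums over subsets -/

/-- The generating function of the sums of the `r`-element subsets of `{0, …, n - 1}`. -/
def gaussSum (Q : K) (n r : ℕ) : K := ∑ A ∈ (Finset.range n).powersetCard r, Q ^ (∑ p ∈ A, p)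

theorem gaussSum_one (Q : K) (n : ℕ) : gaussSum Q n 1 = ∑ p ∈ Finset.range n, Q ^ p := by
  rw [gaussSum, Finset.powersetCard_one, Finset.sum_map]
  simp

open Polynomial in
/-- The Gaussian sums are the coefficients of a product, as in the `q`-binomial theorem. -/
theorem coeff_prod_eq_gaussSum (Q : K) (n r : ℕ) :
    (∏ s ∈ Finset.range n, (1 + C (Q ^ s) * X)).coeff r = gaussSum Q n r := by
  rw [Finset.prod_one_add, finsetSum_coeff, gaussSum, Finset.powersetCard_eq_filter,
    Finset.sum_filter]
  refine Finset.sum_congr rfl fun A _ => ?_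
  rw [Finset.prod_mul_distrib, Finset.prod_const, ← map_prod, Finset.prod_pow_eq_pow_sum,
    coeff_C_mul, coeff_X_pow]
  simp [eq_comm]

open Polynomial in
/-- At a primitive `l`-th root of unity the Gaussian sum for `n` and `l` is `⌊n / l⌋` times the one
for `l` and `l`, which does not vanish in characteristic zero. -/
theorem gaussSum_ne_zero [CharZero K] {Q : K} {l : ℕ} (hl : 0 < l) (hQ : IsPrimitiveRoot Q l)
    (n : ℕ) (hn : l ≤ n) : gaussSum Q n l ≠ 0 := by
  set P : ℕ → K[X] := fun n => ∏ s ∈ Finset.range n, (1 + C (Q ^ s) * X) with hP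
  -- `P l` is invariant under `X ↦ Q X`, so only its coefficients in degrees `0` and `l` survive
  have hQ0 : Q ≠ 0 := hQ.ne_zero hl.ne'
  have hPadd : ∀ n, P (l + n) = P l * P n := by
    intro n
    simp only [hP, Finset.prod_range_add, pow_add, hQ.pow_eq_one, one_mul]
  have hcomp : (P l).comp (C Q * X) = P l := by
    have h1 : (P l).comp (C Q * X) = ∏ s ∈ Finset.range l, (1 + C (Q ^ (s + 1)) * X) := by
      simp only [hP, prod_comp, add_comp, one_comp, mul_comp, C_comp, X_comp, pow_succ, map_mul,
        mul_assoc]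
    have h2 := Finset.prod_range_succ (fun s => 1 + C (Q ^ s) * X) l
    rw [Finset.prod_range_succ', hQ.pow_eq_one, pow_zero] at h2
    have h3 : (1 + C (1 : K) * X : K[X]) ≠ 0 := by
      intro h
      have := congrArg (fun p => p.coeff 0) h
      simp at this
    rw [h1]
    exact mul_right_cancel₀ h3 h2
  have hmid : ∀ j, 0 < j → j < l → (P l).coeff j = 0 := by
    intro j hj hjl
    have h1 := congrArg (fun p => p.coeff j) hcomp
    simp only [comp_C_mul_X_coeff] at h1
    have h2 : Q ^ j ≠ 1 := hQ.pow_ne_one_of_pos_of_lt hj.ne' hjl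
    have h3 : (P l).coeff j * (Q ^ j - 1) = 0 := by rw [mul_sub, h1, mul_one, sub_self]
    exact (mul_eq_zero.mp h3).resolve_right (sub_ne_zero.mpr h2)
  have hzero : ∀ n, (P n).coeff 0 = 1 := by
    intro n
    rw [coeff_prod_eq_gaussSum, gaussSum]
    simp
  have htop : (P l).coeff l ≠ 0 := by
    have h1 : (Finset.range l).powersetCard l = {Finset.range l} := by
      simpa using Finset.powersetCard_self (Finset.range l)
    rw [coeff_prod_eq_gaussSum, gaussSum, h1, Finset.sum_singleton]
    exact pow_ne_zero _ hQ0
  have hstep : ∀ n, (P (l + n)).coeff l = (P l).coeff l + (P n).coeff l := by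
    intro n
    rw [hPadd, coeff_mul, Finset.Nat.sum_antidiagonal_eq_sum_range_succ_mk,
      Finset.sum_range_succ]
    rw [Finset.sum_eq_single 0]
    · simp [hzero]; ring
    · intro j hj hj0
      rw [Finset.mem_range] at hj
      rw [hmid j (by omega) hj, zero_mul]
    · intro h; simp at h; omega
  have hall : ∀ m r, r < l → (P (l * m + r)).coeff l = m * (P l).coeff l := by
    intro m
    induction m with
    | zero =>
      intro r hr
      rw [coeff_prod_eq_gaussSum, gaussSum, Finset.powersetCard_eq_empty.mpr (by simpa using hr)]
      simp
    | succ m ih =>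
      intro r hr
      rw [show l * (m + 1) + r = l + (l * m + r) by ring, hstep, ih r hr]
      push_cast; ring
  have h1 := hall (n / l) (n % l) (Nat.mod_lt _ hl)
  rw [Nat.div_add_mod, coeff_prod_eq_gaussSum] at h1
  rw [h1]
  have : n / l ≠ 0 := (Nat.div_pos hn hl).ne'
  exact mul_ne_zero (Nat.cast_ne_zero.mpr this) htop

/-! ### Morphisms killed by all caps -/

/-- A morphism without top points that is killed by all caps at neighbouring points. -/
def Singular (d : K) {N : ℕ} (x : Hom K 0 N) : Prop :=
  ∀ (M : ℕ) (h : N = M + 2) (i : ℕ) (hi : i ≤ M), comp d (capHom d h i hi) x = 0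

/-- Singular morphisms are represented by multiples of the `q`-symmetric tensor. -/
theorem Singular.spin_eq (hτ : τ ≠ 0) {k : ℕ} {x : Hom K 0 (k + k)} (hs : Singular (τ + τ⁻¹) x) :
    ∃ c, ∀ S ⊆ Finset.range (k + k), S.card = k →
      spin τ x (letters S) = (-τ) ^ (∑ p ∈ S, p) * c := by
  refine ⟨spin τ x (letters (Finset.Ico 0 k)) / (-τ) ^ (∑ p ∈ Finset.Ico 0 k, p),
    fun S hS hk => ?_⟩
  have h1 := eq_of_move_invariant
    (fun S => spin τ x (letters S) / (-τ) ^ (∑ p ∈ S, p)) 0 (k + k) (by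
      intro S i _ hi h1 h2
      exact spin_move τ hτ (M := k + k - 2) (by omega) i (by omega) x (hs _ _ _ _) h1 h2)
      ∅ (Finset.disjoint_empty_left _) S (by rwa [← Finset.range_eq_Ico])
  simp only [Finset.union_empty, zero_add, hk] at h1
  rw [← h1, mul_div_cancel₀]
  exact pow_ne_zero _ (neg_ne_zero.mpr hτ)

/-- A non-zero singular morphism is represented by a multiple of the `q`-symmetric tensor, whereas
all morphisms are killed by the symmetriser on the window of the first `k + r` points. The value of
this symmetriser at the `q`-symmetric tensor is a Gaussian sum, up to a unit. -/
theorem Singular.gaussSum_eq_zero (hτ : τ ≠ 0) {k : ℕ} {x : Hom K 0 (k + k)}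
    (hs : Singular (τ + τ⁻¹) x) (hx : x ≠ 0) (r : ℕ) (hr : 0 < r) (hrk : r ≤ k) :
    gaussSum (τ ^ 2) (k + r) r = 0 := by
  obtain ⟨c, hc⟩ := hs.spin_eq τ hτ
  have hc0 : c ≠ 0 := by
    rintro rfl
    obtain ⟨S, hS, hcard, h⟩ := exists_spin_ne_zero τ hτ x hx
    exact h (by rw [hc S hS (by omega), mul_zero])
  set R := Finset.Ico (k + r) (k + k) with hR
  have hdisj : Disjoint R (Finset.Ico 0 (k + r)) := by
    rw [Finset.disjoint_left]
    intro p hp hp'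
    rw [hR, Finset.mem_Ico] at hp
    rw [Finset.mem_Ico] at hp'
    omega
  have h1 := sum_spin_window τ x 0 (k + r) (by omega) (by omega) r R hdisj
  have h2 : ∀ A ∈ (Finset.Ico 0 (k + r)).powersetCard r,
      (-τ) ^ (∑ p ∈ A, p) * spin τ x (letters (A ∪ R)) =
        (τ ^ 2) ^ (∑ p ∈ A, p) * ((-τ) ^ (∑ p ∈ R, p) * c) := by
    intro A hA
    rw [Finset.mem_powersetCard] at hA
    have hAR : Disjoint A R := (hdisj.mono_right hA.1).symm
    rw [hc, Finset.sum_union hAR, pow_add, ← neg_sq, pow_right_comm]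
    · ring
    · refine Finset.union_subset (fun p hp => ?_) (fun p hp => ?_)
      · have := hA.1 hp
        rw [Finset.mem_Ico] at this
        rw [Finset.mem_range]; omega
      · rw [hR, Finset.mem_Ico] at hp
        rw [Finset.mem_range]; omega
    · rw [Finset.card_union_of_disjoint hAR, hA.2, hR, Nat.card_Ico]
      omega
  rw [Finset.sum_congr rfl h2, ← Finset.sum_mul, ← Finset.range_eq_Ico] at h1
  exact (mul_eq_zero.mp h1).resolve_right
    (mul_ne_zero (pow_ne_zero _ (neg_ne_zero.mpr hτ)) hc0)

/-- The nested cups occur in every non-zero singular morphism. -/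
theorem Singular.apply_nestCup_ne_zero (hτ : τ ≠ 0) {k : ℕ} {x : Hom K 0 (k + k)}
    (hs : Singular (τ + τ⁻¹) x) (hx : x ≠ 0) : x (nestCup k) ≠ 0 := by
  obtain ⟨c, hc⟩ := hs.spin_eq τ hτ
  have hc0 : c ≠ 0 := by
    rintro rfl
    obtain ⟨S, hS, hcard, h⟩ := exists_spin_ne_zero τ hτ x hx
    exact h (by rw [hc S hS (by omega), mul_zero])
  have h1 : spin τ x (letters (Finset.range k)) ≠ 0 := by
    rw [hc _ (Finset.range_subset_range.mpr (by omega)) (Finset.card_range k)]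
    exact mul_ne_zero (pow_ne_zero _ (neg_ne_zero.mpr hτ)) hc0
  rw [spin_apply, Finsupp.sum] at h1
  obtain ⟨D, hD, h2⟩ := Finset.exists_ne_zero_of_sum_ne_zero h1
  have h3 := (spinWeight_ne_zero_iff τ hτ D _).mp (right_ne_zero_of_mul h2)
  have : D = nestCup k := by
    apply D.eq_nestCup
    intro p hp
    have h4 := (alternates_iff D _ p).mp (h3 p)
    simp only [Finset.mem_range] at h4
    omega
  rw [← this]
  exact left_ne_zero_of_mul h2

theorem eq_zero_of_odd {N : ℕ} (x : Hom K 0 N) (hN : ¬ Even N) : x = 0 := by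
  ext D
  exact absurd D.even_of_diagram hN

end

/-! ### Singular morphisms in ideals -/

section

variable {K : Type*} [Field K]

/-- If `τ ^ 2` has order `l`, non-zero singular morphisms on `2 * k > 0` points exist at most for
`k = l - 1`: the Gaussian sum for `r = 1` shows that `l` divides `k + 1`, and the one for `r = l`
shows that `k < l`. -/
theorem Singular.add_one_eq [CharZero K] {τ : K} (hτ : τ ≠ 0) {l : ℕ} (hl : 0 < l)
    (hQ : IsPrimitiveRoot (τ ^ 2) l) {k : ℕ} {x : Hom K 0 (k + k)} (hs : Singular (τ + τ⁻¹) x)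
    (hx : x ≠ 0) (hk : 0 < k) : k + 1 = l := by
  have h1 := hs.gaussSum_eq_zero τ hτ hx 1 one_pos hk
  have h2 := geom_sum_mul (τ ^ 2) (k + 1)
  rw [← gaussSum_one, h1, zero_mul, eq_comm, sub_eq_zero, hQ.pow_eq_one_iff_dvd] at h2
  have h3 := Nat.le_of_dvd (by omega) h2
  by_contra hne
  exact gaussSum_ne_zero hl hQ (k + l) (by omega)
    (hs.gaussSum_eq_zero τ hτ hx l hl (by omega))

theorem tensor_idHom_zero {m n : ℕ} (a : Hom K m n) : tensor a (idHom K 0) = a := by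
  induction a using hom_induction (0 : K) with
  | h0 => simp
  | hadd x y hx hy => simp [hx, hy]
  | hsmul r x hx => simp [hx]
  | h D =>
    rw [idHom_eq 0, ← LoopDiagram.toHom_tensor]
    refine congrArg (LoopDiagram.toHom (0 : K)) (LoopDiagram.mat_injective ?_)
    ext s t
    have h1 :=
      LoopDiagram.mat_tensor (.of D) (.of (idDiagram (rfl : 0 = 0))) s Fin.elim0 t Fin.elim0
    rw [Fin.append_right_nil s _ rfl, Fin.append_right_nil t _ rfl, LoopDiagram.mat_of _,
      LoopDiagram.mat_of, colMat_id, Matrix.one_apply_eq, mul_one] at h1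
    rw [LoopDiagram.mat_of]
    exact h1

variable {d : K} {J : ∀ m n : ℕ, Submodule K (Hom K m n)}

/-- An ideal with a non-zero scalar contains everything. -/
theorem IsTensorIdeal.eq_top_of_zero_zero (hJ : IsTensorIdeal d J) (h : J 0 0 ≠ ⊥) : J = ⊤ := by
  obtain ⟨x, hx, hx0⟩ := (Submodule.ne_bot_iff _).mp h
  have h1 : idHom K 0 ∈ J 0 0 := by
    have e : x = x (idDiagram rfl) • idHom K 0 := by
      ext D
      rw [Subsingleton.elim D (idDiagram rfl)]
      simp [idHom]
    have h2 : x (idDiagram rfl) ≠ 0 := by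
      intro h2
      rw [h2, zero_smul] at e
      exact hx0 e
    rw [e] at hx
    exact (Submodule.smul_mem_iff _ h2).mp hx
  funext m n
  rw [Pi.top_apply, Pi.top_apply, eq_top_iff]
  intro a _
  rw [← tensor_idHom_zero a]
  exact hJ.tensor_left a _ h1

/-- Bending reduces ideals to their morphisms without top points. -/
theorem IsTensorIdeal.exists_ne_bot (hJ : IsTensorIdeal d J) (h : J ≠ ⊥) : ∃ N, J 0 N ≠ ⊥ := by
  by_contra hcon
  push Not at hcon
  refine h (funext fun m => funext fun n => (Submodule.eq_bot_iff _).mpr fun a ha => ?_)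
  have h1 := hJ.bendHom_mem ha
  rw [hcon, Submodule.mem_bot] at h1
  rw [← unbendHom_bendHom d a, h1]
  simp [unbendHom]

/-- The morphisms with the least number of points in an ideal are singular, as caps lower the number
of points. -/
theorem IsTensorIdeal.singular_of_mem (hJ : IsTensorIdeal d J) {N : ℕ}
    (hN : ∀ M < N, J 0 M = ⊥) {x : Hom K 0 N} (hx : x ∈ J 0 N) : Singular d x := by
  intro M h i hi
  have h1 := hJ.comp_left (capHom d h i hi) x hx
  rwa [hN M (by omega), Submodule.mem_bot] at h1

theorem IsTensorIdeal.exists_singular (hJ : IsTensorIdeal d J) (h : J ≠ ⊥) :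
    ∃ k, ∃ x ∈ J 0 (k + k), x ≠ 0 ∧ Singular d x ∧ ∀ M < k + k, J 0 M = ⊥ := by
  classical
  have hex := hJ.exists_ne_bot h
  obtain ⟨N, hN, hmin⟩ : ∃ N, J 0 N ≠ ⊥ ∧ ∀ M < N, J 0 M = ⊥ :=
    ⟨Nat.find hex, Nat.find_spec hex, fun M hM => not_not.mp (Nat.find_min hex hM)⟩
  obtain ⟨x, hx, hx0⟩ := (Submodule.ne_bot_iff _).mp hN
  obtain ⟨k, rfl⟩ : Even N := by
    by_contra hodd
    exact hx0 (eq_zero_of_odd x hodd)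
  exact ⟨k, x, hx, hx0, hJ.singular_of_mem hmin hx, hmin⟩

/-- Without singular morphisms on a positive number of points there are no proper ideals. -/
theorem IsTensorIdeal.eq_bot_or_eq_top {τ : K} (hτ : τ ≠ 0)
    (hQ : ∀ k, 0 < k → ∑ p ∈ Finset.range (k + 1), (τ ^ 2) ^ p ≠ 0)
    (hJ : IsTensorIdeal (τ + τ⁻¹) J) : J = ⊥ ∨ J = ⊤ := by
  refine or_iff_not_imp_left.mpr fun hbot => ?_
  obtain ⟨k, x, hx, hx0, hs, -⟩ := hJ.exists_singular hbot
  rcases Nat.eq_zero_or_pos k with rfl | hk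
  · exact hJ.eq_top_of_zero_zero ((Submodule.ne_bot_iff _).mpr ⟨x, hx, hx0⟩)
  · exact absurd ((gaussSum_one _ _).symm.trans (hs.gaussSum_eq_zero τ hτ hx0 1 one_pos hk))
      (hQ k hk)

theorem trace_idHom_zero (d : K) : trace d (idHom K 0) = 1 := by
  have h := trace_smul_idHom d (idHom K 0)
  have h1 := toHom_zero_zero d (LoopDiagram.of (idDiagram (rfl : 0 = 0)))
  rw [← idHom_eq] at h1
  have h2 := congrArg (fun f : Hom K 0 0 => f (idDiagram rfl)) h1
  simp only [idHom, Finsupp.smul_apply, Finsupp.single_eq_same, smul_eq_mul, mul_one] at h2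
  exact h2.symm

/-- A morphism of the monoidal unit is determined by its trace. -/
theorem eq_trace_smul (d : K) (x : Hom K 0 0) : x = trace d x • idHom K 0 := by
  induction x using hom_induction d with
  | h0 => simp
  | hadd x y hx hy =>
    rw [map_add, add_smul, ← hx, ← hy]
  | hsmul r x hx => rw [map_smul, smul_assoc, ← hx]
  | h D => exact toHom_zero_zero d _

theorem negligible_ne_top (d : K) : negligible d ≠ ⊤ := by
  intro h
  have h1 : idHom K 0 ∈ negligible d 0 0 := by rw [h]; exact Submodule.mem_top
  have h2 := h1 (idHom K 0)
  rw [comp_idHom, trace_idHom_zero] at h2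
  exact one_ne_zero h2

/-- A proper ideal consists of negligible morphisms: closing up an endomorphism with non-zero trace
gives a non-zero scalar. -/
theorem IsTensorIdeal.le_negligible (hJ : IsTensorIdeal d J) (h : J ≠ ⊤) (m n : ℕ) :
    J m n ≤ negligible d m n := by
  intro a ha b
  by_contra hne
  refine h (hJ.eq_top_of_zero_zero ((Submodule.ne_bot_iff _).mpr
    ⟨trace d (comp d a b) • idHom K 0, ?_, ?_⟩))
  · rw [← trace_smul_idHom]
    exact hJ.comp_left _ _ (hJ.bendHom_mem (hJ.comp_right _ _ ha))
  · refine smul_ne_zero hne ?_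
    simp [idHom]

/-- If `τ ^ 2` has order `l`, there are no non-zero negligible morphisms on fewer than `2 * (l - 1)`
points: those with the least number of points would be singular. -/
theorem negligible_eq_bot [CharZero K] {τ : K} (hτ : τ ≠ 0) {l : ℕ} (hl : 0 < l)
    (hQ : IsPrimitiveRoot (τ ^ 2) l) {N : ℕ} (hN : N + 2 < 2 * l) :
    negligible (τ + τ⁻¹) 0 N = ⊥ := by
  induction N using Nat.strong_induction_on with
  | _ N ih =>
  rw [Submodule.eq_bot_iff]
  intro x hx
  by_contra hx0
  obtain ⟨k, rfl⟩ : Even N := by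
    by_contra hodd
    exact hx0 (eq_zero_of_odd x hodd)
  rcases Nat.eq_zero_or_pos k with rfl | hk
  · apply hx0
    have h1 := hx (idHom K 0)
    rw [comp_idHom] at h1
    exact (eq_trace_smul (τ + τ⁻¹) x).trans (by rw [h1, zero_smul])
  · have hs : Singular (τ + τ⁻¹) x :=
      (isTensorIdeal_negligible _).singular_of_mem (fun M hM => ih M hM (by omega)) hx
    have := hs.add_one_eq hτ hl hQ hx0 hk
    omega

end

/-! ### Existence of negligible morphisms -/

section

variable {K : Type*} [Field K]

theorem skip_injective (i : ℕ) : Function.Injective (skip i) := by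
  intro p q h
  unfold skip at h
  split_ifs at h <;> omega

theorem skip_ne_left (i q : ℕ) : skip i q ≠ i := by
  unfold skip; split_ifs <;> omega

theorem skip_ne_right (i q : ℕ) : skip i q ≠ i + 1 := by
  unfold skip; split_ifs <;> omega

/-- A morphism represented by a multiple of the `q`-symmetric tensor is killed by all caps. -/
theorem singular_of_spin_eq {τ : K} (hτ : τ ≠ 0) {N : ℕ} (x : Hom K 0 N) (c : K)
    (hc : ∀ S ⊆ Finset.range N, 2 * S.card = N →
      spin τ x (letters S) = (-τ) ^ (∑ p ∈ S, p) * c) : Singular (τ + τ⁻¹) x := by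
  intro M h i hi
  by_contra hne
  obtain ⟨S, hS, hcard, hspin⟩ := exists_spin_ne_zero τ hτ _ hne
  apply hspin
  set T := S.map ⟨skip i, skip_injective i⟩ with hT
  have hTi : i ∉ T := by
    rw [hT, Finset.mem_map]
    rintro ⟨q, -, hq⟩
    exact skip_ne_left i q hq
  have hTi' : i + 1 ∉ T := by
    rw [hT, Finset.mem_map]
    rintro ⟨q, -, hq⟩
    exact skip_ne_right i q hq
  have hTN : T ⊆ Finset.range N := by
    intro p hp
    rw [hT, Finset.mem_map] at hp
    obtain ⟨q, hq, rfl⟩ := hp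
    exact Finset.mem_range.mpr (skip_lt h (Finset.mem_range.mp (hS hq)))
  have hTc : T.card = S.card := Finset.card_map _
  have e0 : letters S = letters T ∘ skip i := by
    funext q
    simp only [letters, Function.comp, decide_eq_decide, hT]
    exact (Finset.mem_map' ⟨skip i, skip_injective i⟩).symm
  have e1 : setPair (letters T) i true false = letters (insert i T) := by
    rw [letters_eq_setPair (insert i T) i (Finset.mem_insert_self _ _) (by simp [hTi'])]
    funext p
    simp only [setPair, letters, Finset.mem_insert]
    split_ifs with h1 h2
    · rfl
    · rfl
    · simp [h1]
  have e2 : setPair (letters T) i false true = letters (insert (i + 1) T) := by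
    have h1 := letters_move_eq_setPair (insert i T) i
    rw [Finset.erase_insert hTi, ← e1] at h1
    rw [h1]
    funext p
    simp only [setPair]
    split_ifs <;> rfl
  rw [e0, spin_capHom_comp τ hτ, e1, e2, hc, hc, Finset.sum_insert hTi, Finset.sum_insert hTi',
    pow_add, pow_add, pow_succ]
  · field_simp
    ring
  · exact Finset.insert_subset (Finset.mem_range.mpr (by omega)) hTN
  · rw [Finset.card_insert_of_notMem hTi]; omega
  · exact Finset.insert_subset (Finset.mem_range.mpr (by omega)) hTN
  · rw [Finset.card_insert_of_notMem hTi']; omega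

/-- A morphism killed by all caps but the middle one is represented by a tensor that is
`q`-symmetric in the left half and in the right half: up to powers of `-τ`, its coefficient at a set
only depends on the number of elements in the left half. -/
theorem exists_spin_eq_of_halves {τ : K} (hτ : τ ≠ 0) {k : ℕ} (x : Hom K 0 (k + k))
    (hx : ∀ (M : ℕ) (h : k + k = M + 2) (i : ℕ) (hi : i ≤ M), i + 1 ≠ k →
      comp (τ + τ⁻¹) (capHom (τ + τ⁻¹) h i hi) x = 0) :
    ∃ c : ℕ → K, ∀ A ⊆ Finset.Ico 0 k, ∀ B ⊆ Finset.Ico k (k + k), A.card + B.card = k →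
      spin τ x (letters (A ∪ B)) = (-τ) ^ (∑ p ∈ A, p + ∑ p ∈ B, p) * c A.card := by
  set G : Finset ℕ → K := fun S => spin τ x (letters S) / (-τ) ^ (∑ p ∈ S, p) with hG
  have move : ∀ (S : Finset ℕ) (i : ℕ), i + 1 < k + k → i + 1 ≠ k → i ∈ S → i + 1 ∉ S →
      G S = G (insert (i + 1) (S.erase i)) := by
    intro S i h1 h2 h3 h4
    exact spin_move τ hτ (M := k + k - 2) (by omega) i (by omega) x (hx _ _ _ _ h2) h3 h4
  refine ⟨fun j => G (Finset.Ico k (k + (k - j)) ∪ Finset.Ico 0 (0 + j)), fun A hA B hB hcard => ?_⟩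
  have disj : Disjoint (Finset.Ico 0 k) (Finset.Ico k (k + k)) :=
    Finset.Ico_disjoint_Ico_consecutive _ _ _
  have hsub : Finset.Ico 0 (0 + A.card) ⊆ Finset.Ico 0 k :=
    Finset.Ico_subset_Ico_right (by omega)
  have h1 := eq_of_move_invariant G 0 k
    (fun S i _ hi h1 h2 => move S i (by omega) (by omega) h1 h2) B (disj.symm.mono_left hB) A hA
  have h2 := eq_of_move_invariant G k (k + k)
    (fun S i hi hi' h1 h2 => move S i (by omega) (by omega) h1 h2) (Finset.Ico 0 (0 + A.card))
    (disj.mono_left hsub) B hB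
  rw [Finset.union_comm, ← h1, show B.card = k - A.card by omega] at h2
  beta_reduce
  rw [← h2, hG]
  beta_reduce
  rw [Finset.sum_union (disj.mono hA hB), mul_div_cancel₀]
  exact pow_ne_zero _ (neg_ne_zero.mpr hτ)

/-- The symmetrisers on windows relate neighbouring coefficients of a tensor that is `q`-symmetric
in both halves. -/
theorem window_relation {τ : K} {k : ℕ} (x : Hom K 0 (k + k)) (hτ : τ ≠ 0) (c : ℕ → K)
    (hc : ∀ A ⊆ Finset.Ico 0 k, ∀ B ⊆ Finset.Ico k (k + k), A.card + B.card = k →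
      spin τ x (letters (A ∪ B)) = (-τ) ^ (∑ p ∈ A, p + ∑ p ∈ B, p) * c A.card)
    {j : ℕ} (hj : j < k) :
    (∑ p ∈ Finset.Ico j k, (τ ^ 2) ^ p) * c (j + 1) +
      (∑ p ∈ Finset.Ico k (j + k + 1), (τ ^ 2) ^ p) * c j = 0 := by
  -- the window `[j, j + k]` with `j` fixed elements to its left and `k - 1 - j` to its right
  set L := Finset.Ico 0 j with hL
  set R := Finset.Ico (j + k + 1) (k + k) with hR
  have hdisj : Disjoint (L ∪ R) (Finset.Ico j (j + k + 1)) := by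
    rw [Finset.disjoint_left]
    intro p hp hp'
    rw [hL, hR, Finset.mem_union, Finset.mem_Ico, Finset.mem_Ico] at hp
    rw [Finset.mem_Ico] at hp'
    omega
  have h1 := sum_spin_window τ x j (j + k + 1) (by omega) (by omega) 1 (L ∪ R) hdisj
  rw [Finset.powersetCard_one, Finset.sum_map] at h1
  simp only [Function.Embedding.coeFn_mk, Finset.sum_singleton] at h1
  have hLs : L ⊆ Finset.Ico 0 k := Finset.Ico_subset_Ico_right (by omega)
  have hRs : R ⊆ Finset.Ico k (k + k) := Finset.Ico_subset_Ico_left (by omega)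
  have hLc : L.card = j := by simp [hL]
  have hRc : R.card = k - 1 - j := by simp [hR]; omega
  set r := (-τ) ^ (∑ p ∈ L, p + ∑ p ∈ R, p) with hr
  have hr0 : r ≠ 0 := pow_ne_zero _ (neg_ne_zero.mpr hτ)
  have sq : ∀ p : ℕ, (τ ^ 2) ^ p = (-τ) ^ p * (-τ) ^ p := by
    intro p
    rw [← mul_pow, neg_mul_neg, sq]
  have left : ∀ p ∈ Finset.Ico j k, (-τ) ^ p * spin τ x (letters ({p} ∪ (L ∪ R))) =
      r * ((τ ^ 2) ^ p * c (j + 1)) := by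
    intro p hp
    rw [Finset.mem_Ico] at hp
    have hpL : p ∉ L := by rw [hL, Finset.mem_Ico]; omega
    rw [← Finset.union_assoc, ← Finset.insert_eq, hc _ (Finset.insert_subset
      (Finset.mem_Ico.mpr ⟨by omega, hp.2⟩) hLs) _ hRs, Finset.sum_insert hpL,
      Finset.card_insert_of_notMem hpL, hLc, sq, hr]
    · ring
    · rw [Finset.card_insert_of_notMem hpL]; omega
  have right : ∀ p ∈ Finset.Ico k (j + k + 1), (-τ) ^ p * spin τ x (letters ({p} ∪ (L ∪ R))) =
      r * ((τ ^ 2) ^ p * c j) := by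
    intro p hp
    rw [Finset.mem_Ico] at hp
    have hpR : p ∉ R := by rw [hR, Finset.mem_Ico]; omega
    rw [Finset.union_left_comm, ← Finset.insert_eq, hc _ hLs _ (Finset.insert_subset
      (Finset.mem_Ico.mpr ⟨by omega, by omega⟩) hRs), Finset.sum_insert hpR, hLc, sq, hr]
    · ring
    · rw [Finset.card_insert_of_notMem hpR]; omega
  rw [← Finset.sum_Ico_consecutive _ hj.le (by omega : k ≤ j + k + 1), Finset.sum_congr rfl left,
    Finset.sum_congr rfl right, ← Finset.mul_sum, ← Finset.mul_sum, ← mul_add, ← Finset.sum_mul,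
    ← Finset.sum_mul] at h1
  exact (mul_eq_zero.mp h1).resolve_left hr0

/-- If `τ ^ 2` has order `k + 1`, a morphism on `2 * k` points that is killed by all caps but the
middle one is also killed by the middle one: a window of `k + 1` points then has zero Gaussian sum,
which makes all coefficients of its tensor equal up to the powers of `-τ`. -/
theorem singular_of_halves {τ : K} (hτ : τ ≠ 0) {k : ℕ}
    (hQ : IsPrimitiveRoot (τ ^ 2) (k + 1)) (x : Hom K 0 (k + k))
    (hx : ∀ (M : ℕ) (h : k + k = M + 2) (i : ℕ) (hi : i ≤ M), i + 1 ≠ k →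
      comp (τ + τ⁻¹) (capHom (τ + τ⁻¹) h i hi) x = 0) : Singular (τ + τ⁻¹) x := by
  obtain ⟨c, hc⟩ := exists_spin_eq_of_halves hτ x hx
  have step : ∀ j < k, c (j + 1) = c j := by
    intro j hj
    -- the two sums of the window relation add up to a multiple of `1 + τ ^ 2 + ⋯ + τ ^ (2 * k) = 0`
    have h1 := window_relation x hτ c hc hj
    have h2 : ∑ p ∈ Finset.Ico j (j + k + 1), (τ ^ 2) ^ p = 0 := by
      rw [Finset.sum_Ico_eq_sum_range, show j + k + 1 - j = k + 1 by omega]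
      simp only [pow_add (τ ^ 2) j]
      rw [← Finset.mul_sum, hQ.geom_sum_eq_zero (by omega), mul_zero]
    rw [← Finset.sum_Ico_consecutive _ hj.le (by omega : k ≤ j + k + 1)] at h2
    have h3 : ∑ p ∈ Finset.Ico k (j + k + 1), (τ ^ 2) ^ p ≠ 0 := by
      rw [Finset.sum_Ico_eq_sum_range, show j + k + 1 - k = j + 1 by omega]
      simp only [pow_add (τ ^ 2) k]
      rw [← Finset.mul_sum]
      refine mul_ne_zero (pow_ne_zero _ (pow_ne_zero _ hτ)) fun h => ?_
      have h4 := geom_sum_mul (τ ^ 2) (j + 1)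
      rw [h, zero_mul, eq_comm, sub_eq_zero] at h4
      exact hQ.pow_ne_one_of_pos_of_lt (by omega) (by omega) h4
    have h5 : (∑ p ∈ Finset.Ico k (j + k + 1), (τ ^ 2) ^ p) * (c (j + 1) - c j) = 0 := by
      linear_combination c (j + 1) * h2 - h1
    exact sub_eq_zero.mp ((mul_eq_zero.mp h5).resolve_left h3)
  have const : ∀ j ≤ k, c j = c 0 := by
    intro j
    induction j with
    | zero => exact fun _ => rfl
    | succ j ih => exact fun hj => (step j hj).trans (ih (by omega))
  refine singular_of_spin_eq hτ x (c 0) fun S hS hcard => ?_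
  have hd : Disjoint (S.filter (· < k)) (S.filter fun p => ¬ p < k) :=
    Finset.disjoint_filter_filter_not _ _ _
  have hu : S.filter (· < k) ∪ S.filter (fun p => ¬ p < k) = S := by
    ext p
    simp only [Finset.mem_union, Finset.mem_filter]
    tauto
  have hA : S.filter (· < k) ⊆ Finset.Ico 0 k := by
    intro p hp
    rw [Finset.mem_filter] at hp
    exact Finset.mem_Ico.mpr ⟨by omega, hp.2⟩
  have hAc : (S.filter (· < k)).card ≤ k := by
    simpa using Finset.card_le_card hA
  have h1 := hc _ hA (S.filter fun p => ¬ p < k) (by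
    intro p hp
    rw [Finset.mem_filter] at hp
    have := Finset.mem_range.mp (hS hp.1)
    exact Finset.mem_Ico.mpr ⟨by omega, this⟩) (by
    rw [← Finset.card_union_of_disjoint hd, hu]; omega)
  rw [hu, ← Finset.sum_union hd, hu, const _ hAc] at h1
  exact h1

instance {m n : ℕ} : Finite (Diagram m n) :=
  Finite.of_injective (fun D => D.pair) fun _ _ h => Diagram.ext h

/-- Dimension count: some non-zero morphism is orthogonal to all diagrams but the nested caps. -/
theorem exists_orthogonal (d : K) (k : ℕ) : ∃ y : Hom K 0 (k + k), y ≠ 0 ∧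
    ∀ b : Diagram (k + k) 0, b ≠ nestCap k →
      trace d (comp d ((LoopDiagram.of b).toHom d) y) = 0 := by
  classical
  have := Fintype.ofFinite (Diagram (k + k) 0)
  have := Fintype.ofFinite (Diagram 0 (k + k))
  let f : Hom K 0 (k + k) →ₗ[K] ({b : Diagram (k + k) 0 // b ≠ nestCap k} → K) :=
    LinearMap.pi fun b => trace d ∘ₗ comp d ((LoopDiagram.of b.1).toHom d)
  have hcard : Fintype.card (Diagram (k + k) 0) = Fintype.card (Diagram 0 (k + k)) :=
    Fintype.card_congr ⟨Diagram.flip, Diagram.flip, Diagram.flip_flip, Diagram.flip_flip⟩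
  have hlt : Fintype.card {b : Diagram (k + k) 0 // b ≠ nestCap k} <
      Fintype.card (Diagram (k + k) 0) := Fintype.card_subtype_lt (x := nestCap k) (by simp)
  have hker : LinearMap.ker f ≠ ⊥ := by
    apply LinearMap.ker_ne_bot_of_finrank_lt
    rw [Module.finrank_fintype_fun_eq_card, Module.finrank_finsupp_self, ← hcard]
    exact hlt
  obtain ⟨y, hy, hy0⟩ := (Submodule.ne_bot_iff _).mp hker
  exact ⟨y, hy0, fun b hb => congrFun (LinearMap.mem_ker.mp hy) ⟨b, hb⟩⟩

theorem pair_comp_inl {l m n : ℕ} (b : Diagram m n) (a : Diagram l m) {p q : Fin l}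
    (h : a.pair (Sum.inl p) = Sum.inl q) : (b.comp a).pair (Sum.inl p) = Sum.inl q := by
  refine (eq_partner b a _ _ ?_ ?_).symm
  · intro hqp
    exact a.pair_ne (Sum.inl p) (h.trans (congrArg Sum.inl (Sum.inl_injective hqp)))
  · have h1 : curve b a (upper (Sum.inl p)) = curve b a (upper (a.pair (Sum.inl p))) :=
      Quot.sound (Link.up (Sum.inl p))
    rw [h] at h1
    exact h1.symm

theorem pair_capAt {N M : ℕ} (h : N = M + 2) (i : ℕ) (hi : i ≤ M) :
    (capAt h i hi).pair (Sum.inl ⟨i, by omega⟩) = Sum.inl ⟨i + 1, by omega⟩ := by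
  simp [capAt]

/-- Morphisms from `0` with zero pairing against all diagrams are negligible. -/
theorem mem_negligible_of_diagrams {d : K} {N : ℕ} {x : Hom K 0 N}
    (h : ∀ b : Diagram N 0, trace d (comp d ((LoopDiagram.of b).toHom d) x) = 0) :
    x ∈ negligible d 0 N := by
  intro b
  rw [trace_comp_comm]
  induction b using hom_induction d with
  | h0 => simp
  | hadd u v hu hv => simp [hu, hv]
  | hsmul r u hu => simp [hu]
  | h D => exact h D

/-- A morphism orthogonal to all diagrams but the nested caps is singular: the
nested caps factor through no cap but the middle one, so that the other caps send it to negligible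
morphisms on too few points. -/
theorem singular_of_orthogonal [CharZero K] {τ : K} (hτ : τ ≠ 0) {k : ℕ}
    (hQ : IsPrimitiveRoot (τ ^ 2) (k + 1)) {y : Hom K 0 (k + k)}
    (hy : ∀ b : Diagram (k + k) 0, b ≠ nestCap k →
      trace (τ + τ⁻¹) (comp (τ + τ⁻¹) ((LoopDiagram.of b).toHom (τ + τ⁻¹)) y) = 0) :
    Singular (τ + τ⁻¹) y := by
  refine singular_of_halves hτ hQ y fun M h i hi hik => ?_
  rw [← Submodule.mem_bot K, ← negligible_eq_bot hτ (Nat.succ_pos k) hQ (N := M) (by omega)]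
  refine mem_negligible_of_diagrams fun b => ?_
  -- the composite joins `i` and `i + 1`, whereas the nested caps join `i` and `2 * k - 1 - i`
  rw [comp_assoc, capHom, ← LoopDiagram.toHom_comp]
  have h1 : ((LoopDiagram.of b).comp (.of (capAt h i hi))).diag ≠ nestCap k := by
    intro h2
    have h3 := pair_comp_inl b _ (pair_capAt h i hi)
    change (b.comp (capAt h i hi)) = _ at h2
    rw [h2] at h3
    have h4 := Sum.inl_injective h3
    rw [Fin.ext_iff, Fin.val_rev] at h4
    simp only at h4
    omega
  have h2 := hy _ h1
  rw [LoopDiagram.toHom_of] at h2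
  rw [LoopDiagram.toHom, ← mul_one ((τ + τ⁻¹) ^ _), ← Finsupp.smul_single', map_smul,
    LinearMap.smul_apply, map_smul, h2, smul_zero]

theorem pair_inl_of_flip_mate {N : ℕ} (b : Diagram N 0) {p q : Fin N} (h : b.flip.mate p = q) :
    b.pair (Sum.inl p) = Sum.inl q := by
  have h1 := b.flip.pair_inr p
  rw [h] at h1
  have h2 := congrArg Sum.swap h1
  simpa [Diagram.flip] using h2

/-- Singular morphisms are negligible, as every diagram to `0` joins two neighbouring points. -/
theorem Singular.mem_negligible {d : K} (hd : d ≠ 0) {N : ℕ} (hN : 0 < N) {x : Hom K 0 N}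
    (hs : Singular d x) : x ∈ negligible d 0 N := by
  refine mem_negligible_of_diagrams fun b => ?_
  obtain ⟨i, hi, -, -, hmate⟩ := b.flip.exists_adjacent_window 0 N le_rfl (by omega)
  obtain ⟨M, rfl⟩ : ∃ M, N = M + 2 := ⟨N - 2, by omega⟩
  have h1 := smul_comp_eq rfl i (by omega) d (LoopDiagram.of b) (pair_inl_of_flip_mate b hmate) x
  have h2 : comp d ((LoopDiagram.of (capAt rfl i (by omega))).toHom d) x = 0 :=
    hs M rfl i (by omega)
  rw [h2, map_zero, smul_eq_zero] at h1
  rw [h1.resolve_left hd, map_zero]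

theorem negligible_ne_bot [CharZero K] {τ : K} (hτ : τ ≠ 0) (hd : τ + τ⁻¹ ≠ 0) {k : ℕ}
    (hk : 0 < k) (hQ : IsPrimitiveRoot (τ ^ 2) (k + 1)) : negligible (τ + τ⁻¹) ≠ ⊥ := by
  intro h
  obtain ⟨y, hy0, hy⟩ := exists_orthogonal (τ + τ⁻¹) k
  have h1 := (singular_of_orthogonal hτ hQ hy).mem_negligible hd (by omega)
  rw [h] at h1
  exact hy0 ((Submodule.mem_bot K).mp h1)

end

/-! ### Uniqueness of the proper ideal -/

theorem LoopDiagram.compat_iff_mat_ne_zero {m n : ℕ} (a : LoopDiagram m n) (s : Fin m → Bool)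
    (t : Fin n → Bool) : Compat a.diag s t ↔ a.mat s t ≠ 0 := by
  rw [LoopDiagram.mat, Matrix.smul_apply, smul_eq_mul, mul_ne_zero_iff]
  constructor
  · intro h
    exact ⟨by positivity, by rw [colMat_eq_one h]; exact one_ne_zero⟩
  · exact fun h => compat_of_colMat_ne_zero h.2

/-- Every diagram but the nested caps joins two neighbours in the left half. -/
theorem Diagram.exists_adjacent_left {k : ℕ} {D : Diagram 0 (k + k)} (hD : D ≠ nestCup k) :
    ∃ (i : ℕ) (hi : i + 1 < k), D.mate ⟨i, by omega⟩ = ⟨i + 1, by omega⟩ := by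
  obtain ⟨p, h1, h2⟩ : ∃ p : Fin (k + k), p.1 < k ∧ (D.mate p).1 < k := by
    by_contra hcon
    push Not at hcon
    exact hD (D.eq_nestCup hcon)
  rcases lt_or_gt_of_ne (D.mate_ne p) with h3 | h3
  · obtain ⟨i, hi, -, h4, h5⟩ := D.exists_adjacent _ p h3 (D.mate_mate p)
    exact ⟨i, by omega, h5⟩
  · obtain ⟨i, hi, -, h4, h5⟩ := D.exists_adjacent p _ h3 rfl
    exact ⟨i, by omega, h5⟩

/-- Bending the left half of the bottom edge up turns neighbours on the bottom edge into neighbours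
on the top edge. -/
theorem pair_unbend_tensor {k r : ℕ} (D : Diagram 0 (k + k)) (i : ℕ) (hi : i + 1 < k)
    (h : D.mate ⟨i, by omega⟩ = ⟨i + 1, by omega⟩) :
    (((LoopDiagram.of D).unbend).tensor (LoopDiagram.one r)).diag.pair
      (Sum.inl ⟨k - 2 - i, by omega⟩) = Sum.inl ⟨k - 2 - i + 1, by omega⟩ := by
  apply pair_eq_of_forall_compat
  · simp
  · intro s t hst
    obtain ⟨s1, s2, rfl⟩ := exists_append s
    obtain ⟨t1, t2, rfl⟩ := exists_append t
    rw [LoopDiagram.compat_iff_mat_ne_zero, LoopDiagram.mat_tensor,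
      LoopDiagram.mat_unbend _ Fin.elim0, LoopDiagram.mat_of] at hst
    have h1 := Diagram.compat_mate (compat_of_colMat_ne_zero (left_ne_zero_of_mul hst))
      ⟨i, by omega⟩
    rw [h] at h1
    have e : ∀ (j : ℕ) (hj : j < k) (hj' : j < k + r),
        Fin.append s1 s2 ⟨j, hj'⟩ = s1 ⟨j, hj⟩ := fun j hj hj' =>
      Fin.append_left s1 s2 ⟨j, hj⟩
    have e' : ∀ (j : ℕ) (hj : j < k) (hj' : j < k + k),
        Fin.append (s1 ∘ Fin.rev) t1 ⟨j, hj'⟩ = s1 (Fin.rev ⟨j, hj⟩) := fun j hj hj' =>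
      Fin.append_left (s1 ∘ Fin.rev) t1 ⟨j, hj⟩
    rw [e' _ (by omega), e' _ (by omega)] at h1
    rw [Sum.elim_inl, Sum.elim_inl, e _ (by omega), e _ (by omega)]
    convert h1 using 2
    · rw [Fin.ext_iff, Fin.val_rev]
      simp only
      omega
    · rw [Fin.ext_iff, Fin.val_rev]
      simp only
      omega

theorem unbend_nestCup (k : ℕ) : (LoopDiagram.of (nestCup k)).unbend = LoopDiagram.one k := by
  rw [← LoopDiagram.bend_one, LoopDiagram.unbend_bend]

theorem one_tensor_one (k r : ℕ) :
    (LoopDiagram.one k).tensor (LoopDiagram.one r) = LoopDiagram.one (k + r) := by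
  apply LoopDiagram.mat_injective
  ext s t
  obtain ⟨s1, s2, rfl⟩ := exists_append s
  obtain ⟨t1, t2, rfl⟩ := exists_append t
  rw [LoopDiagram.mat_tensor, LoopDiagram.mat_one, LoopDiagram.mat_one, LoopDiagram.mat_one,
    Matrix.one_apply, Matrix.one_apply, Matrix.one_apply]
  simp only [LoopDiagram.append_inj_iff, ite_and]
  split_ifs <;> rfl

section

variable {K : Type*} [Field K] {d : K} {J : ∀ m n : ℕ, Submodule K (Hom K m n)}

/-- Composition of `a` with a bent morphism `x` is multiplication by the coefficient of `x` at the
nested cups, up to terms that factor through caps of `a`. -/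
theorem IsTensorIdeal.comp_unbendHom_sub_mem (hJ : IsTensorIdeal d J) (hd : d ≠ 0) {k r : ℕ}
    {a : Hom K 0 (k + r)} (ha : ∀ (M : ℕ) (h : k + r = M + 2) (i : ℕ) (hi : i ≤ M),
      comp d (capHom d h i hi) a ∈ J 0 M) (x : Hom K 0 (k + k)) :
    comp d (tensor (unbendHom d x) (idHom K r)) a - x (nestCup k) • a ∈ J 0 (k + r) := by
  induction x using hom_induction d with
  | h0 => simp [unbendHom]
  | hadd x y hx hy =>
    convert add_mem hx hy using 1
    simp only [unbendHom, map_add, LinearMap.add_apply, Finsupp.add_apply, add_smul]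
    abel
  | hsmul c x hx =>
    convert Submodule.smul_mem _ c hx using 1
    simp only [unbendHom, map_smul, LinearMap.smul_apply, Finsupp.smul_apply, smul_sub,
      smul_assoc]
  | h D =>
    rw [unbendHom_toHom, idHom_eq d r, ← LoopDiagram.one, ← LoopDiagram.toHom_tensor]
    by_cases hD : D = nestCup k
    · subst hD
      rw [unbend_nestCup, one_tensor_one, LoopDiagram.one, ← idHom_eq, idHom_comp,
        LoopDiagram.toHom_of, Finsupp.single_eq_same, one_smul, sub_self]
      exact zero_mem _
    · obtain ⟨i, hi, h1⟩ := Diagram.exists_adjacent_left hD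
      rw [LoopDiagram.toHom_of, Finsupp.single_eq_of_ne (Ne.symm hD), zero_smul, sub_zero,
        ← Submodule.smul_mem_iff _ hd,
        smul_comp_eq (M := k + r - 2) (by omega) (k - 2 - i) (by omega) d _
          (pair_unbend_tensor D i hi h1)]
      exact hJ.comp_left _ _ (ha _ _ _ _)

/-- If there are no non-zero negligible morphisms on fewer than `2 * k` points, an ideal contains
all negligible morphisms as soon as it contains a morphism on `2 * k` points that involves the
nested cups. -/
theorem IsTensorIdeal.negligible_le (hJ : IsTensorIdeal d J) (hd : d ≠ 0) {k : ℕ}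
    (hbot : ∀ N < k + k, negligible d 0 N = ⊥) {z : Hom K 0 (k + k)} (hz : z ∈ J 0 (k + k))
    (hz0 : z (nestCup k) ≠ 0) (N : ℕ) : negligible d 0 N ≤ J 0 N := by
  induction N using Nat.strong_induction_on with
  | _ N ih =>
  intro a ha
  by_cases hN : N < k + k
  · rw [hbot N hN, Submodule.mem_bot] at ha
    rw [ha]
    exact zero_mem _
  · obtain ⟨r, rfl⟩ : ∃ r, N = k + r := ⟨N - k, by omega⟩
    have h1 := hJ.comp_unbendHom_sub_mem hd (a := a) (fun M h i hi =>
      ih M (by omega) ((isTensorIdeal_negligible d).comp_left _ _ ha)) z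
    have h2 : comp d (tensor (unbendHom d z) (idHom K r)) a ∈ J 0 (k + r) :=
      hJ.comp_right _ _ (hJ.tensor_right _ _ (hJ.unbendHom_mem hz))
    have h3 := sub_mem h2 h1
    rw [sub_sub_cancel] at h3
    exact (Submodule.smul_mem_iff _ hz0).mp h3

theorem IsTensorIdeal.eq_negligible [CharZero K] {τ : K} (hτ : τ ≠ 0) (hd : τ + τ⁻¹ ≠ 0) {k : ℕ}
    (hQ : IsPrimitiveRoot (τ ^ 2) (k + 1)) (hJ : IsTensorIdeal (τ + τ⁻¹) J) (hbot : J ≠ ⊥)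
    (htop : J ≠ ⊤) : J = negligible (τ + τ⁻¹) := by
  obtain ⟨k', z, hz, hz0, hs, -⟩ := hJ.exists_singular hbot
  have hk' : 0 < k' := by
    rw [Nat.pos_iff_ne_zero]
    rintro rfl
    exact htop (hJ.eq_top_of_zero_zero ((Submodule.ne_bot_iff _).mpr ⟨z, hz, hz0⟩))
  obtain rfl : k' = k := Nat.succ_injective (hs.add_one_eq hτ (Nat.succ_pos k) hQ hz0 hk')
  funext m n
  refine le_antisymm (hJ.le_negligible htop m n) fun a ha => hJ.mem_of_bendHom_mem ?_
  exact hJ.negligible_le hd (fun N hN => negligible_eq_bot hτ (Nat.succ_pos k') hQ (by omega)) hz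
    (hs.apply_nestCup_ne_zero τ hτ hz0) _ ((isTensorIdeal_negligible _).bendHom_mem ha)

end

/-! ### The parameters -/

theorem add_inv_eq_add_inv {K : Type*} [Field K] {τ σ : K} (hτ : τ ≠ 0) (hσ : σ ≠ 0)
    (h : τ + τ⁻¹ = σ + σ⁻¹) : τ = σ ∨ τ = σ⁻¹ := by
  have h1 : (τ - σ) * (τ - σ⁻¹) = 0 := by
    field_simp at h ⊢
    linear_combination h
  exact (mul_eq_zero.mp h1).imp sub_eq_zero.mp sub_eq_zero.mp

theorem add_inv_ne_zero {K : Type*} [Field K] {τ : K} (hτ : τ ≠ 0) {n : ℕ} (hn : 3 ≤ n)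
    (hQ : IsPrimitiveRoot (τ ^ 2) n) : τ + τ⁻¹ ≠ 0 := by
  intro h
  have h1 : τ ^ 2 = -1 := by
    field_simp at h
    linear_combination h
  have h2 : n ∣ 2 := hQ.dvd_of_pow_eq_one 2 (by rw [h1]; ring)
  have := Nat.le_of_dvd two_pos h2
  omega

theorem two_cos_eq (x : ℝ) : ((2 * Real.cos x : ℝ) : ℂ) =
    Complex.exp (x * Complex.I) + (Complex.exp (x * Complex.I))⁻¹ := by
  rw [← Complex.exp_neg, ← neg_mul, Complex.ofReal_mul, Complex.ofReal_cos, Complex.ofReal_ofNat,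
    Complex.two_cos]

theorem exp_sq_eq (j : ℤ) (n : ℕ) :
    Complex.exp ((j * Real.pi / n : ℝ) * Complex.I) ^ 2 =
      Complex.exp (2 * Real.pi * Complex.I / n) ^ j := by
  rw [← Complex.exp_nat_mul, ← Complex.exp_int_mul]
  congr 1
  push_cast
  ring

/-- `τ + τ⁻¹` is special if and only if `τ ^ 2` is a root of unity of order at least three. -/
theorem isSpecialValue_iff {τ : ℂ} (hτ : τ ≠ 0) :
    IsSpecialValue (τ + τ⁻¹) ↔ ∃ n, 3 ≤ n ∧ IsPrimitiveRoot (τ ^ 2) n := by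
  constructor
  · rintro ⟨n, j, hn, hj, h⟩
    refine ⟨n, hn, ?_⟩
    have hprim : IsPrimitiveRoot (Complex.exp ((j * Real.pi / n : ℝ) * Complex.I) ^ 2) n := by
      rw [exp_sq_eq]
      exact (Complex.isPrimitiveRoot_exp n (by omega)).zpow_of_gcd_eq_one j
        (Int.isCoprime_iff_gcd_eq_one.mp hj)
    rw [two_cos_eq] at h
    rcases add_inv_eq_add_inv hτ (Complex.exp_ne_zero _) h with rfl | rfl
    · exact hprim
    · rw [inv_pow]
      exact hprim.inv
  · rintro ⟨n, hn, hQ⟩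
    obtain ⟨a, -, ha, h⟩ := (Complex.isPrimitiveRoot_iff _ n (by omega)).mp hQ
    have hn0 : (n : ℝ) ≠ 0 := by
      have : n ≠ 0 := by omega
      exact_mod_cast this
    have hcop : IsCoprime (a : ℤ) (n : ℤ) := Nat.isCoprime_iff_coprime.mpr ha
    have h1 : τ ^ 2 = Complex.exp (((a : ℤ) * Real.pi / n : ℝ) * Complex.I) ^ 2 := by
      rw [← h, ← Complex.exp_nat_mul]
      congr 1
      push_cast
      ring
    rcases sq_eq_sq_iff_eq_or_eq_neg.mp h1 with h2 | h2
    · exact ⟨n, a, hn, hcop, by rw [two_cos_eq, ← h2]⟩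
    · -- the sign is absorbed by a half turn
      refine ⟨n, a + n, hn, ?_, ?_⟩
      · simpa using hcop.add_mul_right_left 1
      · have h3 : (((a + n : ℤ) : ℝ) * Real.pi / n) = ((a : ℤ) * Real.pi / n : ℝ) + Real.pi := by
          push_cast
          field_simp
        rw [two_cos_eq, h3, Complex.ofReal_add, add_mul, Complex.exp_add, Complex.exp_pi_mul_I,
          mul_neg_one, ← h2]

theorem isProperRootOfUnity_iff {τ : ℂ} :
    IsProperRootOfUnity τ ↔ ∃ n, 3 ≤ n ∧ IsPrimitiveRoot (τ ^ 2) n := by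
  constructor
  · rintro ⟨⟨k, hk, h⟩, h1, h2, h3, h4⟩
    have h0 : 0 < orderOf (τ ^ 2) :=
      orderOf_pos_iff.mpr (isOfFinOrder_iff_pow_eq_one.mpr
        ⟨k, hk, by rw [← pow_mul, mul_comm, pow_mul, h, one_pow]⟩)
    refine ⟨orderOf (τ ^ 2), ?_, IsPrimitiveRoot.orderOf _⟩
    by_contra hlt
    have h5 : τ ^ 2 ≠ 1 := by
      intro h5
      rcases sq_eq_one_iff.mp h5 with h6 | h6
      · exact h1 h6
      · exact h2 h6
    have h6 : orderOf (τ ^ 2) ≠ 1 := fun h6 => h5 (orderOf_eq_one_iff.mp h6)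
    have h7 : (τ ^ 2) ^ 2 = 1 := by
      rw [← pow_orderOf_eq_one (τ ^ 2)]
      congr 1
      omega
    rcases sq_eq_one_iff.mp h7 with h8 | h8
    · exact h5 h8
    · rw [← Complex.I_sq] at h8
      rcases sq_eq_sq_iff_eq_or_eq_neg.mp h8 with h9 | h9
      · exact h3 h9
      · exact h4 h9
  · rintro ⟨n, hn, hQ⟩
    have key : (τ ^ 2) ^ 2 ≠ 1 := by
      intro h
      have := Nat.le_of_dvd two_pos (hQ.dvd_of_pow_eq_one 2 h)
      omega
    refine ⟨⟨2 * n, by omega, by rw [pow_mul, hQ.pow_eq_one]⟩, ?_, ?_, ?_, ?_⟩ <;>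
      rintro rfl <;> simp at key

theorem exists_eq_add_inv (d : ℂ) : ∃ τ, τ ≠ 0 ∧ d = τ + τ⁻¹ := by
  obtain ⟨s, hs⟩ := IsAlgClosed.exists_pow_nat_eq (d ^ 2 - 4) two_pos
  have h1 : (d + s) / 2 * ((d - s) / 2) = 1 := by linear_combination -hs / 4
  refine ⟨(d + s) / 2, left_ne_zero_of_mul_eq_one h1, ?_⟩
  rw [← eq_inv_of_mul_eq_one_right h1]
  ring

theorem geom_sum_ne_zero_of_not_isSpecialValue {τ : ℂ} (hτ : τ ≠ 0) (hd : τ + τ⁻¹ ≠ 0)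
    (hs : ¬ IsSpecialValue (τ + τ⁻¹)) (k : ℕ) (hk : 0 < k) :
    ∑ p ∈ Finset.range (k + 1), (τ ^ 2) ^ p ≠ 0 := by
  intro h
  have h1 := geom_sum_mul (τ ^ 2) (k + 1)
  rw [h, zero_mul, eq_comm, sub_eq_zero] at h1
  have h2 : τ ^ 2 ≠ 1 := by
    intro h2
    simp only [h2, one_pow, Finset.sum_const, Finset.card_range, nsmul_eq_mul, mul_one] at h
    exact Nat.cast_ne_zero.mpr (Nat.succ_ne_zero k) h
  have h3 : τ ^ 2 ≠ -1 := by
    intro h3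
    apply hd
    field_simp
    linear_combination h3
  refine hs ((isSpecialValue_iff hτ).mpr (isProperRootOfUnity_iff.mp
    ⟨⟨2 * (k + 1), by omega, by rw [pow_mul, h1]⟩, ?_, ?_, ?_, ?_⟩)) <;>
    rintro rfl <;> simp at h2 h3

theorem geom_sum_X_ne_zero (k : ℕ) :
    ∑ p ∈ Finset.range (k + 1), ((RatFunc.X : RatFunc ℂ) ^ 2) ^ p ≠ 0 := by
  intro h
  have h1 := geom_sum_mul ((RatFunc.X : RatFunc ℂ) ^ 2) (k + 1)
  rw [h, zero_mul, eq_comm, sub_eq_zero, ← pow_mul, ← RatFunc.algebraMap_X, ← map_pow,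
    ← map_one (algebraMap (Polynomial ℂ) (RatFunc ℂ))] at h1
  have h2 := congrArg Polynomial.natDegree (RatFunc.algebraMap_injective ℂ h1)
  simp at h2

end TemperleyLieb

theorem mainTheorem1 :
    -- special values of `d`: the negligible morphisms form the only non-zero proper ideal
    (∀ d : ℂ, TemperleyLieb.IsSpecialValue d →
      ∀ J : (∀ m n : ℕ, Submodule ℂ (TemperleyLieb.Hom ℂ m n)),
        (TemperleyLieb.IsTensorIdeal d J ∧ J ≠ ⊥ ∧ J ≠ ⊤) ↔ J = TemperleyLieb.negligible d) ∧
    -- all other non-zero values of `d`: no non-zero proper ideal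
    (∀ d : ℂ, d ≠ 0 → ¬ TemperleyLieb.IsSpecialValue d →
      ∀ J : (∀ m n : ℕ, Submodule ℂ (TemperleyLieb.Hom ℂ m n)),
        TemperleyLieb.IsTensorIdeal d J → J = ⊥ ∨ J = ⊤) ∧
    -- the generic category over `ℂ(t)`, with `d = t + t⁻¹`: no non-zero proper ideal
    (∀ J : (∀ m n : ℕ, Submodule (RatFunc ℂ) (TemperleyLieb.Hom (RatFunc ℂ) m n)),
      TemperleyLieb.IsTensorIdeal (RatFunc.X + RatFunc.X⁻¹ : RatFunc ℂ) J → J = ⊥ ∨ J = ⊤) ∧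
    -- in terms of `τ` with `d = τ + τ⁻¹`, the special values come from the proper roots of unity
    (∀ τ : ℂ, τ ≠ 0 →
      (TemperleyLieb.IsSpecialValue (τ + τ⁻¹) ↔ TemperleyLieb.IsProperRootOfUnity τ)) := by

  refine ⟨?_, ?_, ?_, ?_⟩
  · intro d hd J
    obtain ⟨τ, hτ, rfl⟩ := TemperleyLieb.exists_eq_add_inv d
    obtain ⟨n, hn, hQ⟩ := (TemperleyLieb.isSpecialValue_iff hτ).mp hd
    have hd0 := TemperleyLieb.add_inv_ne_zero hτ hn hQ
    obtain ⟨k, rfl⟩ : ∃ k, n = k + 1 := ⟨n - 1, by omega⟩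
    constructor
    · rintro ⟨hJ, hbot, htop⟩
      exact hJ.eq_negligible hτ hd0 hQ hbot htop
    · rintro rfl
      exact ⟨TemperleyLieb.isTensorIdeal_negligible _,
        TemperleyLieb.negligible_ne_bot hτ hd0 (by omega) hQ, TemperleyLieb.negligible_ne_top _⟩
  · intro d hd hs J hJ
    obtain ⟨τ, hτ, rfl⟩ := TemperleyLieb.exists_eq_add_inv d
    exact hJ.eq_bot_or_eq_top hτ (TemperleyLieb.geom_sum_ne_zero_of_not_isSpecialValue hτ hd hs)
  · intro J hJ
    exact hJ.eq_bot_or_eq_top RatFunc.X_ne_zero fun k _ => TemperleyLieb.geom_sum_X_ne_zero k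
  · intro τ hτ
    rw [TemperleyLieb.isSpecialValue_iff hτ, TemperleyLieb.isProperRootOfUnity_iff]
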